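/- Let $X\subset\mathbb{P}^N$ be a smooth complete intersection over $\mathbb{C}$ of hypersurfaces of degrees $d_1,\ldots,d_k\geqslant 1$ (with $k\geqslant 0$), i.e. $X=\mathrm{Proj}\,\mathbb{C}[x_0,\ldots,x_N]/(f_1,\ldots,f_k)$ with $f_i$ homogeneous of degree $d_i$, and $X$ is smooth of dimension $n=N-k\geqslant 0$. Assume that $X$ is Fano, i.e. that its Fano index $i_X:=N+1-\sum_{i=1}^k d_i$ is at least $1$. Let $$ \mathsf{p}=\frac{\prod_{i=1}^k(x_{i,1}+\ldots+x_{i,d_i-1}+1)^{d_i}}{\prod_{i=1}^k\prod_{j=1}^{d_i-1}x_{i,j}\,\prod_{s=1}^{i_X-1}y_s}+y_1+\ldots+y_{i_X-1}\in\mathbb{C}\big[x_{i,j}^{\pm1},y_s^{\pm1}\big] $$ be Givental's Laurent polynomial in $\sum_{i}(d_i-1)+(i_X-1)=n$ variables, let $\Delta\subset\mathbb{R}^n$ be its Newton polytope (the convex hull of the exponents of its monomials), and let $$ \nabla=\big\{x\in\mathbb{R}^n\ \big|\ \langle x,y\rangle\geqslant-1\ \text{for all}\ y\in\Delta\big\}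 $$ be the dual polytope. Let $r_X$ be the number of points of $\mathbb{Z}^n$ on the boundary $\partial\nabla$. Then $r_X$ and $h^0(\mathcal{O}_X(-K_X))$ are finite, and $$ r_X=h^0\big(\mathcal{O}_X(-K_X)\big)-1, $$ where $\mathcal{O}_X(-K_X)$ is the dual of the canonical sheaf $\Omega_X^n$ and $h^0$ is the dimension over $\mathbb{C}$ of its space of global sections. -/

import Mathlib

open AlgebraicGeometry CategoryTheory MvPolynomial
open scoped DirectSum

attribute [local instance] MvPolynomial.gradedAlgebra

noncomputable section

/-! ### The grading on the quotient of a graded algebra by a homogeneous ideal -/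

section QuotientGrading

variable {R A : Type} [CommRing R] [CommRing A] [Algebra R A] {𝒜 : ℕ → Submodule R A}
  [GradedAlgebra 𝒜]

/-- The degree `n` part of `A ⧸ I` is the image of the degree `n` part of `A`. -/
def quotientGrading (I : HomogeneousIdeal 𝒜) (n : ℕ) : Submodule R (A ⧸ I.toIdeal) :=
  (𝒜 n).map (Ideal.Quotient.mkₐ R I.toIdeal).toLinearMap

theorem mk_mem_quotientGrading (I : HomogeneousIdeal 𝒜) {n : ℕ} {a : A} (ha : a ∈ 𝒜 n) :
    Ideal.Quotient.mk I.toIdeal a ∈ quotientGrading I n :=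
  ⟨a, ha, rfl⟩

instance quotientGrading.gradedMonoid (I : HomogeneousIdeal 𝒜) :
    SetLike.GradedMonoid (quotientGrading I) where
  one_mem := mk_mem_quotientGrading I (SetLike.GradedOne.one_mem (A := 𝒜))
  mul_mem := by
    rintro i j _ _ ⟨a, ha, rfl⟩ ⟨b, hb, rfl⟩
    exact mk_mem_quotientGrading I (SetLike.GradedMul.mul_mem ha hb)

/-- Auxiliary map: the image of the decomposition of `a` in `A`. -/
def quotientDecomposeAux (I : HomogeneousIdeal 𝒜) : A →+ ⨁ n, quotientGrading I n :=
  (DirectSum.map (fun n ↦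
    ({ toFun := fun a ↦ ⟨Ideal.Quotient.mk I.toIdeal (a : A), mk_mem_quotientGrading I a.2⟩
       map_zero' := by ext; simp
       map_add' := fun a b ↦ by ext; simp } : 𝒜 n →+ quotientGrading I n))).comp
    (DirectSum.decomposeAddEquiv 𝒜).toAddMonoidHom

theorem quotientDecomposeAux_of_mem (I : HomogeneousIdeal 𝒜) {n : ℕ} {a : A} (ha : a ∈ 𝒜 n) :
    quotientDecomposeAux I a = DirectSum.of (fun n ↦ quotientGrading I n) n
      ⟨Ideal.Quotient.mk I.toIdeal a, mk_mem_quotientGrading I ha⟩ := by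
  simp [quotientDecomposeAux, DirectSum.decompose_of_mem 𝒜 ha, DirectSum.map_of]

theorem quotientDecomposeAux_eq_zero (I : HomogeneousIdeal 𝒜) {a : A} (ha : a ∈ I.toIdeal) :
    quotientDecomposeAux I a = 0 := by
  refine DFinsupp.ext fun n ↦ Subtype.ext ?_
  change Ideal.Quotient.mk I.toIdeal (DirectSum.decompose 𝒜 a n : A) = 0
  exact Ideal.Quotient.eq_zero_iff_mem.mpr (I.isHomogeneous n ha)

/-- Auxiliary map: the decomposition of an element of `A ⧸ I`. -/
def quotientDecompose (I : HomogeneousIdeal 𝒜) : A ⧸ I.toIdeal →+ ⨁ n, quotientGrading I n :=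
  QuotientAddGroup.lift (Submodule.toAddSubgroup I.toIdeal) (quotientDecomposeAux I)
    (fun _ ha ↦ AddMonoidHom.mem_ker.mpr (quotientDecomposeAux_eq_zero I ha))

theorem quotientDecompose_mk (I : HomogeneousIdeal 𝒜) (a : A) :
    quotientDecompose I (Ideal.Quotient.mk I.toIdeal a) = quotientDecomposeAux I a :=
  rfl

instance quotientGrading.decomposition (I : HomogeneousIdeal 𝒜) :
    DirectSum.Decomposition (quotientGrading I) :=
  DirectSum.Decomposition.ofAddHom (quotientGrading I) (quotientDecompose I)
    (by
      refine AddMonoidHom.ext fun x ↦ ?_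
      obtain ⟨a, rfl⟩ := Ideal.Quotient.mk_surjective x
      simp only [AddMonoidHom.comp_apply, AddMonoidHom.id_apply, quotientDecompose_mk]
      induction a using DirectSum.Decomposition.inductionOn 𝒜 with
      | zero => simp
      | homogeneous a => rw [quotientDecomposeAux_of_mem I a.2]; simp
      | add a b ha hb => rw [map_add, map_add, map_add, ha, hb])
    (by
      refine DirectSum.addHom_ext fun n x ↦ ?_
      obtain ⟨_, a, ha, rfl⟩ := x
      simp only [AddMonoidHom.comp_apply, AddMonoidHom.id_apply,
        DirectSum.coeAddMonoidHom_of]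
      exact quotientDecomposeAux_of_mem I ha)

instance quotientGrading.gradedAlgebra (I : HomogeneousIdeal 𝒜) :
    GradedAlgebra (quotientGrading I) where

end QuotientGrading

/-! ### Closed subschemes of projective space -/

/-- The homogeneous ideal generated by homogeneous polynomials `f₁, …, f_k` in `N + 1`
variables. -/
def hypersurfacesIdeal {N k : ℕ} (d : Fin k → ℕ) (f : Fin k → MvPolynomial (Fin (N + 1)) ℂ)
    (hf : ∀ i, (f i).IsHomogeneous (d i)) :
    HomogeneousIdeal (homogeneousSubmodule (Fin (N + 1)) ℂ) where
  toSubmodule := Ideal.span (Set.range f)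
  is_homogeneous' := Ideal.homogeneous_span _ _ (by
    rintro _ ⟨i, rfl⟩
    exact ⟨d i, hf i⟩)

/-- The scheme-theoretic intersection in `ℙ^N` of the hypersurfaces `f₁ = 0, …, f_k = 0`, that is
`Proj (ℂ[x₀, …, x_N] / (f₁, …, f_k))`. -/
def hypersurfacesIntersection {N k : ℕ} (d : Fin k → ℕ)
    (f : Fin k → MvPolynomial (Fin (N + 1)) ℂ) (hf : ∀ i, (f i).IsHomogeneous (d i)) : Scheme :=
  Proj (quotientGrading (hypersurfacesIdeal d f hf))

/-- The structure morphism of the intersection to `Spec ℂ`. -/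
instance hypersurfacesIntersection.over {N k : ℕ} (d : Fin k → ℕ)
    (f : Fin k → MvPolynomial (Fin (N + 1)) ℂ) (hf : ∀ i, (f i).IsHomogeneous (d i)) :
    (hypersurfacesIntersection d f hf).Over (Spec (CommRingCat.of ℂ)) where
  hom := Proj.toSpecZero (quotientGrading (hypersurfacesIdeal d f hf)) ≫
    Spec.map (CommRingCat.ofHom
      (algebraMap ℂ (quotientGrading (hypersurfacesIdeal d f hf) 0)))

/-! ### Global sections of the anticanonical sheaf -/

/-- The `ℂ`-algebra structure on the functions on an open subset of a scheme over `ℂ`. -/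
instance sectionsAlgebra (X : Scheme) [X.Over (Spec (CommRingCat.of ℂ))] (U : X.Opens) :
    Algebra ℂ Γ(X, U) :=
  ((Scheme.ΓSpecIso (CommRingCat.of ℂ)).inv ≫ (X ↘ Spec (CommRingCat.of ℂ)).appTop ≫
    X.presheaf.map (homOfLE (le_top : U ≤ ⊤)).op).hom.toAlgebra

/-- The module of sections over an affine open `U` of the sheaf of differential `n`-forms
`Ω_X^n`. If `X` is smooth of dimension `n`, this is the canonical sheaf `𝒪_X(K_X)`. -/
abbrev TopForms (X : Scheme) [X.Over (Spec (CommRingCat.of ℂ))] (n : ℕ) (U : X.affineOpens) :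
    Type :=
  ⋀[Γ(X, (U : X.Opens))]^n (KaehlerDifferential ℂ Γ(X, (U : X.Opens)))

/-- The form `da₁ ∧ … ∧ daₙ` over an affine open `U`. -/
def wedgeD (X : Scheme) [X.Over (Spec (CommRingCat.of ℂ))] (n : ℕ) (U : X.affineOpens)
    (a : Fin n → Γ(X, (U : X.Opens))) : TopForms X n U :=
  exteriorPower.ιMulti Γ(X, (U : X.Opens)) n (fun i ↦ KaehlerDifferential.D ℂ _ (a i))

/-- The space `H⁰(X, 𝓗om(Ω_X^n, 𝒪_X))`, which is `H⁰(X, 𝒪_X(-K_X))` if `X` is smooth of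
dimension `n`. A section is a family of linear forms on the modules of `n`-forms over the affine
open subsets `U` of `X`, compatible with restriction from `U` to `V ⊆ U`. As the forms
`da₁ ∧ … ∧ daₙ` span the module of `n`-forms, the compatibility is tested on these. -/
def anticanonicalSections (X : Scheme) [X.Over (Spec (CommRingCat.of ℂ))] (n : ℕ) :
    Submodule ℂ (∀ U : X.affineOpens, Module.Dual Γ(X, (U : X.Opens)) (TopForms X n U)) where
  carrier := {s | ∀ (U V : X.affineOpens) (h : (V : X.Opens) ≤ (U : X.Opens))
    (a : Fin n → Γ(X, (U : X.Opens))),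
      s V (wedgeD X n V (fun i ↦ X.presheaf.map (homOfLE h).op (a i))) =
        X.presheaf.map (homOfLE h).op (s U (wedgeD X n U a))}
  zero_mem' := by
    intro U V h a
    simp
  add_mem' := by
    intro s t hs ht U V h a
    simp [hs U V h a, ht U V h a]
  smul_mem' := by
    intro c s hs U V h a
    have key : X.presheaf.map (homOfLE h).op (algebraMap ℂ Γ(X, (U : X.Opens)) c) =
        algebraMap ℂ Γ(X, (V : X.Opens)) c := by
      change ((Scheme.ΓSpecIso (CommRingCat.of ℂ)).inv ≫ (X ↘ Spec (CommRingCat.of ℂ)).appTop ≫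
        X.presheaf.map (homOfLE (le_top : (U : X.Opens) ≤ ⊤)).op ≫
          X.presheaf.map (homOfLE h).op).hom c = _
      rw [← Functor.map_comp]
      rfl
    simp only [Pi.smul_apply, LinearMap.smul_apply, Algebra.smul_def, map_mul, key, hs U V h a]

/-! ### Givental's Laurent polynomial and the dual polytope -/

/-- The index set of the variables `x_{i,j}` (`1 ≤ i ≤ k`, `1 ≤ j ≤ d_i - 1`) and `y_s`
(`1 ≤ s ≤ m - 1`). -/
abbrev GiventalVar {k : ℕ} (d : Fin k → ℕ) (m : ℕ) : Type :=
  (Σ i : Fin k, Fin (d i - 1)) ⊕ Fin (m - 1)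

/-- A variable, as an element of the ring of Laurent polynomials `ℂ[ℤ^σ]`. -/
def laurentVar {σ : Type} [DecidableEq σ] (v : σ) : AddMonoidAlgebra ℂ (σ → ℤ) :=
  AddMonoidAlgebra.single (Pi.single v 1) 1

/-- The inverse of a variable in the ring of Laurent polynomials. -/
def laurentVarInv {σ : Type} [DecidableEq σ] (v : σ) : AddMonoidAlgebra ℂ (σ → ℤ) :=
  AddMonoidAlgebra.single (Pi.single v (-1)) 1

/-- Givental's Laurent polynomial
`∏ᵢ (x_{i,1} + … + x_{i,dᵢ-1} + 1)^{dᵢ} / (∏ᵢ ∏ⱼ x_{i,j} · ∏ₛ y_s) + y_1 + … + y_{m-1}`. -/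
def giventalPolynomial {k : ℕ} (d : Fin k → ℕ) (m : ℕ) :
    AddMonoidAlgebra ℂ (GiventalVar d m → ℤ) :=
  (∏ i, ((∑ j, laurentVar (.inl ⟨i, j⟩)) + 1) ^ d i) *
      ((∏ i, ∏ j, laurentVarInv (.inl ⟨i, j⟩)) * ∏ s, laurentVarInv (.inr s)) +
    ∑ s, laurentVar (.inr s)

/-- The point of `ℝ^σ` with given integral coordinates. -/
def latticePoint {σ : Type} (a : σ → ℤ) : σ → ℝ := fun v ↦ (a v : ℝ)

/-- The Newton polytope of a Laurent polynomial: the convex hull of the exponents of its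
monomials. -/
def newtonPolytope {σ : Type} (p : AddMonoidAlgebra ℂ (σ → ℤ)) : Set (σ → ℝ) :=
  convexHull ℝ (latticePoint '' {a : σ → ℤ | p.coeff a ≠ 0})

/-- The dual `{x | ⟨x, y⟩ ≥ -1 for all y ∈ Δ}` of `Δ`. -/
def dualPolytope {σ : Type} [Fintype σ] (Δ : Set (σ → ℝ)) : Set (σ → ℝ) :=
  {x | ∀ y ∈ Δ, -1 ≤ ∑ v, x v * y v}

/-- The integral points on the boundary of a subset of `ℝ^σ`. -/
def boundaryLatticePoints {σ : Type} (P : Set (σ → ℝ)) : Set (σ → ℤ) :=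
  {a | latticePoint a ∈ frontier P}

end

/-!
Both sides count monomials. Write `m = i_X`, `S = ℂ[x₀, …, x_N] / (f₁, …, f_k)`, and let `S_m` be
the part of degree `m`. The dimension of `H⁰(X, 𝒪(-K_X))` is that of `S_m`, and this is the number
of monomials of degree `m` in `N + 1` variables which are divisible by none of the products of `k`
disjoint blocks of `d₁, …, d_k` variables. The lattice points of `∇` correspond to the same
monomials, and the origin is the only one in the interior.

*The homogeneous coordinate ring.* Smoothness makes the gradients of the `f_j` linearly independent
at every point of the affine cone except the vertex (`linearIndependent_gradient`). Away from the
vertex the cone therefore has at most the expected dimension `n + 1`, and a chain of primes ending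
at the vertex can be moved to another point, so the same holds at the vertex
(`height_le_of_jacobian`). As the local ring of affine space has depth `N + 1`, the `f_j` form a
regular sequence there and the local ring of the cone at the vertex has depth `n + 1`
(`isWeaklyRegular_of_supportDim_le`, `exists_isRegular_originRing`). Homogeneous ideals are detected
in the local ring at the vertex, so the `f_j` form a regular sequence of polynomials
(`mem_prefixIdeal_of_mul_mem`) and the Hilbert function of `S` satisfies the recursion of the count
of monomials (`finrank_quotientPart_prefixIdeal`). Depth at least two yields that forms given by
compatible fractions on the sets `X_i ≠ 0` come from polynomials (`exists_homogeneous`). In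
dimension zero the assumption `m ≥ 1` forces the equations to be linear, and `X` is a point.

*Anticanonical sections.* The isomorphism `𝒪(m) ≅ 𝒪(-K_X)` is written down explicitly. A polynomial
`a` of degree `m` sends `du₁ ∧ … ∧ duₙ` to `a det(∇f₁, …, ∇f_k, e_i, ∇u₁, …, ∇uₙ) / X_i`, with the
gradients of the `u_t` as functions of degree zero on the cone; by Euler's identity this does not
depend on `i` (`mul_frameDet_comm`), and it has degree zero because `m = N + 1 - ∑ d_j`. It is well
defined at each point since the gradient is a derivation modulo the gradients of the equations
(`exists_pointForm`), and the values at the points glue (`exists_isGradientForm`,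
`gradientSection`). On `X_i ≠ 0` the minors `δ_K = det(∇f₁, …, ∇f_k, e_i, e_{K(1)}, …, e_{K(n)})`
have no common zero on `X`, and by Cramer's rule the differentials of `X_{K(t)} / X_i` span all
differentials where `δ_K ≠ 0`. So every form is a multiple of the one defined by `X_i^m`
(`exists_eq_smul_gradientForm`), and the multipliers of a section glue to a polynomial
(`gradientSection_surjective`). A polynomial defines the zero section precisely if it lies in the
ideal (`gradientSection_eq_iff`).

*The polytope.* As Givental's polynomial has nonnegative coefficients, the minimum of a linear form
over its exponents is computed by tropicalization: at a lattice point `p` with coordinates `x_{i,j}`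
and `y_s` it is the minimum of the `y_s` and `∑_i (d_i μ_i - ∑_j x_{i,j}) - ∑_s y_s`, where
`μ_i = min(0, min_j x_{i,j})` (`isTropicalValue_giventalPolynomial`). Subtracting `μ_i` from
`0, x_{i,1}, …, x_{i,d_i-1}` gives the exponents of a monomial in a block of `d_i` variables, not
all of them positive; adding `1` to the `y_s` and to the displayed value gives those of the
remaining `m` variables, and the degree is then `m`. This is the bijection between the lattice
points of `∇` and the monomials (`bijOn_pointOfMonomial`).
-/

noncomputable section

/-! ### Depth and regular sequences over local rings -/

section Depth

open IsLocalRing RingTheory.Sequence Abelian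
open scoped Pointwise

variable {R : Type} [CommRing R] [IsLocalRing R] [IsNoetherianRing R]

/-- The depth of a module drops by at most one on passing to the quotient by a regular element. -/
theorem exists_isRegular_quotSMulTop {M : Type} [AddCommGroup M] [Module R M] [Module.Finite R M]
    [Nontrivial M] {x : R} (hx : IsSMulRegular M x) (hxm : x ∈ maximalIdeal R) {rs : List R}
    (mem : ∀ r ∈ rs, r ∈ maximalIdeal R) (reg : IsRegular M rs) {n : ℕ} (hn : rs.length = n + 1) :
    ∃ rs' : List R, rs'.length = n ∧ (∀ r ∈ rs', r ∈ maximalIdeal R) ∧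
      IsRegular (QuotSMulTop x M) rs' := by
  have lt : ∀ (L : Type) [AddCommGroup L] [Module R L] [Module.Finite R L] [Nontrivial L],
      maximalIdeal R • (⊤ : Submodule R L) < ⊤ := by
    intro L _ _ _ _
    refine lt_top_iff_ne_top.mpr fun h ↦ ?_
    exact Submodule.top_ne_ideal_smul_of_le_jacobson_annihilator
      ((maximalIdeal_le_jacobson _)) h.symm
  have : Nontrivial (QuotSMulTop x M) := by
    refine Submodule.Quotient.nontrivial_iff.mpr fun h ↦ ?_
    have h1 := lt M
    rw [← Submodule.ideal_span_singleton_smul] at h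
    have h2 : Ideal.span {x} • (⊤ : Submodule R M) ≤ maximalIdeal R • ⊤ :=
      Submodule.smul_mono_left ((Ideal.span_singleton_le_iff_mem _).mpr hxm)
    rw [h] at h2
    exact h1.ne (top_le_iff.mp h2)
  let N : ModuleCat.{0} R := ModuleCat.of R (R ⧸ maximalIdeal R)
  have hN : Module.support R N = PrimeSpectrum.zeroLocus (maximalIdeal R) := by
    rw [Module.support_eq_zeroLocus]
    exact congrArg (fun I : Ideal R ↦ PrimeSpectrum.zeroLocus (I : Set R))
      Ideal.annihilator_quotient
  have : Module.Finite R N := inferInstanceAs (Module.Finite R (R ⧸ maximalIdeal R))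
  have ext : ∀ i < rs.length, Subsingleton (Ext N (ModuleCat.of R M) i) :=
    ModuleCat.subsingleton_ext_of_exists_isRegular (maximalIdeal R) N hN.subset
      (ModuleCat.of R M) (lt M) rs mem reg
  -- Depth is read off from the vanishing of `Ext` from the residue field; the long exact sequence
  -- of multiplication by `x` loses one degree.
  refine ModuleCat.exists_isRegular_of_exists_subsingleton_ext (maximalIdeal R) n
    (ModuleCat.of R (QuotSMulTop x M)) (lt _) N hN fun i hi ↦ ?_
  have zero1 := AddCommGrpCat.isZero_of_iff_subsingleton.mpr (ext i (by omega))
  have zero2 := AddCommGrpCat.isZero_of_iff_subsingleton.mpr (ext (i + 1) (by omega))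
  exact AddCommGrpCat.subsingleton_of_isZero <| ShortComplex.Exact.isZero_of_both_zeros
    ((Ext.covariant_sequence_exact₃' _
      (IsSMulRegular.smulShortComplex_shortExact (M := ModuleCat.of R M) hx)) i (i + 1) rfl)
    (zero1.eq_zero_of_src _) (zero2.eq_zero_of_tgt _)

/-- The depth of a module is at most the dimension of each of its associated primes. -/
theorem length_le_ringKrullDim_of_isAssociatedPrime (rs : List R) {M : Type} [AddCommGroup M]
    [Module R M] [Module.Finite R M] (mem : ∀ r ∈ rs, r ∈ maximalIdeal R)
    (reg : IsWeaklyRegular M rs) {p : Ideal R} (hp : IsAssociatedPrime p M) :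
    (rs.length : WithBot ℕ∞) ≤ ringKrullDim (R ⧸ p) := by
  induction rs generalizing M p with
  | nil =>
    have := hp.isPrime
    simpa using ringKrullDim_nonneg_of_nontrivial (R := R ⧸ p)
  | cons a rs ih =>
    rw [isWeaklyRegular_cons_iff] at reg
    obtain ⟨ha, reg⟩ := reg
    have hpp := hp.isPrime
    obtain ⟨-, x, hx⟩ := isAssociatedPrime_iff.mp hp
    have hmem : ∀ r, r ∈ p ↔ r • x = 0 := fun r ↦ by rw [hx]; simp
    have hap : a ∉ p := by
      intro h
      have h0 : a • x = a • 0 := by rw [(hmem a).mp h, smul_zero]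
      have : x = 0 := ha h0
      exact hpp.ne_top ((Ideal.eq_top_iff_one _).mpr ((hmem 1).mpr (by simp [this])))
    -- the submodule of elements killed by `p` is not contained in `a • M`
    let K : Submodule R M :=
      { carrier := {y | ∀ r ∈ p, r • y = 0}
        zero_mem' := by simp
        add_mem' := fun {y z} hy hz r hr ↦ by rw [smul_add, hy r hr, hz r hr, add_zero]
        smul_mem' := fun c y hy r hr ↦ by rw [smul_comm, hy r hr, smul_zero] }
    have hxK : x ∈ K := fun r hr ↦ (hmem r).mp hr
    have hx0 : x ≠ 0 := fun h ↦
      hpp.ne_top ((Ideal.eq_top_iff_one _).mpr ((hmem 1).mpr (by simp [h])))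
    obtain ⟨y, hyK, hy⟩ : ∃ y ∈ K, y ∉ (a • ⊤ : Submodule R M) := by
      by_contra! hcon
      have hle : K ≤ Ideal.span {a} • K := by
        intro y hy
        obtain ⟨z, -, rfl⟩ := (Submodule.mem_smul_pointwise_iff_exists _ _ _).mp (hcon y hy)
        rw [Submodule.ideal_span_singleton_smul]
        refine Submodule.smul_mem_pointwise_smul _ _ _ fun r hr ↦ ?_
        refine ha ?_
        change a • r • z = a • 0
        rw [smul_comm, hy r hr, smul_zero]
      have hbot := Submodule.eq_bot_of_le_smul_of_le_jacobson_bot _ K (IsNoetherian.noetherian K)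
        hle ((Ideal.span_singleton_le_iff_mem _).mpr
          (IsLocalRing.jacobson_eq_maximalIdeal (⊥ : Ideal R) bot_ne_top ▸ mem a (by simp)))
      rw [hbot] at hxK
      exact hx0 (by simpa using hxK)
    -- Hence `M / a M` has an associated prime containing both `p` and `a`.
    obtain ⟨q, hq, hle⟩ := exists_le_isAssociatedPrime_of_isNoetherianRing R
      (Submodule.Quotient.mk (p := (a • ⊤ : Submodule R M)) y)
      (fun h ↦ hy ((Submodule.Quotient.mk_eq_zero _).mp h))
    have hpq : p ≤ q := fun r hr ↦ hle (by
      rw [Submodule.mem_colon_singleton, ← Submodule.Quotient.mk_smul, hyK r hr]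
      simp)
    have haq : a ∈ q := hle (by
      rw [Submodule.mem_colon_singleton, ← Submodule.Quotient.mk_smul, Submodule.mem_bot,
        Submodule.Quotient.mk_eq_zero]
      exact Submodule.smul_mem_pointwise_smul _ _ _ trivial)
    have h1 := ih (fun r hr ↦ mem r (by simp [hr])) reg hq
    have h2 : ringKrullDim (R ⧸ q) + 1 ≤ ringKrullDim (R ⧸ p) :=
      ringKrullDim_succ_le_of_surjective (Ideal.Quotient.factor hpq)
        (Ideal.Quotient.factor_surjective hpq) (r := Ideal.Quotient.mk p a)
        (mem_nonZeroDivisors_of_ne_zero fun h ↦ hap (Ideal.Quotient.eq_zero_iff_mem.mp h))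
        (by simpa using Ideal.Quotient.eq_zero_iff_mem.mpr haq)
    calc ((a :: rs).length : WithBot ℕ∞) = (rs.length : WithBot ℕ∞) + 1 := by simp
      _ ≤ _ := (add_le_add_left h1 1).trans h2

/-- Each element of the maximal ideal cuts the dimension of the support down by at most one. -/
theorem supportDim_le_supportDim_quotient_add_length (fs : List R) {M : Type} [AddCommGroup M]
    [Module R M] [Module.Finite R M] (mem : ∀ r ∈ fs, r ∈ maximalIdeal R) :
    Module.supportDim R M ≤
      Module.supportDim R (M ⧸ (Ideal.ofList fs • ⊤ : Submodule R M)) + fs.length := by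
  induction fs generalizing M with
  | nil =>
    simp only [List.length_nil, Nat.cast_zero, add_zero]
    refine Module.supportDim_le_of_injective (Submodule.mkQ _) ?_
    rw [← LinearMap.ker_eq_bot, Submodule.ker_mkQ]
    simp
  | cons a fs ih =>
    refine (Module.supportDim_le_supportDim_quotSMulTop_succ (mem a (by simp))).trans ?_
    rw [Module.supportDim_eq_of_equiv (Submodule.quotOfListConsSMulTopEquivQuotSMulTopInner M a fs)]
    have := ih (M := QuotSMulTop a M) (fun r hr ↦ mem r (by simp [hr]))
    calc _ ≤ _ := add_le_add_left this 1
      _ = _ := by rw [List.length_cons, Nat.cast_add, add_assoc, Nat.cast_one]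

/-- In a module of depth `r + k`, elements `f₁, …, f_k` of the maximal ideal which cut its support
down to dimension at most `r` form a regular sequence, and the quotient by them has depth `r`. -/
theorem isWeaklyRegular_of_supportDim_le (fs : List R) {M : Type} [AddCommGroup M]
    [Module R M] [Module.Finite R M] [Nontrivial M] (mem : ∀ r ∈ fs, r ∈ maximalIdeal R) {r : ℕ}
    (rs : List R) (hrs : ∀ r ∈ rs, r ∈ maximalIdeal R) (reg : IsRegular M rs)
    (hlen : rs.length = r + fs.length)
    (hdim : Module.supportDim R (M ⧸ (Ideal.ofList fs • ⊤ : Submodule R M)) ≤ r) :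
    IsWeaklyRegular M fs ∧ ∃ rs' : List R, rs'.length = r ∧ (∀ r ∈ rs', r ∈ maximalIdeal R) ∧
      IsRegular (M ⧸ (Ideal.ofList fs • ⊤ : Submodule R M)) rs' := by
  induction fs generalizing M rs with
  | nil =>
    refine ⟨.nil R M, rs, by simpa using hlen, hrs, ?_⟩
    have e : M ≃ₗ[R] (M ⧸ (Ideal.ofList [] • ⊤ : Submodule R M)) :=
      (Submodule.quotEquivOfEqBot _ (by
        rw [Ideal.ofList_nil (R := R)]; exact Submodule.bot_smul _)).symm
    exact (e.isRegular_congr rs).mp reg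
  | cons a fs ih =>
    have ha : IsSMulRegular M a := by
      -- A zerodivisor `a` would lie in an associated prime `p`. Its dimension is at least the depth
      -- `r + fs.length + 1`, while the `fs.length` remaining elements cut `R ⧸ p` down to dimension
      -- at most `r`.
      by_contra hna
      have h1 : a ∈ ⋃ p ∈ associatedPrimes R M, (p : Set R) := by
        rw [biUnion_associatedPrimes_eq_compl_regular]
        exact hna
      simp only [Set.mem_iUnion] at h1
      obtain ⟨p, hp, hap⟩ := h1
      have h2 := length_le_ringKrullDim_of_isAssociatedPrime rs hrs reg.1 hp
      rw [← Module.supportDim_quotient_eq_ringKrullDim] at h2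
      have h3 := supportDim_le_supportDim_quotient_add_length fs (M := R ⧸ p)
        (fun r hr ↦ mem r (by simp [hr]))
      have h4 : Module.supportDim R ((R ⧸ p) ⧸ (Ideal.ofList fs • ⊤ : Submodule R (R ⧸ p))) ≤
          Module.supportDim R (M ⧸ (Ideal.ofList (a :: fs) • ⊤ : Submodule R M)) := by
        have hsub : Module.support R ((R ⧸ p) ⧸ (Ideal.ofList fs • ⊤ : Submodule R (R ⧸ p))) ⊆
            Module.support R (M ⧸ (Ideal.ofList (a :: fs) • ⊤ : Submodule R M)) := by
          rw [Module.support_quotient, Module.support_quotient, Ideal.ofList_cons,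
            PrimeSpectrum.zeroLocus_sup]
          obtain ⟨-, g, hg⟩ := (isAssociatedPrime_iff_exists_injective_linearMap _ _).mp hp
          rintro q ⟨hq1, hq2⟩
          refine ⟨Module.support_subset_of_injective g hg hq1, ?_, hq2⟩
          rw [Module.support_eq_zeroLocus, Ideal.annihilator_quotient] at hq1
          exact (Ideal.span_singleton_le_iff_mem _).mpr (hq1 hap)
        exact Order.krullDim_le_of_strictMono (fun q ↦ ⟨q.1, hsub q.2⟩) (fun {_ _} lt ↦ lt)
      have h5 : ((r + (fs.length + 1) : ℕ) : WithBot ℕ∞) ≤ ((r + fs.length : ℕ) : WithBot ℕ∞) := by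
        calc ((r + (fs.length + 1) : ℕ) : WithBot ℕ∞) = rs.length := by rw [hlen]; rfl
          _ ≤ _ := h2.trans (h3.trans (add_le_add_left (h4.trans hdim) _))
          _ = _ := by push_cast; rfl
      have h6 : r + (fs.length + 1) ≤ r + fs.length := by exact_mod_cast h5
      omega
    obtain ⟨rs', hlen', hrs', reg'⟩ := exists_isRegular_quotSMulTop ha (mem a (by simp)) hrs reg
      (n := r + fs.length) (by rw [hlen, List.length_cons]; omega)
    have := reg'.nontrivial
    have e := Submodule.quotOfListConsSMulTopEquivQuotSMulTopInner M a fs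
    obtain ⟨h1, rs'', h2, h3, h4⟩ := ih (M := QuotSMulTop a M) (fun r hr ↦ mem r (by simp [hr]))
      rs' hrs' reg' hlen' (by rwa [← Module.supportDim_eq_of_equiv e])
    exact ⟨.cons ha h1, rs'', h2, h3, (e.isRegular_congr rs'').mpr h4⟩

end Depth

/-! ### Hilbert functions of quotients by a form -/

section HilbertFunction

variable {A : Type} [CommRing A] [Algebra ℂ A] (𝒜 : ℕ → Submodule ℂ A)

/-- The image of the degree `t` part of a graded algebra in its quotient by an ideal. -/
def quotientPart (J : Ideal A) (t : ℕ) : Submodule ℂ (A ⧸ J) :=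
  (𝒜 t).map (Ideal.Quotient.mkₐ ℂ J).toLinearMap

instance quotientPart.finite [∀ t, Module.Finite ℂ (𝒜 t)] (J : Ideal A) (t : ℕ) :
    Module.Finite ℂ (quotientPart 𝒜 J t) :=
  inferInstanceAs (Module.Finite ℂ ((𝒜 t).map (Ideal.Quotient.mkₐ ℂ J).toLinearMap))

theorem map_factor_quotientPart {J J' : Ideal A} (h : J ≤ J') (t : ℕ) :
    (quotientPart 𝒜 J t).map (Ideal.Quotient.factorₐ ℂ h).toLinearMap = quotientPart 𝒜 J' t := by
  rw [quotientPart, quotientPart, ← Submodule.map_comp]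
  rfl

variable [∀ t, Module.Finite ℂ (𝒜 t)]

/-- The degree `t` part of `A ⧸ J` maps onto that of `A ⧸ J'`; the kernel accounts for the
difference of dimensions. -/
theorem finrank_quotientPart_eq_add {J J' : Ideal A} (h : J ≤ J') (t : ℕ) :
    Module.finrank ℂ (quotientPart 𝒜 J t) = Module.finrank ℂ (quotientPart 𝒜 J' t) +
      Module.finrank ℂ (LinearMap.ker ((Ideal.Quotient.factorₐ ℂ h).toLinearMap.domRestrict
        (quotientPart 𝒜 J t))) := by
  rw [← LinearMap.finrank_range_add_finrank_ker
    ((Ideal.Quotient.factorₐ ℂ h).toLinearMap.domRestrict (quotientPart 𝒜 J t)),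
    LinearMap.range_domRestrict, map_factor_quotientPart]

variable {𝒜} [GradedAlgebra 𝒜] {J : Ideal A} (hJ : J.IsHomogeneous 𝒜) {d : ℕ} {f : A} (hf : f ∈ 𝒜 d)

include hJ hf in
/-- In degrees below `d`, dividing by a form of degree `d` changes nothing. -/
theorem finrank_quotientPart_sup_of_lt {t : ℕ} (ht : t < d) :
    Module.finrank ℂ (quotientPart 𝒜 (J ⊔ Ideal.span {f}) t) =
      Module.finrank ℂ (quotientPart 𝒜 J t) := by
  rw [finrank_quotientPart_eq_add 𝒜 (le_sup_left : J ≤ J ⊔ Ideal.span {f})]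
  suffices h : LinearMap.ker ((Ideal.Quotient.factorₐ ℂ
      (le_sup_left : J ≤ J ⊔ Ideal.span {f})).toLinearMap.domRestrict (quotientPart 𝒜 J t)) = ⊥ by
    rw [h, finrank_bot, add_zero]
  rw [LinearMap.ker_eq_bot']
  rintro ⟨_, a, ha, rfl⟩ h
  have h1 : Ideal.Quotient.mk (J ⊔ Ideal.span {f}) a = 0 := h
  rw [Ideal.Quotient.eq_zero_iff_mem, Submodule.mem_sup] at h1
  obtain ⟨y, hy, z, hz, rfl⟩ := h1
  obtain ⟨c, rfl⟩ := Ideal.mem_span_singleton'.mp hz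
  refine Subtype.ext (Ideal.Quotient.eq_zero_iff_mem.mpr ?_)
  have h2 := DirectSum.decompose_of_mem_same 𝒜 ha
  rw [DirectSum.decompose_add, DirectSum.add_apply, Submodule.coe_add, mul_comm c,
    DirectSum.coe_decompose_mul_of_left_mem_of_not_le 𝒜 hf (by omega), add_zero] at h2
  rw [mul_comm c, ← h2]
  exact hJ t hy

include hJ hf in
/-- The Hilbert function of the quotient by a form which is a nonzerodivisor. -/
theorem finrank_quotientPart_sup_of_le (hreg : ∀ h, f * h ∈ J → h ∈ J) {t : ℕ} (ht : d ≤ t) :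
    Module.finrank ℂ (quotientPart 𝒜 (J ⊔ Ideal.span {f}) t) +
      Module.finrank ℂ (quotientPart 𝒜 J (t - d)) = Module.finrank ℂ (quotientPart 𝒜 J t) := by
  rw [finrank_quotientPart_eq_add 𝒜 (le_sup_left : J ≤ J ⊔ Ideal.span {f}) t]
  congr 1
  have hinj : Function.Injective (LinearMap.mulLeft ℂ (Ideal.Quotient.mk J f)) := by
    rw [← LinearMap.ker_eq_bot, LinearMap.ker_eq_bot']
    intro x hx
    obtain ⟨h, rfl⟩ := Ideal.Quotient.mk_surjective x
    rw [LinearMap.mulLeft_apply, ← map_mul, Ideal.Quotient.eq_zero_iff_mem] at hx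
    exact Ideal.Quotient.eq_zero_iff_mem.mpr (hreg h hx)
  rw [LinearEquiv.finrank_eq (Submodule.equivMapOfInjective _ hinj (quotientPart 𝒜 J (t - d))),
    LinearEquiv.finrank_eq (Submodule.equivMapOfInjective _
      (Submodule.injective_subtype (quotientPart 𝒜 J t)) (LinearMap.ker _))]
  -- Multiplication by `f` identifies the degree `t - d` part of `A ⧸ J` with the kernel.
  suffices h : (quotientPart 𝒜 J (t - d)).map (LinearMap.mulLeft ℂ (Ideal.Quotient.mk J f)) =
      (LinearMap.ker ((Ideal.Quotient.factorₐ ℂ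
        (le_sup_left : J ≤ J ⊔ Ideal.span {f})).toLinearMap.domRestrict
          (quotientPart 𝒜 J t))).map (quotientPart 𝒜 J t).subtype by
    rw [h]
  ext x
  constructor
  · rintro ⟨_, ⟨c, hc, rfl⟩, rfl⟩
    have h1 : f * c ∈ 𝒜 t := by
      have := SetLike.GradedMul.mul_mem hf hc
      rwa [Nat.add_sub_cancel' ht] at this
    refine ⟨⟨Ideal.Quotient.mk J (f * c), f * c, h1, rfl⟩, ?_, map_mul (Ideal.Quotient.mk J) f c⟩
    exact Ideal.Quotient.eq_zero_iff_mem.mpr (Submodule.mem_sup_right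
      (Ideal.mul_mem_right _ _ (Ideal.mem_span_singleton_self f)))
  · rintro ⟨⟨_, a, ha, rfl⟩, h, rfl⟩
    have h1 : Ideal.Quotient.mk (J ⊔ Ideal.span {f}) a = 0 := h
    rw [Ideal.Quotient.eq_zero_iff_mem, Submodule.mem_sup] at h1
    obtain ⟨y, hy, z, hz, rfl⟩ := h1
    obtain ⟨c, rfl⟩ := Ideal.mem_span_singleton'.mp hz
    refine ⟨Ideal.Quotient.mk J (DirectSum.decompose 𝒜 c (t - d)), ⟨_, SetLike.coe_mem _, rfl⟩, ?_⟩
    have h2 := DirectSum.decompose_of_mem_same 𝒜 ha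
    rw [DirectSum.decompose_add, DirectSum.add_apply, Submodule.coe_add, mul_comm c,
      DirectSum.coe_decompose_mul_of_left_mem_of_le 𝒜 hf ht] at h2
    change Ideal.Quotient.mk J f * _ = Ideal.Quotient.mk J (y + c * f)
    rw [mul_comm c, ← h2, map_add, map_mul, Ideal.Quotient.eq_zero_iff_mem.mpr (hJ t hy), zero_add]

end HilbertFunction

/-! ### Monomials avoiding the products of blocks of variables -/

section MonomialCount

variable {V : Type} {k : ℕ} (B : Fin k → Finset V)

/-- The monomials of degree `t` which, for each of the first `j` blocks of variables, are not
divisible by the product of the variables in the block. -/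
def avoidingMonomials (t j : ℕ) : Set (V →₀ ℕ) :=
  {a | a.degree = t ∧ ∀ i : Fin k, (i : ℕ) < j → ∃ l ∈ B i, a l = 0}

theorem avoidingMonomials_finite [Finite V] (t j : ℕ) : (avoidingMonomials B t j).Finite :=
  (Finsupp.finite_of_degree_eq t).subset fun _ h ↦ h.1

/-- The exponent of the product of the variables in a block. -/
def blockExponent (s : Finset V) : V →₀ ℕ := Finsupp.indicator s fun _ _ ↦ 1

theorem blockExponent_apply [DecidableEq V] (s : Finset V) (l : V) :
    blockExponent s l = if l ∈ s then 1 else 0 := by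
  simp [blockExponent, Finsupp.indicator_apply]

theorem degree_blockExponent [Fintype V] [DecidableEq V] (s : Finset V) :
    (blockExponent s).degree = s.card := by
  rw [Finsupp.degree_eq_sum]
  simp [blockExponent_apply]

variable {B} [Fintype V] [DecidableEq V] (hB : Pairwise (fun i j ↦ Disjoint (B i) (B j)))

theorem avoidingMonomials_succ_of_lt {t : ℕ} {j : Fin k} (ht : t < (B j).card) :
    avoidingMonomials B t (j + 1) = avoidingMonomials B t j := by
  refine Set.Subset.antisymm (fun a ha ↦ ⟨ha.1, fun i hi ↦ ha.2 i (by omega)⟩)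
    fun a ha ↦ ⟨ha.1, fun i hi ↦ ?_⟩
  rcases Nat.lt_succ_iff_lt_or_eq.mp hi with h | h
  · exact ha.2 i h
  obtain rfl : i = j := Fin.ext h
  by_contra! hcon
  have h1 : blockExponent (B i) ≤ a := fun l ↦ by
    rw [blockExponent_apply]
    split_ifs with h
    · exact Nat.one_le_iff_ne_zero.mpr (hcon l h)
    · exact Nat.zero_le _
  have h2 := Finsupp.degree_mono h1
  rw [degree_blockExponent, ha.1] at h2
  omega

include hB in
/-- A monomial avoiding the first `j` block products either avoids the next one too, or is the
product of the next block with a monomial avoiding the first `j`. The same recursion governs the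
Hilbert function of a regular sequence. -/
theorem ncard_avoidingMonomials_succ {t : ℕ} {j : Fin k} (ht : (B j).card ≤ t) :
    (avoidingMonomials B t (j + 1)).ncard + (avoidingMonomials B (t - (B j).card) j).ncard =
      (avoidingMonomials B t j).ncard := by
  have hinj : Function.Injective (fun a : V →₀ ℕ ↦ a + blockExponent (B j)) :=
    add_left_injective _
  rw [← Set.ncard_image_of_injective (avoidingMonomials B (t - (B j).card) j) hinj,
    ← Set.ncard_union_eq ?_
    (avoidingMonomials_finite B _ _) ((avoidingMonomials_finite B _ _).image _)]
  · congr 1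
    ext a
    constructor
    · rintro (ha | ⟨a, ha, rfl⟩)
      · exact ⟨ha.1, fun i hi ↦ ha.2 i (by omega)⟩
      · refine ⟨by rw [map_add, ha.1, degree_blockExponent]; omega, fun i hi ↦ ?_⟩
        obtain ⟨l, hl, h0⟩ := ha.2 i hi
        refine ⟨l, hl, ?_⟩
        have : l ∉ B j := fun h ↦ Finset.disjoint_left.mp (hB (i := i) (j := j)
          (fun h ↦ by subst h; omega)) hl h
        simp [h0, blockExponent_apply, this]
    · intro ha
      by_cases h : ∃ l ∈ B j, a l = 0
      · refine Or.inl ⟨ha.1, fun i hi ↦ ?_⟩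
        rcases Nat.lt_succ_iff_lt_or_eq.mp hi with h' | h'
        · exact ha.2 i h'
        · obtain rfl : i = j := Fin.ext h'
          exact h
      · push Not at h
        have h1 : blockExponent (B j) ≤ a := fun l ↦ by
          rw [blockExponent_apply]
          split_ifs with h'
          · exact Nat.one_le_iff_ne_zero.mpr (h l h')
          · exact Nat.zero_le _
        refine Or.inr ⟨a - blockExponent (B j), ⟨?_, fun i hi ↦ ?_⟩, tsub_add_cancel_of_le h1⟩
        · have h2 := congrArg Finsupp.degree (tsub_add_cancel_of_le h1)
          rw [map_add, degree_blockExponent, ha.1] at h2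
          omega
        · obtain ⟨l, hl, h0⟩ := ha.2 i hi
          exact ⟨l, hl, by simp [h0]⟩
  · rw [Set.disjoint_left]
    rintro _ ha ⟨a, -, rfl⟩
    obtain ⟨l, hl, h0⟩ := ha.2 j (Nat.lt_succ_self _)
    simp [blockExponent_apply, hl] at h0

end MonomialCount

/-! ### The Hilbert function of a regular sequence of forms -/

section CompleteIntersection

theorem finrank_homogeneousSubmodule (σ : Type) [Fintype σ] (t : ℕ) :
    Module.finrank ℂ (homogeneousSubmodule σ ℂ t) = {a : σ →₀ ℕ | a.degree = t}.ncard := by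
  have : Fintype {a : σ →₀ ℕ | a.degree = t} := (Finsupp.finite_of_degree_eq t).fintype
  rw [homogeneousSubmodule_eq_finsupp_supported,
    LinearEquiv.finrank_eq (AddMonoidAlgebra.supportedEquivFinsupp _),
    Module.finrank_finsupp_self, Set.ncard_eq_toFinset_card', Set.toFinset_card]

instance homogeneousSubmodule.finite {σ : Type} [Finite σ] (t : ℕ) :
    Module.Finite ℂ (homogeneousSubmodule σ ℂ t) :=
  Module.Finite.iff_fg.mpr (homogeneousSubmodule_fg σ ℂ t)

/-- The ideal generated by the first `j` members of a family of polynomials. -/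
def prefixIdeal {σ : Type} {k : ℕ} (f : Fin k → MvPolynomial σ ℂ) (j : ℕ) :
    Ideal (MvPolynomial σ ℂ) :=
  Ideal.span (f '' {i | (i : ℕ) < j})

theorem prefixIdeal_succ {σ : Type} {k : ℕ} (f : Fin k → MvPolynomial σ ℂ) (j : Fin k) :
    prefixIdeal f (j + 1) = prefixIdeal f j ⊔ Ideal.span {f j} := by
  rw [prefixIdeal, prefixIdeal, ← Ideal.span_union, ← Set.image_singleton, ← Set.image_union]
  congr 2
  ext i
  simp only [Set.mem_ofPred_eq, Set.mem_union, Set.mem_singleton_iff, Fin.ext_iff]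
  omega

theorem prefixIdeal_isHomogeneous {σ : Type} {k : ℕ} {d : Fin k → ℕ}
    {f : Fin k → MvPolynomial σ ℂ} (hf : ∀ i, (f i).IsHomogeneous (d i)) (j : ℕ) :
    (prefixIdeal f j).IsHomogeneous (homogeneousSubmodule σ ℂ) :=
  Ideal.homogeneous_span _ _ (by rintro _ ⟨i, -, rfl⟩; exact ⟨d i, hf i⟩)

/-- A regular sequence of forms of degrees `d₁, …, d_k` has the same Hilbert function as the
products of the variables in disjoint blocks of `d₁, …, d_k` variables. -/
theorem finrank_quotientPart_prefixIdeal {σ V : Type} [Fintype σ] [Fintype V] [DecidableEq V]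
    {k : ℕ} {d : Fin k → ℕ} {f : Fin k → MvPolynomial σ ℂ} (hf : ∀ i, (f i).IsHomogeneous (d i))
    (hreg : ∀ (j : Fin k) h, f j * h ∈ prefixIdeal f j → h ∈ prefixIdeal f j)
    (hV : Fintype.card V = Fintype.card σ) {B : Fin k → Finset V}
    (hB : Pairwise (fun i j ↦ Disjoint (B i) (B j))) (hd : ∀ i, (B i).card = d i)
    {j : ℕ} (hj : j ≤ k) (t : ℕ) :
    Module.finrank ℂ (quotientPart (homogeneousSubmodule σ ℂ) (prefixIdeal f j) t) =
      (avoidingMonomials B t j).ncard := by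
  induction j generalizing t with
  | zero =>
    have h0 : prefixIdeal f 0 = ⊥ := by simp [prefixIdeal]
    have h1 : avoidingMonomials B t 0 = {a : V →₀ ℕ | a.degree = t} := by
      simp [avoidingMonomials]
    have h2 : Function.Injective
      (Ideal.Quotient.mkₐ ℂ (⊥ : Ideal (MvPolynomial σ ℂ))).toLinearMap :=
      (RingHom.injective_iff_ker_eq_bot (Ideal.Quotient.mk ⊥)).mpr Ideal.mk_ker
    have e := Fintype.equivOfCardEq hV
    rw [h0, h1, quotientPart, ← LinearEquiv.finrank_eq (Submodule.equivMapOfInjective _ h2 _),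
      finrank_homogeneousSubmodule]
    refine (Set.ncard_congr' ((Finsupp.domCongr e).toEquiv.subtypeEquiv fun a ↦ ?_)).symm
    change a.degree = t ↔ (Finsupp.equivMapDomain e a).degree = t
    rw [Finsupp.degree_eq_sum, Finsupp.degree_eq_sum, ← e.sum_comp]
    simp
  | succ j ih =>
    let j' : Fin k := ⟨j, hj⟩
    have e : prefixIdeal f (j + 1) = prefixIdeal f j ⊔ Ideal.span {f j'} := prefixIdeal_succ f j'
    rw [e]
    rcases lt_or_ge t (d j') with h | h
    · rw [finrank_quotientPart_sup_of_lt (prefixIdeal_isHomogeneous hf j) (hf j') h,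
        ih (by omega)]
      exact congrArg Set.ncard (avoidingMonomials_succ_of_lt (j := j') (by rwa [hd])).symm
    · have h1 := finrank_quotientPart_sup_of_le (prefixIdeal_isHomogeneous hf j) (hf j')
        (hreg j') h
      have h2 := ncard_avoidingMonomials_succ hB (t := t) (j := j') (by rwa [hd])
      rw [hd] at h2
      rw [ih (by omega), ih (by omega)] at h1
      exact Nat.add_right_cancel (h1.trans h2.symm)

end CompleteIntersection

/-! ### Sections of the structure sheaf of `Proj` -/

section ProjSections

variable {A : Type} [CommRing A] [Algebra ℂ A] (𝒜 : ℕ → Submodule ℂ A) [GradedAlgebra 𝒜]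

/-- The homogeneous prime ideal which is a point of `Proj 𝒜`. -/
def primeAt (x : Proj 𝒜) : Ideal A :=
  ProjectiveSpectrum.asHomogeneousIdeal (𝒜 := 𝒜) x |>.toIdeal

instance primeAt.isPrime (x : Proj 𝒜) : (primeAt 𝒜 x).IsPrime :=
  ProjectiveSpectrum.isPrime (𝒜 := 𝒜) x

/-- The (inhomogeneous) localization of the graded ring at a point of `Proj 𝒜`. The stalk of the
structure sheaf is its degree zero part. -/
abbrev Loc (x : Proj 𝒜) : Type := Localization.AtPrime (primeAt 𝒜 x)

/-- The value of a section of the structure sheaf of `Proj 𝒜` at a point. -/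
def evalAt {U : (Proj 𝒜).Opens} {x : Proj 𝒜} (hx : x ∈ U) : Γ(Proj 𝒜, U) →+* Loc 𝒜 x :=
  (algebraMap (HomogeneousLocalization.AtPrime 𝒜 (primeAt 𝒜 x)) (Loc 𝒜 x)).comp
    (openToLocalization 𝒜 U x hx).hom

theorem evalAt_ext {U : (Proj 𝒜).Opens} {u v : Γ(Proj 𝒜, U)}
    (h : ∀ x (hx : x ∈ U), evalAt 𝒜 hx u = evalAt 𝒜 hx v) : u = v := by
  apply Subtype.ext
  funext x
  exact HomogeneousLocalization.val_injective _ (h x.1 x.2)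

/-- A family of elements of the localizations at the points of `U` is locally a fraction of two
homogeneous elements of the same degree. -/
def IsLocallyFrac {U : (Proj 𝒜).Opens} (φ : ∀ x, x ∈ U → Loc 𝒜 x) : Prop :=
  ∀ x (_ : x ∈ U), ∃ V : (Proj 𝒜).Opens, x ∈ V ∧ ∃ hVU : V ≤ U, ∃ (e : ℕ) (r s : A),
    r ∈ 𝒜 e ∧ s ∈ 𝒜 e ∧ ∀ y (hy : y ∈ V), s ∉ primeAt 𝒜 y ∧
      algebraMap A (Loc 𝒜 y) s * φ y (hVU hy) = algebraMap A (Loc 𝒜 y) r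

theorem isLocallyFrac_evalAt {U : (Proj 𝒜).Opens} (u : Γ(Proj 𝒜, U)) :
    IsLocallyFrac 𝒜 (fun _ hx ↦ evalAt 𝒜 hx u) := by
  intro x hx
  obtain ⟨V, hxV, i, e, r, s, hs, h⟩ := u.2 ⟨x, hx⟩
  refine ⟨V, hxV, leOfHom i, e, r, s, r.2, s.2, fun y hy => ⟨hs ⟨y, hy⟩, ?_⟩⟩
  have h1 := h ⟨y, hy⟩
  have hs' : (s : A) ∈ (primeAt 𝒜 y).primeCompl := hs ⟨y, hy⟩
  have h2 : evalAt 𝒜 (leOfHom i hy) u = Localization.mk (r : A) ⟨(s : A), hs'⟩ :=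
    (congrArg HomogeneousLocalization.val h1).trans rfl
  have h3 : algebraMap A (Loc 𝒜 y) s * Localization.mk (r : A) ⟨(s : A), hs'⟩ =
      algebraMap A (Loc 𝒜 y) r := by
    rw [Localization.mk_eq_mk']
    exact IsLocalization.mk'_spec' (Loc 𝒜 y) (r : A) (⟨(s : A), hs'⟩ : (primeAt 𝒜 y).primeCompl)
  exact (congrArg (algebraMap A (Loc 𝒜 y) s * ·) h2).trans h3

/-- Sections of the structure sheaf can be defined by their values at the points. -/
theorem exists_evalAt_eq {U : (Proj 𝒜).Opens} {φ : ∀ x, x ∈ U → Loc 𝒜 x}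
    (h : IsLocallyFrac 𝒜 φ) : ∃ u : Γ(Proj 𝒜, U), ∀ x hx, evalAt 𝒜 hx u = φ x hx := by
  have aux : ∀ (y : Proj 𝒜) (z : Loc 𝒜 y) (e : ℕ) (r s : A) (hr : r ∈ 𝒜 e) (hs : s ∈ 𝒜 e)
      (hsy : s ∈ (primeAt 𝒜 y).primeCompl)
      (_ : algebraMap A (Loc 𝒜 y) s * z = algebraMap A (Loc 𝒜 y) r),
      (HomogeneousLocalization.mk ⟨e, ⟨r, hr⟩, ⟨s, hs⟩, hsy⟩ :
        HomogeneousLocalization.AtPrime 𝒜 (primeAt 𝒜 y)).val = z := by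
    intro y z e r s hr hs hsy h
    rw [HomogeneousLocalization.val_mk, Localization.mk_eq_mk', IsLocalization.mk'_eq_iff_eq_mul,
      mul_comm]
    exact h.symm
  have key : ∀ x (hx : x ∈ U), ∃ q : HomogeneousLocalization.AtPrime 𝒜 (primeAt 𝒜 x),
      q.val = φ x hx := by
    intro x hx
    obtain ⟨V, hxV, hVU, e, r, s, hr, hs, h⟩ := h x hx
    exact ⟨_, aux x _ e r s hr hs (h x hxV).1 (h x hxV).2⟩
  choose q hq using key
  refine ⟨⟨fun x => q x.1 x.2, ?_⟩, fun x hx => hq x hx⟩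
  intro x
  obtain ⟨V, hxV, hVU, e, r, s, hr, hs, h⟩ := h x.1 x.2
  refine ⟨V, hxV, homOfLE hVU, e, ⟨r, hr⟩, ⟨s, hs⟩, fun y => (h y.1 y.2).1, fun y => ?_⟩
  apply HomogeneousLocalization.val_injective
  exact (hq y.1 (hVU y.2)).trans (aux y.1 _ e r s hr hs (h y.1 y.2).1 (h y.1 y.2).2).symm

/-- A section over `D₊(a)` is a global fraction with denominator a power of `a`. -/
theorem exists_frac_of_basicOpen {a : A} {e : ℕ} (ha : a ∈ 𝒜 e) (he : 0 < e)
    (u : Γ(Proj 𝒜, Proj.basicOpen 𝒜 a)) :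
    ∃ (q : ℕ) (r : A), r ∈ 𝒜 (q * e) ∧ ∀ x (hx : x ∈ Proj.basicOpen 𝒜 a),
      algebraMap A (Loc 𝒜 x) (a ^ q) * evalAt 𝒜 hx u = algebraMap A (Loc 𝒜 x) r := by
  obtain ⟨v, rfl⟩ := (ConcreteCategory.bijective_of_isIso
    (Proj.basicOpenIsoAway 𝒜 a ha he).hom).2 u
  obtain ⟨q, r, hr, rfl⟩ := HomogeneousLocalization.Away.mk_surjective 𝒜 ha v
  refine ⟨q, r, by simpa using hr, fun x hx ↦ ?_⟩
  have hq : a ^ q ∈ (primeAt 𝒜 x).primeCompl := pow_mem (S := (primeAt 𝒜 x).primeCompl) hx q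
  have h2 : evalAt 𝒜 hx ((Proj.basicOpenIsoAway 𝒜 a ha he).hom
      (HomogeneousLocalization.Away.mk 𝒜 ha q r hr)) = Localization.mk r ⟨a ^ q, hq⟩ := by
    rw [Proj.basicOpenIsoAway_hom]
    rfl
  rw [h2, Localization.mk_eq_mk']
  exact IsLocalization.mk'_spec' (Loc 𝒜 x) r (⟨a ^ q, hq⟩ : (primeAt 𝒜 x).primeCompl)

theorem evalAt_awayToSection {a : A} {x : Proj 𝒜} (hx : x ∈ Proj.basicOpen 𝒜 a) (e : ℕ)
    (r s : A) (hr : r ∈ 𝒜 e) (hs : s ∈ 𝒜 e) (hsa : s ∈ Submonoid.powers a) :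
    algebraMap A (Loc 𝒜 x) s *
      evalAt 𝒜 hx (Proj.awayToSection 𝒜 a (HomogeneousLocalization.mk ⟨e, ⟨r, hr⟩, ⟨s, hs⟩, hsa⟩)) =
    algebraMap A (Loc 𝒜 x) r := by
  have hq : s ∈ (primeAt 𝒜 x).primeCompl := Submonoid.powers_le.mpr hx hsa
  have h2 : evalAt 𝒜 hx (Proj.awayToSection 𝒜 a
      (HomogeneousLocalization.mk ⟨e, ⟨r, hr⟩, ⟨s, hs⟩, hsa⟩)) = Localization.mk r ⟨s, hq⟩ := rfl
  rw [h2, Localization.mk_eq_mk']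
  exact IsLocalization.mk'_spec' (Loc 𝒜 x) r (⟨s, hq⟩ : (primeAt 𝒜 x).primeCompl)

theorem topIso_inv_isoOfEq_inv_appTop {X : Scheme} {U : X.Opens} (e : U = ⊤) :
    U.topIso.inv ≫ (X.isoOfEq e).inv.appTop ≫ X.topIso.inv.appTop =
      X.presheaf.map (homOfLE e.ge).op := by
  subst e
  have h1 : (X.isoOfEq (rfl : (⊤ : X.Opens) = ⊤)).inv = 𝟙 _ := by
    rw [← cancel_mono (Scheme.Opens.ι _), Scheme.isoOfEq_inv_ι, Category.id_comp]
  have h2 : (⊤ : X.Opens).topIso.inv = (⊤ : X.Opens).ι.appTop := by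
    rw [Scheme.Opens.ι_appTop, Scheme.Opens.topIso_inv]
    rfl
  rw [h1, Scheme.Hom.id_appTop, Category.id_comp, h2, ← Scheme.Hom.comp_appTop,
    Scheme.toIso_inv_ι, Scheme.Hom.id_appTop]
  exact (X.presheaf.map_id _).symm

/-- The structure morphism of `Proj 𝒜` over `Spec ℂ` induces the evident algebra structures. -/
theorem evalAt_structure {U : (Proj 𝒜).Opens} {x : Proj 𝒜} (hx : x ∈ U) (c : ℂ) :
    evalAt 𝒜 hx (((Scheme.ΓSpecIso (CommRingCat.of ℂ)).inv ≫
      (Proj.toSpecZero 𝒜 ≫ Spec.map (CommRingCat.ofHom (algebraMap ℂ (𝒜 0)))).appTop ≫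
        (Proj 𝒜).presheaf.map (homOfLE (le_top : U ≤ ⊤)).op).hom c) =
      algebraMap ℂ (Loc 𝒜 x) c := by
  have h1 : (Scheme.ΓSpecIso (CommRingCat.of ℂ)).inv ≫
      (Proj.toSpecZero 𝒜 ≫ Spec.map (CommRingCat.ofHom (algebraMap ℂ (𝒜 0)))).appTop =
      CommRingCat.ofHom (algebraMap ℂ (𝒜 0)) ≫
        CommRingCat.ofHom (HomogeneousLocalization.fromZeroRingHom 𝒜 (Submonoid.powers 1)) ≫
        Proj.awayToSection 𝒜 1 ≫ (Proj 𝒜).presheaf.map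
          (homOfLE (Proj.basicOpen_one 𝒜).ge).op := by
    rw [Scheme.Hom.comp_appTop, ← Scheme.ΓSpecIso_inv_naturality_assoc, Proj.toSpecZero]
    simp only [Scheme.Hom.comp_appTop, Category.assoc]
    rw [← Scheme.ΓSpecIso_inv_naturality_assoc]
    have h := Proj.basicOpenToSpec_app_top 𝒜 1
    rw [Scheme.Hom.appTop, h]
    rw [Category.assoc, Iso.inv_hom_id_assoc, Category.assoc,
      topIso_inv_isoOfEq_inv_appTop]
  have h2 := congrArg (fun g ↦ (g ≫ (Proj 𝒜).presheaf.map (homOfLE (le_top : U ≤ ⊤)).op).hom c) h1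
  have h3 := congrArg (evalAt 𝒜 hx) h2
  refine Eq.trans h3 ?_
  have hx1 : x ∈ Proj.basicOpen 𝒜 (1 : A) := by rw [Proj.basicOpen_one]; trivial
  have h4 := evalAt_awayToSection 𝒜 hx1 0 (algebraMap ℂ A c) 1
    (algebraMap ℂ (𝒜 0) c).2 (SetLike.GradedOne.one_mem) (one_mem _)
  rw [map_one, one_mul] at h4
  exact h4.trans (IsScalarTower.algebraMap_apply ℂ A (Loc 𝒜 x) c).symm

end ProjSections

/-! ### The dimension of the affine cone at its vertex -/

section JacobianCriterion

variable {σ : Type}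

/-- The ideal of a point of affine space. -/
def pointIdeal (z : σ → ℂ) : Ideal (MvPolynomial σ ℂ) :=
  Ideal.span (Set.range fun l ↦ X l - C (z l))

theorem X_sub_C_mem_pointIdeal (z : σ → ℂ) (l : σ) : X l - C (z l) ∈ pointIdeal z :=
  Ideal.subset_span ⟨l, rfl⟩

variable [Fintype σ]

/-- The first order Taylor expansion at a point. -/
theorem taylor_mem_pointIdeal_sq (z : σ → ℂ) (p : MvPolynomial σ ℂ) :
    p - C (eval z p) - ∑ l, C (eval z (pderiv l p)) * (X l - C (z l)) ∈
      pointIdeal z * pointIdeal z := by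
  classical
  induction p using MvPolynomial.induction_on with
  | C a => simp
  | add p q hp hq =>
    convert add_mem hp hq using 1
    simp only [map_add, add_mul, Finset.sum_add_distrib]
    ring
  | mul_X p i hp =>
    have h1 : (X i - C (z i)) * ∑ l, C (eval z (pderiv l p)) * (X l - C (z l)) ∈
        pointIdeal z * pointIdeal z :=
      Ideal.mul_mem_mul (X_sub_C_mem_pointIdeal z i)
        (sum_mem fun l _ ↦ Ideal.mul_mem_left _ _ (X_sub_C_mem_pointIdeal z l))
    convert add_mem (Ideal.mul_mem_left _ (X i) hp) h1 using 1
    have h2 : ∑ l, C (eval z (pderiv l (p * X i))) * (X l - C (z l)) =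
        C (z i) * ∑ l, C (eval z (pderiv l p)) * (X l - C (z l)) +
          C (eval z p) * (X i - C (z i)) := by
      have : C (eval z p) * (X i - C (z i)) =
          ∑ l, C (eval z p * (Pi.single i 1 : σ → ℂ) l) * (X l - C (z l)) := by
        rw [Finset.sum_eq_single i] <;> simp +contextual
      rw [this, Finset.mul_sum, ← Finset.sum_add_distrib]
      refine Finset.sum_congr rfl fun l _ ↦ ?_
      rw [Derivation.leibniz, pderiv_X]
      simp only [smul_eq_mul, map_add, map_mul, eval_X]
      have : eval z ((Pi.single l 1 : σ → MvPolynomial σ ℂ) i) = (Pi.single i 1 : σ → ℂ) l := by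
        by_cases h : i = l
        · subst h; simp
        · simp [h, Ne.symm h]
      rw [this]
      ring
    rw [h2]
    simp only [map_mul, eval_X]
    ring

theorem sub_C_eval_mem_pointIdeal (z : σ → ℂ) (p : MvPolynomial σ ℂ) :
    p - C (eval z p) ∈ pointIdeal z := by
  have h := Ideal.mul_le_right (taylor_mem_pointIdeal_sq z p)
  have h2 : ∑ l, C (eval z (pderiv l p)) * (X l - C (z l)) ∈ pointIdeal z :=
    sum_mem fun l _ ↦ Ideal.mul_mem_left _ _ (X_sub_C_mem_pointIdeal z l)
  simpa using add_mem h h2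

theorem mem_pointIdeal_iff (z : σ → ℂ) (p : MvPolynomial σ ℂ) :
    p ∈ pointIdeal z ↔ eval z p = 0 := by
  refine ⟨fun h ↦ ?_, fun h ↦ by simpa [h] using sub_C_eval_mem_pointIdeal z p⟩
  have : pointIdeal z ≤ RingHom.ker (eval z) := Ideal.span_le.mpr (by
    rintro _ ⟨l, rfl⟩
    simp [RingHom.mem_ker])
  exact this h

/-- The weak Nullstellensatz. -/
theorem exists_eq_pointIdeal {I : Ideal (MvPolynomial σ ℂ)} (hI : I.IsMaximal) :
    ∃ z, I = pointIdeal z := by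
  obtain ⟨z, rfl⟩ := isMaximal_iff_eq_vanishingIdeal_singleton.mp hI
  refine ⟨z, Ideal.ext fun p ↦ ?_⟩
  rw [mem_vanishingIdeal_singleton_iff, mem_pointIdeal_iff]
  rfl

variable {k : ℕ} (f : Fin k → MvPolynomial σ ℂ)

/-- If the gradients of `f` at a zero `z` are linearly independent, the cotangent space at `z` of
the zero scheme of `f` has the expected dimension. -/
theorem exists_pointIdeal_le_sup {z : σ → ℂ} (hz : ∀ j, eval z (f j) = 0)
    (hJ : LinearIndependent ℂ fun j l ↦ eval z (pderiv l (f j))) {r : ℕ}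
    (hr : r + k = Fintype.card σ) :
    ∃ g : Fin r → MvPolynomial σ ℂ, (∀ t, g t ∈ pointIdeal z) ∧
      pointIdeal z ≤ Ideal.span (Set.range f) ⊔ Ideal.span (Set.range g) ⊔
        pointIdeal z * pointIdeal z := by
  set v : Fin k → (σ → ℂ) := fun j l ↦ eval z (pderiv l (f j)) with hv
  -- The `g t` are linear forms in the `X l - z l` spanning a complement of the gradients.
  obtain ⟨W, hW⟩ := Submodule.exists_isCompl (Submodule.span ℂ (Set.range v))
  have hWr : Module.finrank ℂ W = r := by
    have h1 := Submodule.finrank_add_eq_of_isCompl hW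
    rw [finrank_span_eq_card hJ, Module.finrank_fintype_fun_eq_card, Fintype.card_fin] at h1
    omega
  let b := Module.finBasisOfFinrankEq ℂ W hWr
  let L : (σ → ℂ) →ₗ[ℂ] MvPolynomial σ ℂ :=
    { toFun := fun w ↦ ∑ l, C (w l) * (X l - C (z l))
      map_add' := fun w w' ↦ by
        simp only [Pi.add_apply, map_add, add_mul, Finset.sum_add_distrib]
      map_smul' := fun c w ↦ by
        simp only [Pi.smul_apply, smul_eq_mul, map_mul, mul_assoc, ← Finset.mul_sum,
          RingHom.id_apply, smul_eq_C_mul] }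
  have hL : ∀ w, L w ∈ pointIdeal z := fun w ↦
    sum_mem fun l _ ↦ Ideal.mul_mem_left _ _ (X_sub_C_mem_pointIdeal z l)
  refine ⟨fun t ↦ L (b t), fun t ↦ hL _, ?_⟩
  set T := Ideal.span (Set.range f) ⊔ Ideal.span (Set.range fun t ↦ L (b t)) ⊔
        pointIdeal z * pointIdeal z with hT
  have key : (⊤ : Submodule ℂ (σ → ℂ)) ≤ (T.restrictScalars ℂ).comap L := by
    rw [← hW.sup_eq_top]
    refine sup_le (Submodule.span_le.mpr ?_) ?_
    · rintro _ ⟨j, rfl⟩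
      change L (v j) ∈ T
      have h1 := taylor_mem_pointIdeal_sq z (f j)
      rw [hz j, map_zero, sub_zero] at h1
      have h2 : f j ∈ T := (le_sup_left.trans le_sup_left : _ ≤ T) (Ideal.subset_span ⟨j, rfl⟩)
      have h3 := sub_mem h2 ((le_sup_right : _ ≤ T) h1)
      rwa [sub_sub_cancel] at h3
    · intro w hw
      have h1 := b.sum_repr ⟨w, hw⟩
      have h2 : w = ∑ t, b.repr ⟨w, hw⟩ t • (b t : σ → ℂ) := by
        have := congrArg W.subtype h1
        rw [map_sum] at this
        exact this.symm
      rw [h2]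
      refine sum_mem fun t _ ↦ Submodule.smul_mem _ _ ?_
      exact (le_sup_right.trans le_sup_left : _ ≤ T) (Ideal.subset_span ⟨t, rfl⟩)
  refine Ideal.span_le.mpr ?_
  rintro _ ⟨l, rfl⟩
  classical
  have h := key (Submodule.mem_top (x := Pi.single l 1))
  change ∑ l', _ ∈ T at h
  rw [Finset.sum_eq_single l] at h
  · simpa using h
  · intro l' _ h'
    simp [h']
  · simp

/-- At a point where the gradients are independent, the zero scheme has at most the expected
dimension: by Nakayama its maximal ideal is generated by `r` elements locally, so Krull's height
theorem applies. -/
theorem height_le_of_comap_eq_pointIdeal {z : σ → ℂ}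
    (hJ : LinearIndependent ℂ fun j l ↦ eval z (pderiv l (f j))) {r : ℕ}
    (hr : r + k = Fintype.card σ) (Q : Ideal (MvPolynomial σ ℂ ⧸ Ideal.span (Set.range f)))
    (hQ : Q.comap (Ideal.Quotient.mk _) = pointIdeal z) [Q.IsPrime] : Q.height ≤ r := by
  classical
  have hfQ : ∀ p ∈ Ideal.span (Set.range f), p ∈ pointIdeal z := by
    intro p hp
    rw [← hQ, Ideal.mem_comap, Ideal.Quotient.eq_zero_iff_mem.mpr hp]
    exact zero_mem _
  have hz : ∀ j, eval z (f j) = 0 := fun j ↦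
    (mem_pointIdeal_iff z _).mp (hfQ _ (Ideal.subset_span ⟨j, rfl⟩))
  obtain ⟨g, hg, hle⟩ := exists_pointIdeal_le_sup f hz hJ hr
  set s : Finset (MvPolynomial σ ℂ ⧸ Ideal.span (Set.range f)) :=
    Finset.univ.image fun t ↦ Ideal.Quotient.mk _ (g t) with hs
  -- By Nakayama `Q` is minimal over the ideal generated by the classes of the `g t`.
  have hmin : Q ∈ (Ideal.span (s : Set _)).minimalPrimes := by
    refine ⟨⟨inferInstance, Ideal.span_le.mpr ?_⟩, ?_⟩
    · intro x hx
      simp only [hs, Finset.coe_image, Finset.coe_univ, Set.image_univ, Set.mem_range] at hx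
      obtain ⟨t, rfl⟩ := hx
      have := hg t
      rwa [← hQ] at this
    · rintro p ⟨hp, hsp⟩ hpQ
      have hle2 : pointIdeal z ≤ p.comap (Ideal.Quotient.mk _) ⊔ pointIdeal z • pointIdeal z := by
        refine hle.trans (sup_le (sup_le ?_ ?_ |>.trans le_sup_left) le_sup_right)
        · intro q hq
          rw [Ideal.mem_comap, Ideal.Quotient.eq_zero_iff_mem.mpr hq]
          exact zero_mem _
        · refine Ideal.span_le.mpr ?_
          rintro _ ⟨t, rfl⟩
          exact hsp (Ideal.subset_span (by simp [hs]))
      obtain ⟨c, hc, hcle⟩ := Submodule.exists_sub_one_mem_and_smul_le_of_fg_of_le_sup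
        (IsNoetherian.noetherian _) (le_refl _) hle2
      have hcp : c ∉ p.comap (Ideal.Quotient.mk (Ideal.span (Set.range f))) := by
        intro hcp
        have h1 : c ∈ pointIdeal z := by
          rw [← hQ]
          exact Ideal.comap_mono hpQ hcp
        have h2 : (1 : MvPolynomial σ ℂ) ∈ pointIdeal z := by simpa using sub_mem h1 hc
        rw [mem_pointIdeal_iff] at h2
        simp at h2
      intro x hx
      obtain ⟨y, rfl⟩ := Ideal.Quotient.mk_surjective x
      have hy : y ∈ pointIdeal z := by rw [← hQ]; exact hx
      have h1 := hcle (Submodule.smul_mem_pointwise_smul y c _ hy)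
      exact ((inferInstance : (p.comap _).IsPrime).mem_or_mem h1).resolve_left hcp
  have h1 := Ideal.height_le_card_of_mem_minimalPrimes_span_finset hmin
  refine h1.trans ?_
  exact_mod_cast Finset.card_image_le.trans (by simp)

/-- The cone over the smooth intersection has, at its vertex, at most the expected dimension: a
chain of primes ending at the vertex can be moved to one ending at another point. -/
theorem height_le_of_jacobian
    (hJ : ∀ z : σ → ℂ, z ≠ 0 → (∀ j, eval z (f j) = 0) →
      LinearIndependent ℂ fun j l ↦ eval z (pderiv l (f j))) {r : ℕ}
    (hr : r + 1 + k = Fintype.card σ)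
    (Q : Ideal (MvPolynomial σ ℂ ⧸ Ideal.span (Set.range f))) [hQm : Q.IsMaximal]
    (hQ : Q.comap (Ideal.Quotient.mk _) = pointIdeal 0) : Q.height ≤ (r + 1 : ℕ) := by
  rw [Ideal.height_le_iff]
  intro p hp hpQ
  obtain ⟨x, hxQ, hxp⟩ := SetLike.exists_of_lt hpQ
  -- A prime `p` strictly below the vertex `Q` is an intersection of maximal ideals, so it lies in
  -- the ideal `Q'` of another point, where the height is at most `r`.
  have hjac : p.jacobson = p := IsJacobsonRing.out inferInstance hp.isRadical
  rw [← hjac, Ideal.jacobson, Ideal.mem_sInf] at hxp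
  push Not at hxp
  obtain ⟨Q', ⟨hpQ', hQ'⟩, hxQ'⟩ := hxp
  have hpQ'' : p < Q' := by
    refine lt_of_le_of_ne hpQ' ?_
    rintro rfl
    exact hxQ' (hQ'.eq_of_le hQm.ne_top hpQ.le ▸ hxQ)
  have hmax : (Q'.comap (Ideal.Quotient.mk (Ideal.span (Set.range f)))).IsMaximal :=
    Ideal.comap_isMaximal_of_surjective _ Ideal.Quotient.mk_surjective
  obtain ⟨z, hz⟩ := exists_eq_pointIdeal hmax
  have hz0 : z ≠ 0 := by
    rintro rfl
    rw [← hQ] at hz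
    exact hxQ' (Ideal.comap_injective_of_surjective _ Ideal.Quotient.mk_surjective hz ▸ hxQ)
  have h0 : ∀ j, eval z (f j) = 0 := fun j ↦ by
    rw [← mem_pointIdeal_iff, ← hz, Ideal.mem_comap,
      Ideal.Quotient.eq_zero_iff_mem.mpr (Ideal.subset_span (Set.mem_range_self j))]
    exact zero_mem _
  have h1 := height_le_of_comap_eq_pointIdeal f (hJ z hz0 h0) hr Q' hz
  have : Q'.FiniteHeight := Q'.finiteHeight_iff.mpr
    (Or.inr (ne_top_of_le_ne_top (ENat.natCast_ne_top _) h1))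
  exact (Ideal.height_strict_mono_of_isPrime_of_isPrime hpQ'').trans_le h1

end JacobianCriterion

/-! ### The local ring at the vertex of the affine cone -/

section LocalRing

open RingTheory.Sequence

theorem ofList_take_ofFn {R : Type} [CommRing R] {k : ℕ} (g : Fin k → R) (i : ℕ) :
    Ideal.ofList ((List.ofFn g).take i) = Ideal.span (g '' {l | (l : ℕ) < i}) := by
  refine congrArg Ideal.span (Set.ext fun x ↦ ?_)
  simp only [Set.mem_ofPred_eq, List.mem_take_iff_getElem, List.length_ofFn, List.getElem_ofFn,
    Set.mem_image]
  constructor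
  · rintro ⟨j, hj, rfl⟩
    exact ⟨⟨j, by omega⟩, by simp; omega, rfl⟩
  · rintro ⟨l, hl, rfl⟩
    exact ⟨l, by have := l.2; omega, rfl⟩

theorem ofList_ofFn {R : Type} [CommRing R] {k : ℕ} (g : Fin k → R) :
    Ideal.ofList (List.ofFn g) = Ideal.span (Set.range g) := by
  refine congrArg Ideal.span (Set.ext fun x ↦ ?_)
  simp [List.mem_ofFn]

theorem isSMulRegular_quotient_iff {R : Type} [CommRing R] (I : Ideal R) (r : R) :
    IsSMulRegular (R ⧸ (I • ⊤ : Submodule R R)) r ↔ ∀ x, r * x ∈ I → x ∈ I := by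
  rw [smul_eq_mul, Ideal.mul_top, isSMulRegular_iff_right_eq_zero_of_smul]
  constructor
  · intro h x hx
    have := h (Submodule.Quotient.mk x) (by
      rw [← Submodule.Quotient.mk_smul, Submodule.Quotient.mk_eq_zero]; exact hx)
    rwa [Submodule.Quotient.mk_eq_zero] at this
  · intro h x hx
    obtain ⟨x, rfl⟩ := Submodule.Quotient.mk_surjective _ x
    rw [← Submodule.Quotient.mk_smul, Submodule.Quotient.mk_eq_zero] at hx
    rw [Submodule.Quotient.mk_eq_zero]
    exact h x hx

theorem isWeaklyRegular_ofFn_iff {R : Type} [CommRing R] {k : ℕ} (g : Fin k → R) :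
    IsWeaklyRegular R (List.ofFn g) ↔ ∀ (j : Fin k) (x : R),
      g j * x ∈ Ideal.span (g '' {l | (l : ℕ) < j}) → x ∈ Ideal.span (g '' {l | (l : ℕ) < j}) := by
  rw [isWeaklyRegular_iff_Fin]
  simp_rw [isSMulRegular_quotient_iff, ofList_take_ofFn]
  constructor
  · intro h j x hx
    exact h ⟨j, by simp⟩ x (by simpa using hx)
  · intro h j x hx
    exact h ⟨j, by simpa using j.2⟩ x (by simpa using hx)

theorem isWeaklyRegular_X (r : ℕ) :
    IsWeaklyRegular (MvPolynomial (Fin r) ℂ)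
      (List.ofFn fun i : Fin r ↦ (X i : MvPolynomial (Fin r) ℂ)) := by
  rw [isWeaklyRegular_ofFn_iff]
  intro j x hx
  rw [mem_ideal_span_X_image] at hx ⊢
  intro a ha
  obtain ⟨i, hi, hi'⟩ := hx (Finsupp.single j 1 + a) (by
    rw [mem_support_iff, coeff_X_mul]
    exact mem_support_iff.mp ha)
  refine ⟨i, hi, ?_⟩
  have : j ≠ i := by rintro rfl; simp at hi
  simpa [Finsupp.single_apply, this] using hi'

theorem pointIdeal_zero_eq (σ : Type) : pointIdeal (0 : σ → ℂ) = idealOfVars σ ℂ := by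
  simp [pointIdeal, idealOfVars]

instance pointIdeal_isMaximal {σ : Type} [Fintype σ] (z : σ → ℂ) : (pointIdeal z).IsMaximal := by
  have : pointIdeal z = RingHom.ker (eval z) := Ideal.ext fun p ↦ by
    rw [mem_pointIdeal_iff, RingHom.mem_ker]
  rw [this]
  exact RingHom.ker_isMaximal_of_surjective _ fun c ↦ ⟨C c, by simp⟩

/-- The local ring of a quotient at a prime has dimension at most the height of the prime. -/
theorem ringKrullDim_localization_quotient_le {P : Type} [CommRing P] (m I : Ideal P) [m.IsPrime]
    (Q : Ideal (P ⧸ I)) [Q.IsPrime] (hQ : Q.comap (Ideal.Quotient.mk I) = m) :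
    ringKrullDim (Localization.AtPrime m ⧸ I.map (algebraMap P (Localization.AtPrime m))) ≤
      Q.height := by
  let φ : P ⧸ I →+* Localization.AtPrime m ⧸ I.map (algebraMap P (Localization.AtPrime m)) :=
    Ideal.quotientMap _ (algebraMap P (Localization.AtPrime m)) Ideal.le_comap_map
  have hu : ∀ y : Q.primeCompl, IsUnit (φ y) := by
    rintro ⟨y, hy⟩
    obtain ⟨p, rfl⟩ := Ideal.Quotient.mk_surjective y
    have hp : p ∈ m.primeCompl := by
      intro hp
      rw [← hQ] at hp
      exact hy hp
    exact (IsLocalization.map_units (Localization.AtPrime m) ⟨p, hp⟩).map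
      (Ideal.Quotient.mk (I.map (algebraMap P (Localization.AtPrime m))))
  let ψ : Localization.AtPrime Q →+* Localization.AtPrime m ⧸ I.map
    (algebraMap P (Localization.AtPrime m)) := IsLocalization.lift (M := Q.primeCompl) hu
  have hψ : Function.Surjective ψ := by
    intro y
    obtain ⟨y, rfl⟩ := Ideal.Quotient.mk_surjective y
    obtain ⟨p, s, rfl⟩ := IsLocalization.exists_mk'_eq m.primeCompl y
    have hs : Ideal.Quotient.mk I s ∈ Q.primeCompl := by
      intro h
      have : (s : P) ∈ Q.comap (Ideal.Quotient.mk I) := h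
      rw [hQ] at this
      exact s.2 this
    refine ⟨IsLocalization.mk' _ (Ideal.Quotient.mk I p) ⟨_, hs⟩, ?_⟩
    rw [IsLocalization.lift_mk'_spec]
    change Ideal.Quotient.mk _ (algebraMap P (Localization.AtPrime m) p) =
      Ideal.Quotient.mk _ (algebraMap P (Localization.AtPrime m) s) * Ideal.Quotient.mk _ _
    rw [← map_mul, IsLocalization.mk'_spec']
  exact (ringKrullDim_le_of_surjective ψ hψ).trans
    (IsLocalization.AtPrime.ringKrullDim_eq_height Q _).le

variable {N k : ℕ} (f : Fin k → MvPolynomial (Fin (N + 1)) ℂ)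

/-- The local ring of affine space at the origin. -/
abbrev OriginRing (N : ℕ) : Type :=
  Localization.AtPrime (pointIdeal (0 : Fin (N + 1) → ℂ))

/-- The local ring of the affine cone at its vertex has dimension at most `n + 1`. -/
theorem ringKrullDim_originRing_quotient_le
    (hf0 : ∀ j, eval 0 (f j) = 0)
    (hJ : ∀ z : Fin (N + 1) → ℂ, z ≠ 0 → (∀ j, eval z (f j) = 0) →
      LinearIndependent ℂ fun j l ↦ eval z (pderiv l (f j))) {n : ℕ} (hn : n + k = N) :
    ringKrullDim (OriginRing N ⧸ (Ideal.span (Set.range f)).map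
      (algebraMap (MvPolynomial (Fin (N + 1)) ℂ) (OriginRing N))) ≤ (n + 1 : ℕ) := by
  let P := MvPolynomial (Fin (N + 1)) ℂ
  let I : Ideal P := Ideal.span (Set.range f)
  let R := OriginRing N
  have hIm : I ≤ pointIdeal 0 := Ideal.span_le.mpr (by
    rintro _ ⟨j, rfl⟩
    exact (mem_pointIdeal_iff _ _).mpr (hf0 j))
  let Q : Ideal (P ⧸ I) := (pointIdeal 0).map (Ideal.Quotient.mk I)
  have hQ : Q.comap (Ideal.Quotient.mk I) = pointIdeal 0 := by
    rw [Ideal.comap_map_of_surjective' _ Ideal.Quotient.mk_surjective, Ideal.mk_ker,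
      sup_eq_left.mpr hIm]
  have hQm : Q.IsMaximal := by
    apply Ideal.IsMaximal.map_of_surjective_of_ker_le Ideal.Quotient.mk_surjective
    rwa [Ideal.mk_ker]
  have h1 := height_le_of_jacobian f hJ (r := n) (by simp; omega) Q hQ
  refine (ringKrullDim_localization_quotient_le _ _ Q hQ).trans ?_
  exact_mod_cast h1

/-- The local ring of affine space at the origin has depth `N + 1`, the coordinates forming a
regular sequence, and the equations of the cone cut its dimension down to `n + 1 = N + 1 - k`. Hence
they form a regular sequence, and the local ring of the cone at its vertex has depth `n + 1`. -/
theorem exists_isRegular_originRing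
    (hf0 : ∀ j, eval 0 (f j) = 0)
    (hJ : ∀ z : Fin (N + 1) → ℂ, z ≠ 0 → (∀ j, eval z (f j) = 0) →
      LinearIndependent ℂ fun j l ↦ eval z (pderiv l (f j))) {n : ℕ} (hn : n + k = N) :
    IsWeaklyRegular (OriginRing N) (List.ofFn fun j ↦ algebraMap _ (OriginRing N) (f j)) ∧
    ∃ rs : List (OriginRing N), rs.length = n + 1 ∧
      (∀ r ∈ rs, r ∈ IsLocalRing.maximalIdeal (OriginRing N)) ∧
      IsWeaklyRegular (OriginRing N ⧸ (Ideal.span (Set.range f)).map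
        (algebraMap (MvPolynomial (Fin (N + 1)) ℂ) (OriginRing N))) rs := by
  have hmem : ∀ p : MvPolynomial (Fin (N + 1)) ℂ, eval 0 p = 0 →
      algebraMap _ (OriginRing N) p ∈ IsLocalRing.maximalIdeal (OriginRing N) := fun p hp ↦ by
    rw [IsLocalization.AtPrime.to_map_mem_maximal_iff _ (pointIdeal 0), mem_pointIdeal_iff, hp]
  have hX := (isWeaklyRegular_X (N + 1)).isRegular_of_isLocalization_of_mem
    (OriginRing N) (pointIdeal 0) (by simp [List.mem_ofFn, mem_pointIdeal_iff])
  have hI : (Ideal.ofList (List.ofFn fun j ↦ algebraMap _ (OriginRing N) (f j)) • ⊤ :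
      Submodule (OriginRing N) (OriginRing N)) = (Ideal.span (Set.range f)).map
        (algebraMap (MvPolynomial (Fin (N + 1)) ℂ) (OriginRing N)) := by
    rw [ofList_ofFn, smul_eq_mul, Ideal.mul_top, Ideal.map_span, ← Set.range_comp]
    rfl
  obtain ⟨h1, rs, h2, h3, h4⟩ := isWeaklyRegular_of_supportDim_le
    (R := OriginRing N) (M := OriginRing N)
    (List.ofFn fun j ↦ algebraMap _ (OriginRing N) (f j)) (r := n + 1) (by
      simp only [List.mem_ofFn]
      rintro _ ⟨j, rfl⟩
      exact hmem _ (hf0 j)) _ (by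
      simp only [List.mem_map, List.mem_ofFn]
      rintro _ ⟨_, ⟨j, rfl⟩, rfl⟩
      exact hmem _ (by simp)) hX (by simp; omega) (by
      rw [hI, Module.supportDim_quotient_eq_ringKrullDim]
      exact ringKrullDim_originRing_quotient_le f hf0 hJ hn)
  refine ⟨h1, rs, h2, h3, ?_⟩
  rw [hI] at h4
  exact h4.toIsWeaklyRegular

end LocalRing

/-! ### Homogeneous ideals and the local ring at the origin -/

section Descent

open RingTheory.Sequence

/-- A polynomial which does not vanish at the origin is invertible modulo high powers of the ideal
of the origin, by the geometric series. -/
theorem exists_mul_eq_one_sub {σ : Type} [Fintype σ] {s : MvPolynomial σ ℂ} (hs : eval 0 s ≠ 0)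
    (D : ℕ) :
    ∃ w, ∃ v ∈ idealOfVars σ ℂ ^ D, w * s = 1 - v := by
  set u := 1 - C (eval 0 s)⁻¹ * s with hu
  have hu' : u ∈ idealOfVars σ ℂ := by
    rw [← pointIdeal_zero_eq, mem_pointIdeal_iff, hu]
    rw [map_sub, map_mul, eval_C, map_one, inv_mul_cancel₀ hs, sub_self]
  refine ⟨(∑ i ∈ Finset.range D, u ^ i) * C (eval 0 s)⁻¹, u ^ D, Ideal.pow_mem_pow hu' D, ?_⟩
  rw [← geom_sum_mul_neg, mul_assoc]
  congr 1
  rw [hu]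
  ring

theorem coe_decompose_eq {σ : Type} (p : MvPolynomial σ ℂ) (t : ℕ) :
    (DirectSum.decompose (homogeneousSubmodule σ ℂ) p t : MvPolynomial σ ℂ) =
      homogeneousComponent t p :=
  decomposition.decompose'_apply p t

theorem coe_decompose_eq_zero_of_mem_pow {σ : Type} {v : MvPolynomial σ ℂ} {D t : ℕ}
    (hv : v ∈ idealOfVars σ ℂ ^ D) (ht : t < D) :
    (DirectSum.decompose (homogeneousSubmodule σ ℂ) v t : MvPolynomial σ ℂ) = 0 := by
  rw [mem_pow_idealOfVars_iff] at hv
  rw [coe_decompose_eq]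
  refine homogeneousComponent_eq_zero' t v fun a ha h ↦ ?_
  have := hv a ha
  omega

/-- A homogeneous ideal is saturated with respect to the polynomials not vanishing at the origin. -/
theorem mem_of_mul_mem_of_eval_ne_zero {σ : Type} [Fintype σ] {J : Ideal (MvPolynomial σ ℂ)}
    (hJ : J.IsHomogeneous (homogeneousSubmodule σ ℂ)) {s h : MvPolynomial σ ℂ}
    (hs : eval 0 s ≠ 0) (hsh : s * h ∈ J) : h ∈ J := by
  obtain ⟨w, v, hv, hw⟩ := exists_mul_eq_one_sub hs (h.totalDegree + 1)
  -- The components of `h` agree with those of `h - v * h`, as `v` has large order.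
  have h1 : h - v * h ∈ J := by
    have := J.mul_mem_left w hsh
    rwa [← mul_assoc, hw, sub_mul, one_mul] at this
  rw [← sum_homogeneousComponent h]
  refine sum_mem fun t ht ↦ ?_
  have h2 := hJ t h1
  rw [DirectSum.decompose_sub, DirectSum.sub_apply, AddSubgroupClass.coe_sub,
    coe_decompose_eq_zero_of_mem_pow (Ideal.mul_mem_right h _ hv) (Finset.mem_range.mp ht),
    sub_zero, coe_decompose_eq] at h2
  exact h2

variable {N k : ℕ}

/-- Membership in a homogeneous ideal can be tested in the local ring at the origin. -/
theorem algebraMap_originRing_mem_map_iff {J : Ideal (MvPolynomial (Fin (N + 1)) ℂ)}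
    (hJ : J.IsHomogeneous (homogeneousSubmodule (Fin (N + 1)) ℂ))
    {h : MvPolynomial (Fin (N + 1)) ℂ} :
    algebraMap _ (OriginRing N) h ∈ J.map (algebraMap _ (OriginRing N)) ↔ h ∈ J := by
  refine ⟨fun hh ↦ ?_, Ideal.mem_map_of_mem _⟩
  rw [IsLocalization.algebraMap_mem_map_algebraMap_iff (pointIdeal 0).primeCompl] at hh
  obtain ⟨s, hs, hsh⟩ := hh
  exact mem_of_mul_mem_of_eval_ne_zero hJ
    (fun h0 ↦ hs ((mem_pointIdeal_iff _ _).mpr h0)) hsh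

/-- Regularity on a quotient of `R ⧸ I` in terms of ideals of `R`. -/
theorem IsSMulRegular.mem_sup_of_mul_mem {R : Type} [CommRing R] {I J : Ideal R} {r : R}
    (h : IsSMulRegular ((R ⧸ I) ⧸ (J • ⊤ : Submodule R (R ⧸ I))) r) {x : R}
    (hx : r * x ∈ I ⊔ J) : x ∈ I ⊔ J := by
  have h1 : ∀ y : R, (Submodule.Quotient.mk (Submodule.Quotient.mk y) :
      (R ⧸ I) ⧸ (J • ⊤ : Submodule R (R ⧸ I))) = 0 ↔ y ∈ I ⊔ J := by
    intro y
    have h2 : (J • ⊤ : Submodule R (R ⧸ I)) = Submodule.map (Submodule.mkQ I) J := by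
      conv_rhs => rw [← Ideal.mul_top J, ← smul_eq_mul, Submodule.map_smul'', Submodule.map_top,
        Submodule.range_mkQ]
    rw [Submodule.Quotient.mk_eq_zero, h2]
    rw [← Submodule.mkQ_apply, ← Submodule.mem_comap, Submodule.comap_map_mkQ]
  rw [isSMulRegular_iff_right_eq_zero_of_smul] at h
  rw [← h1]
  refine h _ ?_
  rw [← Submodule.Quotient.mk_smul, ← Submodule.Quotient.mk_smul, h1]
  exact hx

/-- If `a, b` is a regular sequence modulo `I`, then so is `a ^ r, b`. -/
theorem mem_sup_span_pow_of_mul_mem {R : Type} [CommRing R] {I : Ideal R} {a b : R}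
    (ha : ∀ x, a * x ∈ I → x ∈ I)
    (hb : ∀ x, b * x ∈ I ⊔ Ideal.span {a} → x ∈ I ⊔ Ideal.span {a}) (r : ℕ) (x : R)
    (hx : b * x ∈ I ⊔ Ideal.span {a ^ r}) : x ∈ I ⊔ Ideal.span {a ^ r} := by
  induction r generalizing x with
  | zero => simp
  | succ r ih =>
    have h0 : I ⊔ Ideal.span {a ^ (r + 1)} ≤ I ⊔ Ideal.span {a} :=
      sup_le_sup_left (Ideal.span_singleton_le_span_singleton.mpr (dvd_pow_self a (by simp))) _
    obtain ⟨y, hy, z, hz, rfl⟩ := Submodule.mem_sup.mp (hb x (h0 hx))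
    obtain ⟨c, rfl⟩ := Ideal.mem_span_singleton'.mp hz
    obtain ⟨y', hy', z', hz', h1⟩ := Submodule.mem_sup.mp hx
    obtain ⟨c', rfl⟩ := Ideal.mem_span_singleton'.mp hz'
    have h2 : b * c - c' * a ^ r ∈ I := ha _ (by
      have : a * (b * c - c' * a ^ r) = y' - b * y := by linear_combination (-1 : R) * h1
      rw [this]
      exact sub_mem hy' (Ideal.mul_mem_left _ _ hy))
    have h3 := ih c (by
      have : b * c = (b * c - c' * a ^ r) + c' * a ^ r := by ring
      rw [this]
      exact add_mem (Ideal.mem_sup_left h2)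
        (Ideal.mem_sup_right (Ideal.mul_mem_left _ _ (Ideal.mem_span_singleton_self _))))
    refine add_mem (Ideal.mem_sup_left hy) ?_
    obtain ⟨y'', hy'', z'', hz'', rfl⟩ := Submodule.mem_sup.mp h3
    obtain ⟨c'', rfl⟩ := Ideal.mem_span_singleton'.mp hz''
    rw [add_mul, mul_assoc, ← pow_succ]
    exact add_mem (Ideal.mem_sup_left (Ideal.mul_mem_right _ _ hy''))
      (Ideal.mem_sup_right (Ideal.mul_mem_left _ _ (Ideal.mem_span_singleton_self _)))

theorem mem_of_pow_mul_mem {R : Type} [CommRing R] {I : Ideal R} {a : R}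
    (ha : ∀ x, a * x ∈ I → x ∈ I) (r : ℕ) (x : R) (hx : a ^ r * x ∈ I) : x ∈ I := by
  induction r with
  | zero => simpa using hx
  | succ r ih =>
    refine ih (ha _ ?_)
    rwa [← mul_assoc, ← pow_succ']

/-- The powers of the coordinates generate an ideal primary to the maximal ideal. -/
theorem exists_pow_mem_span_X_pow (e : ℕ) : ∃ r : ℕ,
    ∀ l ∈ IsLocalRing.maximalIdeal (OriginRing N), ∃ α : Fin (N + 1) → OriginRing N,
      l ^ r = ∑ i, α i * algebraMap (MvPolynomial (Fin (N + 1)) ℂ) (OriginRing N) (X i) ^ e := by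
  set J : Ideal (OriginRing N) :=
    Ideal.span (Set.range fun i ↦ algebraMap (MvPolynomial (Fin (N + 1)) ℂ) (OriginRing N) (X i) ^
      e) with hJ
  have h1 : IsLocalRing.maximalIdeal (OriginRing N) ≤ J.radical := by
    rw [← IsLocalization.AtPrime.map_eq_maximalIdeal (pointIdeal (0 : Fin (N + 1) → ℂ)),
      Ideal.map_le_iff_le_comap]
    refine Ideal.span_le.mpr ?_
    rintro _ ⟨i, rfl⟩
    refine ⟨e, Ideal.subset_span ⟨i, ?_⟩⟩
    simp
  obtain ⟨r, hr⟩ := Ideal.exists_pow_le_of_le_radical_of_fg h1 (IsNoetherian.noetherian _)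
  refine ⟨r, fun l hl ↦ ?_⟩
  have h2 := hr (Ideal.pow_mem_pow hl r)
  obtain ⟨α, hα⟩ := (Ideal.mem_span_range_iff_exists_fun).mp h2
  exact ⟨α, hα.symm⟩

end Descent

/-! ### Forms given by compatible fractions -/

section Gluing

open RingTheory.Sequence

variable {N n k : ℕ} {d : Fin k → ℕ} {f : Fin k → MvPolynomial (Fin (N + 1)) ℂ}

theorem eval_zero_of_isHomogeneous (hf : ∀ i, (f i).IsHomogeneous (d i)) (hd : ∀ i, 1 ≤ d i)
    (j : Fin k) :
    eval 0 (f j) = 0 := by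
  rw [eval_zero]
  exact (hf j).coeff_eq_zero (by have := hd j; simp; omega)

/-- The ideal of the intersection in the local ring at the vertex of the affine cone. -/
abbrev originIdeal (f : Fin k → MvPolynomial (Fin (N + 1)) ℂ) : Ideal (OriginRing N) :=
  (Ideal.span (Set.range f)).map (algebraMap (MvPolynomial (Fin (N + 1)) ℂ) (OriginRing N))

theorem span_isHomogeneous (hf : ∀ i, (f i).IsHomogeneous (d i)) :
    (Ideal.span (Set.range f)).IsHomogeneous (homogeneousSubmodule (Fin (N + 1)) ℂ) :=
  Ideal.homogeneous_span _ _ (by rintro _ ⟨i, rfl⟩; exact ⟨d i, hf i⟩)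

section

variable (hf : ∀ i, (f i).IsHomogeneous (d i)) (hd : ∀ i, 1 ≤ d i)
  (hJ : ∀ z : Fin (N + 1) → ℂ, z ≠ 0 → (∀ j, eval z (f j) = 0) →
      LinearIndependent ℂ fun j l ↦ eval z (pderiv l (f j))) (hn : n + k = N)

include hf hd hJ hn

/-- The equations of the smooth complete intersection form a regular sequence. -/
theorem mem_prefixIdeal_of_mul_mem (j : Fin k) (h : MvPolynomial (Fin (N + 1)) ℂ)
    (hh : f j * h ∈ prefixIdeal f j) : h ∈ prefixIdeal f j := by
  have h1 := (exists_isRegular_originRing f (eval_zero_of_isHomogeneous hf hd) hJ hn).1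
  rw [isWeaklyRegular_ofFn_iff] at h1
  have h2 : (prefixIdeal f j).map (algebraMap _ (OriginRing N)) =
      Ideal.span ((fun j ↦ algebraMap _ (OriginRing N) (f j)) '' {l | (l : ℕ) < j}) := by
    rw [prefixIdeal, Ideal.map_span, ← Set.image_comp]
    rfl
  rw [← algebraMap_originRing_mem_map_iff (prefixIdeal_isHomogeneous hf j), h2]
  refine h1 j _ ?_
  rw [← map_mul, ← h2]
  exact Ideal.mem_map_of_mem _ hh

/-- The first two members of a regular sequence on the local ring of the cone at its vertex; the
second one exists in positive dimension. -/
theorem exists_regular_originIdeal : ∃ l ∈ IsLocalRing.maximalIdeal (OriginRing N),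
    (∀ x, l * x ∈ originIdeal f → x ∈ originIdeal f) ∧
    (1 ≤ n → ∃ l' ∈ IsLocalRing.maximalIdeal (OriginRing N),
      ∀ x, l' * x ∈ originIdeal f ⊔ Ideal.span {l} → x ∈ originIdeal f ⊔ Ideal.span {l}) := by
  obtain ⟨rs, h2, h3, h4⟩ :=
    (exists_isRegular_originRing f (eval_zero_of_isHomogeneous hf hd) hJ hn).2
  rw [isWeaklyRegular_iff] at h4
  refine ⟨rs[0], h3 _ (by simp), fun x hx ↦ ?_, fun h1 ↦ ⟨rs[1], h3 _ (by simp), fun x hx ↦ ?_⟩⟩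
  · have := (h4 0 (by omega)).mem_sup_of_mul_mem (x := x)
    simp only [List.take_zero, Ideal.ofList_nil, sup_bot_eq] at this
    exact this hx
  · have h5 := (h4 1 (by omega)).mem_sup_of_mul_mem (x := x)
    have h6 : rs.take 1 = [rs[0]] := by
      rw [List.take_one, List.head?_eq_getElem?, List.getElem?_eq_getElem (by omega)]
      rfl
    rw [h6, Ideal.ofList_singleton] at h5
    exact h5 hx

/-- The vertex is not an embedded component of the cone: a polynomial which lies in the ideal after
multiplication by a power of each coordinate lies in the ideal. -/
theorem mem_of_forall_mul_X_pow_mem (e : ℕ) (a : MvPolynomial (Fin (N + 1)) ℂ)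
    (ha : ∀ j, a * X j ^ e ∈ Ideal.span (Set.range f)) : a ∈ Ideal.span (Set.range f) := by
  obtain ⟨l, hl, h1, -⟩ := exists_regular_originIdeal hf hd hJ hn
  obtain ⟨r, hr⟩ := exists_pow_mem_span_X_pow (N := N) e
  -- A power of the nonzerodivisor `l` is a combination of the `X_j ^ e`, so it multiplies `a` into
  -- the ideal.
  obtain ⟨α, hα⟩ := hr l hl
  rw [← algebraMap_originRing_mem_map_iff (span_isHomogeneous hf)]
  refine mem_of_pow_mul_mem h1 r _ ?_
  rw [hα, Finset.sum_mul]
  refine sum_mem fun i _ ↦ ?_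
  have := Ideal.mem_map_of_mem (algebraMap _ (OriginRing N)) (ha i)
  rw [map_mul, map_pow] at this
  rw [mul_assoc, mul_comm _ (algebraMap _ _ a)]
  exact Ideal.mul_mem_left _ _ this

/-- In positive dimension, a section given by compatible fractions with denominators `X_j ^ e` is
given, in the local ring at the vertex, by one element, as this ring has depth two. -/
theorem exists_sub_mem_originIdeal (h1n : 1 ≤ n) (e : ℕ)
    (g : Fin (N + 1) → MvPolynomial (Fin (N + 1)) ℂ)
    (hg : ∀ i j, g i * X j ^ e - g j * X i ^ e ∈ Ideal.span (Set.range f)) :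
    ∃ a : OriginRing N, ∀ j, algebraMap _ (OriginRing N) (g j) -
      a * algebraMap (MvPolynomial (Fin (N + 1)) ℂ) (OriginRing N) (X j) ^ e ∈ originIdeal f := by
  obtain ⟨l, hl, h1, h2⟩ := exists_regular_originIdeal hf hd hJ hn
  obtain ⟨l', hl', h2⟩ := h2 h1n
  obtain ⟨r, hr⟩ := exists_pow_mem_span_X_pow (N := N) e
  obtain ⟨α, hα⟩ := hr l hl
  obtain ⟨β, hβ⟩ := hr l' hl'
  set G : Fin (N + 1) → OriginRing N := fun j ↦ algebraMap _ (OriginRing N) (g j) with hG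
  set x : Fin (N + 1) → OriginRing N := fun j ↦
    algebraMap (MvPolynomial (Fin (N + 1)) ℂ) (OriginRing N) (X j) ^ e with hx
  have hgx : ∀ i j, G i * x j - G j * x i ∈ originIdeal f := fun i j ↦ by
    have := Ideal.mem_map_of_mem (algebraMap _ (OriginRing N)) (hg i j)
    simpa [hG, hx] using this
  have key : ∀ (γ : Fin (N + 1) → OriginRing N) j,
      (∑ i, γ i * G i) * x j - (∑ i, γ i * x i) * G j ∈ originIdeal f := by
    intro γ j
    rw [Finset.sum_mul, Finset.sum_mul, ← Finset.sum_sub_distrib]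
    refine sum_mem fun i _ ↦ ?_
    have : γ i * G i * x j - γ i * x i * G j = γ i * (G i * x j - G j * x i) := by ring
    rw [this]
    exact Ideal.mul_mem_left _ _ (hgx i j)
  -- In the local ring, `a₁ / l ^ r` and `a₂ / l' ^ r` are two presentations of the same fraction.
  -- As `l ^ r, l'` is a regular sequence, `a₁` is divisible by `l ^ r` modulo the ideal.
  set a₁ := ∑ i, α i * G i
  set a₂ := ∑ i, β i * G i
  have h3 : l' ^ r * a₁ - l ^ r * a₂ ∈ originIdeal f := by
    have : l' ^ r * a₁ - l ^ r * a₂ = ∑ j, β j * (a₁ * x j - (∑ i, α i * x i) * G j) := by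
      rw [hα, hβ]
      simp only [mul_sub, Finset.sum_sub_distrib]
      congr 1
      · rw [Finset.sum_mul]
        exact Finset.sum_congr rfl fun j _ ↦ by ring
      · rw [Finset.mul_sum]
        exact Finset.sum_congr rfl fun j _ ↦ by ring
    rw [this]
    exact sum_mem fun j _ ↦ Ideal.mul_mem_left _ _ (key α j)
  have h4 : ∀ (q : ℕ) (y : OriginRing N), l' ^ q * y ∈ originIdeal f ⊔ Ideal.span {l ^ r} →
      y ∈ originIdeal f ⊔ Ideal.span {l ^ r} := fun q y hy ↦
    mem_of_pow_mul_mem (mem_sup_span_pow_of_mul_mem h1 h2 r) q y hy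
  have h5 := h4 r a₁ (by
    have : l' ^ r * a₁ = (l' ^ r * a₁ - l ^ r * a₂) + l ^ r * a₂ := by ring
    rw [this]
    exact add_mem (Ideal.mem_sup_left h3)
      (Ideal.mem_sup_right (Ideal.mul_mem_right _ _ (Ideal.mem_span_singleton_self _))))
  obtain ⟨y, hy, z, hz, hyz⟩ := Submodule.mem_sup.mp h5
  obtain ⟨a, rfl⟩ := Ideal.mem_span_singleton'.mp hz
  refine ⟨a, fun j ↦ mem_of_pow_mul_mem h1 r _ ?_⟩
  have : l ^ r * (G j - a * x j) = -(a₁ * x j - (∑ i, α i * x i) * G j) + y * x j := by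
    rw [← hyz, ← hα]
    ring
  rw [this]
  exact add_mem (neg_mem (key α j)) (Ideal.mul_mem_right _ _ hy)

/-- In positive dimension, a form given by compatible fractions is given by a polynomial: the
element of the local ring at the vertex has a polynomial representative modulo high powers of the
ideal of the origin, and its component of the right degree has the required property. -/
theorem exists_homogeneous_of_pos (h1n : 1 ≤ n) (e m : ℕ)
    (g : Fin (N + 1) → MvPolynomial (Fin (N + 1)) ℂ) (hgm : ∀ i, (g i).IsHomogeneous (m + e))
    (hg : ∀ i j, g i * X j ^ e - g j * X i ^ e ∈ Ideal.span (Set.range f)) :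
    ∃ a : MvPolynomial (Fin (N + 1)) ℂ, a.IsHomogeneous m ∧
      ∀ j, g j - a * X j ^ e ∈ Ideal.span (Set.range f) := by
  obtain ⟨a, ha⟩ := exists_sub_mem_originIdeal hf hd hJ hn h1n e g hg
  obtain ⟨p, s, rfl⟩ := IsLocalization.exists_mk'_eq (pointIdeal (0 : Fin (N + 1) → ℂ)).primeCompl a
  have hs : eval 0 (s : MvPolynomial (Fin (N + 1)) ℂ) ≠ 0 := fun h ↦
    s.2 ((mem_pointIdeal_iff _ _).mpr h)
  -- The correction `v` has order above `m + e`, so it does not affect components of degree `m + e`.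
  obtain ⟨w, v, hv, hw⟩ := exists_mul_eq_one_sub hs (m + e + 1)
  have h1 : ∀ j, g j * (s : MvPolynomial (Fin (N + 1)) ℂ) - p * X j ^ e ∈ Ideal.span
    (Set.range f) := by
    intro j
    rw [← algebraMap_originRing_mem_map_iff (span_isHomogeneous hf)]
    have := Ideal.mul_mem_right (algebraMap _ (OriginRing N) (s : MvPolynomial (Fin (N + 1)) ℂ)) _
      (ha j)
    rw [sub_mul, mul_right_comm, IsLocalization.mk'_spec, ← map_pow, ← map_mul, ← map_mul,
      ← map_sub] at this
    exact this
  refine ⟨homogeneousComponent m (w * p), homogeneousComponent_isHomogeneous _ _, fun j ↦ ?_⟩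
  have h2 : g j - v * g j - w * p * X j ^ e ∈ Ideal.span (Set.range f) := by
    have := Ideal.mul_mem_left _ w (h1 j)
    convert this using 1
    linear_combination (-g j) * hw
  have h3 := span_isHomogeneous hf (m + e) h2
  have hX : X j ^ e ∈ homogeneousSubmodule (Fin (N + 1)) ℂ e := by
    have := (isHomogeneous_X ℂ j).pow e
    rwa [one_mul] at this
  rw [DirectSum.decompose_sub, DirectSum.sub_apply, AddSubgroupClass.coe_sub,
    DirectSum.decompose_sub, DirectSum.sub_apply, AddSubgroupClass.coe_sub,
    coe_decompose_eq_zero_of_mem_pow (Ideal.mul_mem_right _ _ hv) (Nat.lt_succ_self _), sub_zero,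
    DirectSum.decompose_of_mem_same _ (hgm j),
    DirectSum.coe_decompose_mul_of_right_mem_of_le _ hX (by omega), Nat.add_sub_cancel,
    coe_decompose_eq] at h3
  exact h3

omit hd hn in
/-- In dimension zero all equations are linear, and the coordinates are proportional. -/
theorem exists_X_sub_C_mul_X_mem (hd1 : ∀ i, d i = 1) (hk : k = N) :
    ∃ (l : Fin (N + 1)) (c : Fin (N + 1) → ℂ), ∀ j,
      X j - C (c j) * X l ∈ Ideal.span (Set.range f) := by
  classical
  have h0 : ∀ i l, pderiv l (f i) = C (eval 0 (pderiv l (f i))) := by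
    intro i l
    have h1 : (pderiv l (f i)).IsHomogeneous 0 := by simpa [hd1 i] using (hf i).pderiv (i := l)
    have h2 := totalDegree_eq_zero_iff_eq_C.mp (Nat.le_zero.mp h1.totalDegree_le)
    rw [h2]
    simp
  set v : Fin k → Fin (N + 1) → ℂ := fun i l ↦ eval 0 (pderiv l (f i)) with hv
  have h1 : ∀ i, f i = ∑ l, C (v i l) * X l := by
    intro i
    have := (hf i).sum_X_mul_pderiv
    rw [hd1 i, one_smul] at this
    rw [← this]
    exact Finset.sum_congr rfl fun l _ ↦ by rw [h0 i l, mul_comm]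
  -- The `N` linear equations in `N + 1` variables have a nonzero solution `z`.
  obtain ⟨z, hz, hz0⟩ := (Submodule.ne_bot_iff _).mp (LinearMap.ker_ne_bot_of_finrank_lt
    (f := Matrix.mulVecLin (Matrix.of v)) (by simp; omega))
  have hz' : ∀ i, ∑ l, v i l * z l = 0 := fun i ↦ congrFun hz i
  have hli := hJ z hz0 (fun i ↦ by rw [h1 i]; simpa using hz' i)
  have hli' : LinearIndependent ℂ v := by
    convert hli using 3 with i l
    rw [h0 i l, eval_C]
  obtain ⟨l, hl⟩ := Function.ne_iff.mp hz0
  set W := Submodule.span ℂ (Set.range v) with hW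
  have hWz : ∀ w ∈ W, ∑ l, w l * z l = 0 := by
    intro w hw
    induction hw using Submodule.span_induction with
    | mem x hx => obtain ⟨i, rfl⟩ := hx; exact hz' i
    | zero => simp
    | add x y _ _ hx hy => simp [add_mul, Finset.sum_add_distrib, hx, hy]
    | smul c x _ hx => simp [mul_assoc, ← Finset.mul_sum, hx]
  have hlW : (Pi.single l 1 : Fin (N + 1) → ℂ) ∉ W := by
    intro h
    have := hWz _ h
    rw [Finset.sum_eq_single l (fun b _ hb ↦ by simp [hb]) (by simp)] at this
    exact hl (by simpa using this)
  have htop : W ⊔ Submodule.span ℂ {(Pi.single l 1 : Fin (N + 1) → ℂ)} = ⊤ := by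
    apply Submodule.eq_top_of_finrank_eq
    have hlt : W < W ⊔ Submodule.span ℂ {(Pi.single l 1 : Fin (N + 1) → ℂ)} :=
      lt_of_le_of_ne le_sup_left fun h ↦ hlW (by
        rw [h]; exact Submodule.mem_sup_right (Submodule.mem_span_singleton_self _))
    have h2 := Submodule.finrank_lt_finrank_of_lt hlt
    have h3 := Submodule.finrank_le (W ⊔ Submodule.span ℂ {(Pi.single l 1 : Fin (N + 1) → ℂ)})
    have h4 : Module.finrank ℂ W = k := by rw [hW, finrank_span_eq_card hli', Fintype.card_fin]
    rw [Module.finrank_fintype_fun_eq_card, Fintype.card_fin] at h3 ⊢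
    omega
  have hWI : ∀ w ∈ W, ∑ l, C (w l) * X l ∈ Ideal.span (Set.range f) := by
    intro w hw
    induction hw using Submodule.span_induction with
    | mem x hx =>
      obtain ⟨i, rfl⟩ := hx
      rw [← h1]
      exact Ideal.subset_span ⟨i, rfl⟩
    | zero => simp
    | add x y _ _ hx hy =>
      simpa only [Pi.add_apply, map_add, add_mul, Finset.sum_add_distrib] using add_mem hx hy
    | smul c x _ hx =>
      simpa only [Pi.smul_apply, smul_eq_mul, map_mul, mul_assoc, ← Finset.mul_sum] using
        Ideal.mul_mem_left _ (C c) hx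
  have h4 : ∀ j, ∃ c : ℂ, X j - C c * X l ∈ Ideal.span (Set.range f) := by
    intro j
    obtain ⟨w, hw, u, hu, hwu⟩ := Submodule.mem_sup.mp
      (htop.ge (Submodule.mem_top (x := (Pi.single j 1 : Fin (N + 1) → ℂ))))
    obtain ⟨c, rfl⟩ := Submodule.mem_span_singleton.mp hu
    refine ⟨c, ?_⟩
    convert hWI w hw using 1
    have : w = Pi.single j 1 - c • (Pi.single l 1 : Fin (N + 1) → ℂ) := by rw [← hwu]; simp
    rw [this]
    simp only [Pi.sub_apply, Pi.smul_apply, smul_eq_mul, map_sub, map_mul, sub_mul,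
      Finset.sum_sub_distrib, mul_assoc, ← Finset.mul_sum]
    congr 1
    · rw [Finset.sum_eq_single j] <;> simp +contextual
    · rw [Finset.sum_eq_single l] <;> simp +contextual
  choose c hc using h4
  exact ⟨l, c, hc⟩

omit hf hd hJ hn in
/-- If all coordinates are multiples of `X_l` modulo `I`, then so are the forms of degree `t` of
`X_l ^ t`. -/
theorem sub_C_eval_mul_X_pow_mem {I : Ideal (MvPolynomial (Fin (N + 1)) ℂ)} {l : Fin (N + 1)}
    {c : Fin (N + 1) → ℂ} (hc : ∀ j, X j - C (c j) * X l ∈ I) {t : ℕ}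
    {p : MvPolynomial (Fin (N + 1)) ℂ} (hp : p.IsHomogeneous t) :
    p - C (eval c p) * X l ^ t ∈ I := by
  have h : ∀ j, Ideal.Quotient.mk I (X j) = Ideal.Quotient.mk I (C (c j)) *
      Ideal.Quotient.mk I (X l) := fun j ↦ by
    rw [← map_mul]
    exact Ideal.Quotient.eq.mpr (hc j)
  have h1 : ∀ a ∈ p.support, monomial a (p.coeff a) -
      C (eval c (monomial a (p.coeff a))) * X l ^ t ∈ I := by
    intro a ha
    have hat : ∑ i, a i = t := by
      have := hp (mem_support_iff.mp ha)
      rwa [← Finsupp.degree_eq_sum, Finsupp.degree_eq_weight_one]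
    rw [← Ideal.Quotient.eq, eval_monomial, monomial_eq, Finsupp.prod_fintype _ _ (by simp),
      Finsupp.prod_fintype _ _ (by simp)]
    have h2 : ∏ i, Ideal.Quotient.mk I (X i) ^ a i =
        ∏ i, (Ideal.Quotient.mk I (C (c i)) ^ a i * Ideal.Quotient.mk I (X l) ^ a i) :=
      Finset.prod_congr rfl fun i _ ↦ by rw [h i, mul_pow]
    simp only [map_mul, map_prod, map_pow, h2, Finset.prod_mul_distrib,
      Finset.prod_pow_eq_pow_sum, hat, mul_assoc]
  rw [p.as_sum, map_sum, map_sum, Finset.sum_mul, ← Finset.sum_sub_distrib]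
  exact sum_mem h1

/-- A form on the intersection given by compatible fractions with denominators `X_j ^ e` is given
by a polynomial. -/
theorem exists_homogeneous {m : ℕ} (hm : m + ∑ i, d i = N + 1) (hm1 : 1 ≤ m) (e : ℕ)
    (g : Fin (N + 1) → MvPolynomial (Fin (N + 1)) ℂ) (hgm : ∀ i, (g i).IsHomogeneous (m + e))
    (hg : ∀ i j, g i * X j ^ e - g j * X i ^ e ∈ Ideal.span (Set.range f)) :
    ∃ a : MvPolynomial (Fin (N + 1)) ℂ, a.IsHomogeneous m ∧
      ∀ j, g j - a * X j ^ e ∈ Ideal.span (Set.range f) := by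
  rcases Nat.eq_zero_or_pos n with rfl | h1n
  -- If `n = 0`, then `k = N` and `m ≥ 1` leave no room for equations of degree above one.
  · have hd1 : ∀ i, d i = 1 := by
      have h1 : ∑ i : Fin k, 1 ≤ ∑ i, d i := Finset.sum_le_sum fun i _ ↦ hd i
      have h2 : ∑ i : Fin k, 1 = ∑ i, d i := le_antisymm h1 (by simp; omega)
      exact fun i ↦ ((Finset.sum_eq_sum_iff_of_le fun i _ ↦ hd i).mp h2 i (Finset.mem_univ i)).symm
    obtain ⟨l, c, hc⟩ := exists_X_sub_C_mul_X_mem hf hJ hd1 (by omega)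
    have hreg : ∀ x, x * X l ^ e ∈ Ideal.span (Set.range f) → x ∈ Ideal.span (Set.range f) := by
      intro x hx
      refine mem_of_forall_mul_X_pow_mem hf hd hJ hn e x fun j ↦ ?_
      have h1 := Ideal.mul_mem_left _ x
        (sub_C_eval_mul_X_pow_mem hc ((isHomogeneous_X ℂ j).pow e))
      have h2 := Ideal.mul_mem_left _ (C (eval c (X j ^ e))) hx
      convert add_mem h1 h2 using 1
      ring
    refine ⟨C (eval c (g l)) * X l ^ m, ?_, fun j ↦ hreg _ ?_⟩
    · have := (isHomogeneous_C (Fin (N + 1)) (eval c (g l))).mul ((isHomogeneous_X ℂ l).pow m)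
      simpa using this
    · have h1 := Ideal.mul_mem_right (X j ^ e) _ (sub_C_eval_mul_X_pow_mem hc (hgm l))
      convert add_mem (hg j l) h1 using 1
      ring
  · exact exists_homogeneous_of_pos hf hd hJ hn h1n e m g hgm hg

end

end Gluing

/-! ### Smoothness and independence of gradients -/

section SmoothTangent

/-- The derivations of a standard smooth algebra of relative dimension `n` at a point are determined
by `n` parameters. -/
theorem exists_submodule_derivation_mem {C : Type} [CommRing C] [Algebra ℂ C] [Algebra C ℂ]
    [IsScalarTower ℂ C ℂ] {n : ℕ} [Algebra.IsStandardSmoothOfRelativeDimension n ℂ C]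
    {r : ℕ} (y : Fin r → C) : ∃ W : Submodule ℂ (Fin r → ℂ), Module.finrank ℂ W ≤ n ∧
      ∀ D : Derivation ℂ C ℂ, (fun l ↦ D (y l)) ∈ W := by
  have : Nontrivial C := (algebraMap C ℂ).domain_nontrivial
  have : Algebra.IsStandardSmooth ℂ C :=
    Algebra.IsStandardSmoothOfRelativeDimension.isStandardSmooth n
  have hrank := Algebra.IsStandardSmoothOfRelativeDimension.rank_kaehlerDifferential (R := ℂ)
    (S := C) n
  have hfin : Module.finrank C (KaehlerDifferential ℂ C) = n := by
    rw [Module.finrank, hrank]; simp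
  let b := Module.finBasisOfFinrankEq C (KaehlerDifferential ℂ C) hfin
  let w : Fin n → Fin r → ℂ := fun k l ↦
    algebraMap C ℂ (b.repr (KaehlerDifferential.D ℂ C (y l)) k)
  refine ⟨Submodule.span ℂ (Set.range w), (finrank_range_le_card w).trans (by simp), fun D ↦ ?_⟩
  have h1 : (fun l ↦ D (y l)) = ∑ k, D.liftKaehlerDifferential (b k) • w k := by
    funext l
    have h2 : D (y l) = D.liftKaehlerDifferential (KaehlerDifferential.D ℂ C (y l)) := by simp
    rw [h2, ← b.sum_repr (KaehlerDifferential.D ℂ C (y l)), map_sum]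
    simp only [map_smul, Finset.sum_apply, Pi.smul_apply, smul_eq_mul, w]
    exact Finset.sum_congr rfl fun k _ ↦ by rw [Algebra.smul_def, mul_comm]
  rw [h1]
  exact sum_mem fun k _ ↦ Submodule.smul_mem _ _ (Submodule.subset_span ⟨k, rfl⟩)

/-- The tangent vectors at a point, given as homomorphisms to the dual numbers, of a smooth algebra
form a space of the expected dimension. -/
theorem exists_submodule_dualNumber_mem {C : Type} [CommRing C] (φ : ℂ →+* C) {n : ℕ}
    (hφ : φ.IsStandardSmoothOfRelativeDimension n) (ev : C →+* ℂ) (hev : ev.comp φ = RingHom.id ℂ)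
    {r : ℕ} (y : Fin r → C) : ∃ W : Submodule ℂ (Fin r → ℂ), Module.finrank ℂ W ≤ n ∧
      ∀ h : C →+* DualNumber ℂ, (∀ c, h (φ c) = TrivSqZeroExt.inl c) →
        (∀ x, (h x).fst = ev x) → (fun l ↦ (h (y l)).snd) ∈ W := by
  let := φ.toAlgebra
  let := ev.toAlgebra
  have : IsScalarTower ℂ C ℂ := IsScalarTower.of_algebraMap_eq' hev.symm
  have : Algebra.IsStandardSmoothOfRelativeDimension n ℂ C := hφ
  obtain ⟨W, hW, h⟩ := exists_submodule_derivation_mem (n := n) y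
  refine ⟨W, hW, fun g hg1 hg2 ↦ ?_⟩
  let D : Derivation ℂ C ℂ := Derivation.mk'
    { toFun := fun x ↦ (g x).snd
      map_add' := fun x x' ↦ by simp
      map_smul' := fun c x ↦ by
        rw [Algebra.smul_def, map_mul]
        change (g (φ c) * g x).snd = _
        rw [hg1]
        simp } (fun a b ↦ by
        change (g (a * b)).snd = ev a * (g b).snd + ev b * (g a).snd
        rw [map_mul, TrivSqZeroExt.snd_mul, hg2, hg2]
        simp [mul_comm])
  exact h D

theorem exists_submodule_dualNumber_mem_of_locally {B : Type} [CommRing B] (φ : ℂ →+* B) {n : ℕ}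
    (hφ : RingHom.Locally (RingHom.IsStandardSmoothOfRelativeDimension n) φ) (ev : B →+* ℂ)
    (hev : ev.comp φ = RingHom.id ℂ)
    {r : ℕ} (y : Fin r → B) : ∃ W : Submodule ℂ (Fin r → ℂ), Module.finrank ℂ W ≤ n ∧
      ∀ h : B →+* DualNumber ℂ, (∀ c, h (φ c) = TrivSqZeroExt.inl c) →
        (∀ x, (h x).fst = ev x) → (fun l ↦ (h (y l)).snd) ∈ W := by
  obtain ⟨s, hs, hloc⟩ := hφ
  -- The point lies in one of the open sets of the cover.
  obtain ⟨b, hb, hevb⟩ : ∃ b ∈ s, ev b ≠ 0 := by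
    by_contra! hcon
    have : Ideal.span s ≤ RingHom.ker ev := Ideal.span_le.mpr hcon
    rw [hs, top_le_iff] at this
    exact RingHom.ker_ne_top ev this
  let ev' : Localization.Away b →+* ℂ := IsLocalization.Away.lift b (g := ev) (Ne.isUnit hevb)
  have hev' : ∀ x, ev' (algebraMap B _ x) = ev x := fun x ↦ IsLocalization.Away.lift_eq _ _ _
  obtain ⟨W, hW, h⟩ := exists_submodule_dualNumber_mem _ (hloc b hb) ev' (by
    ext c
    exact (hev' _).trans (RingHom.congr_fun hev c)) (fun l ↦ algebraMap B _ (y l))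
  refine ⟨W, hW, fun g hg1 hg2 ↦ ?_⟩
  have hu : IsUnit (g b) := TrivSqZeroExt.isUnit_iff_isUnit_fst.mpr (by
    rw [hg2]; exact Ne.isUnit hevb)
  let g' : Localization.Away b →+* DualNumber ℂ := IsLocalization.Away.lift b (g := g) hu
  have hg' : ∀ x, g' (algebraMap B _ x) = g x := fun x ↦ IsLocalization.Away.lift_eq _ _ _
  have := h g' (fun c ↦ (hg' _).trans (hg1 c)) (by
    intro x
    have : (TrivSqZeroExt.fstHom ℂ ℂ ℂ).toRingHom.comp g' = ev' :=
      IsLocalization.ringHom_ext (Submonoid.powers b) (by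
        ext x
        change (g' (algebraMap B _ x)).fst = ev' (algebraMap B _ x)
        rw [hg', hev', hg2])
    exact RingHom.congr_fun this x)
  simpa only [hg'] using this

/-- Evaluation at a tangent vector, encoded as a point over the dual numbers. -/
theorem aeval_dualNumber {σ : Type} [Fintype σ] (z V : σ → ℂ) (p : MvPolynomial σ ℂ) :
    aeval (fun l ↦ (TrivSqZeroExt.inl (z l) + TrivSqZeroExt.inr (V l) : DualNumber ℂ)) p =
      TrivSqZeroExt.inl (eval z p) +
        TrivSqZeroExt.inr (∑ l, eval z (pderiv l p) * V l) := by
  classical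
  induction p using MvPolynomial.induction_on with
  | C a => rw [aeval_C, TrivSqZeroExt.algebraMap_eq_inl]; simp
  | add p q hp hq =>
    rw [map_add, hp, hq]
    simp only [map_add, add_mul, Finset.sum_add_distrib, TrivSqZeroExt.inl_add,
      TrivSqZeroExt.inr_add]
    ring
  | mul_X p i hp =>
    rw [map_mul, hp, aeval_X]
    have : ∑ l, eval z (pderiv l (p * X i)) * V l =
        z i * (∑ l, eval z (pderiv l p) * V l) + eval z p * V i := by
      simp only [Derivation.leibniz, pderiv_X, smul_eq_mul, map_add, map_mul, eval_X, add_mul,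
        Finset.sum_add_distrib, Finset.mul_sum]
      rw [add_comm]
      congr 1
      · exact Finset.sum_congr rfl fun l _ ↦ by ring
      · rw [Finset.sum_eq_single i]
        · simp
        · intro l _ hl; simp [Ne.symm hl]
        · simp
    rw [this]
    ext
    · simp
    · simp; ring

variable {N n k : ℕ} {d : Fin k → ℕ} {f : Fin k → MvPolynomial (Fin (N + 1)) ℂ}

/-- The differential of the affine chart `z ↦ (z_l / z_t)_l` has as kernel only the line through
`z`, so a space of tangent vectors of the cone has dimension at most one more than its image. -/
theorem tangentMap_finrank_le {z : Fin (N + 1) → ℂ} {t : Fin (N + 1)} (ht : z t ≠ 0)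
    (K W : Submodule ℂ (Fin (N + 1) → ℂ)) (hW : Module.finrank ℂ W ≤ n)
    (hKW : ∀ V ∈ K, (fun l ↦ (V l * z t - z l * V t) / z t ^ 2) ∈ W) :
    Module.finrank ℂ K ≤ n + 1 := by
  let T : K →ₗ[ℂ] W :=
    { toFun := fun V ↦ ⟨_, hKW V.1 V.2⟩
      map_add' := fun V V' ↦ by ext l; simp; ring
      map_smul' := fun c V ↦ by ext l; simp; ring }
  have h1 := T.finrank_range_add_finrank_ker
  have h2 := Submodule.finrank_le (LinearMap.range T)
  have h3 : T.ker.map K.subtype ≤ Submodule.span ℂ {z} := by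
    rintro _ ⟨V, hV, rfl⟩
    refine Submodule.mem_span_singleton.mpr ⟨(V : Fin (N + 1) → ℂ) t / z t, ?_⟩
    funext l
    have h4 : ((V : Fin (N + 1) → ℂ) l * z t - z l * (V : Fin (N + 1) → ℂ) t) / z t ^ 2 = 0 :=
      congrFun (congrArg Subtype.val (LinearMap.mem_ker.mp hV)) l
    rw [div_eq_zero_iff, or_iff_left (pow_ne_zero 2 ht), sub_eq_zero] at h4
    simp only [Pi.smul_apply, smul_eq_mul, Submodule.subtype_apply]
    field_simp
    linear_combination -h4
  have h5 := Submodule.finrank_mono h3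
  rw [Submodule.finrank_map_subtype_eq] at h5
  have h6 := finrank_span_le_card (R := ℂ) ({z} : Set (Fin (N + 1) → ℂ))
  simp only [Set.toFinset_singleton, Finset.card_singleton] at h6
  omega

open HomogeneousLocalization in
/-- The Jacobian criterion: smoothness of the intersection makes the gradients of the equations
linearly independent at all points of the affine cone except the vertex. -/
theorem linearIndependent_gradient (hf : ∀ i, (f i).IsHomogeneous (d i)) (hn : n + k = N)
    (hX : SmoothOfRelativeDimension n
      (hypersurfacesIntersection d f hf ↘ Spec (CommRingCat.of ℂ)))
    {z : Fin (N + 1) → ℂ} (hz : z ≠ 0) (hfz : ∀ j, eval z (f j) = 0) :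
    LinearIndependent ℂ fun j (l : Fin (N + 1)) ↦ eval z (pderiv l (f j)) := by
  obtain ⟨t, ht⟩ := Function.ne_iff.mp hz
  set I := hypersurfacesIdeal d f hf with hI
  set 𝒜 := quotientGrading I with h𝒜
  set x : Fin (N + 1) → MvPolynomial (Fin (N + 1)) ℂ ⧸ I.toIdeal :=
    fun l ↦ Ideal.Quotient.mk I.toIdeal (X l) with hx
  have hx1 : ∀ l, x l ∈ 𝒜 1 := fun l ↦ mk_mem_quotientGrading I (isHomogeneous_X ℂ l)
  let φ : ℂ →+* Away 𝒜 (x t) :=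
    (fromZeroRingHom 𝒜 (Submonoid.powers (x t))).comp (algebraMap ℂ (𝒜 0))
  have hφ : RingHom.Locally (RingHom.IsStandardSmoothOfRelativeDimension n) φ := by
    have h1 : SmoothOfRelativeDimension (0 + n) (Proj.awayι 𝒜 (x t) (hx1 t) one_pos ≫
        (hypersurfacesIntersection d f hf ↘ Spec (CommRingCat.of ℂ))) :=
      smoothOfRelativeDimension_comp (hg := hX) ..
    rw [zero_add] at h1
    have h2 : Proj.awayι 𝒜 (x t) (hx1 t) one_pos ≫
        (hypersurfacesIntersection d f hf ↘ Spec (CommRingCat.of ℂ)) =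
        Spec.map (CommRingCat.ofHom φ) := by
      change _ ≫ Proj.toSpecZero 𝒜 ≫ _ = _
      rw [Proj.awayι_toSpecZero_assoc, ← Spec.map_comp]
      rfl
    rw [h2] at h1
    exact (HasRingHomProperty.Spec_iff (P := @SmoothOfRelativeDimension n)).mp h1
  let y : Fin (N + 1) → Away 𝒜 (x t) := fun l ↦
    HomogeneousLocalization.mk ⟨1, ⟨x l, hx1 l⟩, ⟨x t, hx1 t⟩, Submonoid.mem_powers _⟩
  set K : Submodule ℂ (Fin (N + 1) → ℂ) :=
    LinearMap.ker (Matrix.mulVecLin (Matrix.of fun j l ↦ eval z (pderiv l (f j)))) with hK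
  have hKmem : ∀ {V}, V ∈ K → ∀ j, ∑ l, eval z (pderiv l (f j)) * V l = 0 :=
    fun hV j ↦ congrFun hV j
  -- a tangent vector of the cone gives a homomorphism to the dual numbers
  have key : ∀ V ∈ K, ∃ g : Localization.Away (x t) →+* DualNumber ℂ,
      (∀ l, g (algebraMap _ _ (x l)) = TrivSqZeroExt.inl (z l) + TrivSqZeroExt.inr (V l)) ∧
      (∀ c : ℂ, g (algebraMap ℂ _ c) = TrivSqZeroExt.inl c) := by
    intro V hV
    let g₀ : MvPolynomial (Fin (N + 1)) ℂ ⧸ I.toIdeal →+* DualNumber ℂ :=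
      Ideal.Quotient.lift I.toIdeal
        (aeval (fun l ↦ (TrivSqZeroExt.inl (z l) + TrivSqZeroExt.inr (V l) :
          DualNumber ℂ))).toRingHom
        (by
          intro a ha
          have : I.toIdeal ≤ RingHom.ker (aeval (fun l ↦ (TrivSqZeroExt.inl (z l) +
              TrivSqZeroExt.inr (V l) : DualNumber ℂ))).toRingHom := Ideal.span_le.mpr (by
            rintro _ ⟨j, rfl⟩
            refine RingHom.mem_ker.mpr ((aeval_dualNumber z V (f j)).trans ?_)
            rw [hfz j, hKmem hV j]
            simp)
          exact this ha)
    have hg₀ : ∀ l, g₀ (x l) = TrivSqZeroExt.inl (z l) + TrivSqZeroExt.inr (V l) := fun l ↦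
      (aeval_X _ l)
    have hu : IsUnit (g₀ (x t)) := TrivSqZeroExt.isUnit_iff_isUnit_fst.mpr (by
      rw [hg₀]; simpa using ht)
    refine ⟨IsLocalization.Away.lift (x t) hu, fun l ↦ ?_, fun c ↦ ?_⟩
    · rw [IsLocalization.Away.lift_eq, hg₀]
    · rw [IsScalarTower.algebraMap_apply ℂ (MvPolynomial (Fin (N + 1)) ℂ ⧸ I.toIdeal),
        IsLocalization.Away.lift_eq]
      exact aeval_C _ c
  obtain ⟨g₀, hg₀, hg₀c⟩ := key 0 (zero_mem K)
  let ev : Localization.Away (x t) →+* ℂ := (TrivSqZeroExt.fstHom ℂ ℂ ℂ).toRingHom.comp g₀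
  have hext : ∀ g g' : Localization.Away (x t) →+* ℂ,
      (∀ l, g (algebraMap _ _ (x l)) = g' (algebraMap _ _ (x l))) →
      (∀ c : ℂ, g (algebraMap ℂ _ c) = g' (algebraMap ℂ _ c)) → g = g' := by
    intro g g' h1 h2
    refine IsLocalization.ringHom_ext (Submonoid.powers (x t)) (Ideal.Quotient.ringHom_ext
      (MvPolynomial.ringHom_ext (fun c ↦ ?_) fun l ↦ h1 l))
    have := h2 c
    rwa [IsScalarTower.algebraMap_apply ℂ (MvPolynomial (Fin (N + 1)) ℂ ⧸ I.toIdeal)] at this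
  have hφc : ∀ c, algebraMap (Away 𝒜 (x t)) (Localization.Away (x t)) (φ c) = algebraMap ℂ _ c := by
    intro c
    exact Eq.trans rfl (Localization.mk_one_eq_algebraMap _)
  obtain ⟨W, hW, hW'⟩ := exists_submodule_dualNumber_mem_of_locally φ hφ
    (ev.comp (algebraMap (Away 𝒜 (x t)) (Localization.Away (x t)))) (by
      ext c
      change ev (algebraMap _ _ (φ c)) = c
      rw [hφc]
      change (g₀ _).fst = c
      rw [hg₀c, TrivSqZeroExt.fst_inl]) y
  -- The kernel of the Jacobian matrix has dimension at most `n + 1`, so its rank is at least `k`.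
  have hKfin : Module.finrank ℂ K ≤ n + 1 := by
    refine tangentMap_finrank_le ht K W hW fun V hV ↦ ?_
    obtain ⟨g, hg, hgc⟩ := key V hV
    have h1 : (TrivSqZeroExt.fstHom ℂ ℂ ℂ).toRingHom.comp g = ev := hext _ _ (fun l ↦ by
        change (g _).fst = (g₀ _).fst
        rw [hg, hg₀]; simp) (fun c ↦ by
        change (g _).fst = (g₀ _).fst
        rw [hgc, hg₀c])
    have h2 := hW' (g.comp (algebraMap _ _)) (fun c ↦ by
      change g (algebraMap _ _ (φ c)) = _
      rw [hφc, hgc]) (fun b ↦ RingHom.congr_fun h1 _)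
    convert h2 using 1
    funext l
    have h3 : algebraMap (Away 𝒜 (x t)) (Localization.Away (x t)) (y l) *
        algebraMap _ _ (x t) = algebraMap _ _ (x l) := by
      have : algebraMap (Away 𝒜 (x t)) (Localization.Away (x t)) (y l) =
        Localization.mk (x l) ⟨x t, Submonoid.mem_powers _⟩ := rfl
      rw [this, Localization.mk_eq_mk']
      exact IsLocalization.mk'_spec _ (x l) (⟨x t, Submonoid.mem_powers _⟩ : Submonoid.powers (x t))
    have h4 := congrArg g h3
    rw [map_mul, hg, hg] at h4
    have h5 := congrArg TrivSqZeroExt.fst h4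
    have h6 := congrArg TrivSqZeroExt.snd h4
    simp at h5 h6
    change _ = (g (algebraMap _ _ (y l))).snd
    rw [div_eq_iff (pow_ne_zero 2 ht)]
    linear_combination (-z t) * h6 + V t * h5
  have h1 := (Matrix.mulVecLin
    (Matrix.of fun j l ↦ eval z (pderiv l (f j)))).finrank_range_add_finrank_ker
  rw [← hK, Module.finrank_fintype_fun_eq_card, Fintype.card_fin] at h1
  have h2 := (Matrix.of fun j l ↦ eval z (pderiv l (f j))).rank_eq_finrank_span_row
  rw [Matrix.rank] at h2
  rw [linearIndependent_iff_card_le_finrank_span, Fintype.card_fin]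
  change _ = Module.finrank ℂ (Submodule.span ℂ
    (Set.range fun j (l : Fin (N + 1)) ↦ eval z (pderiv l (f j)))) at h2
  refine le_trans ?_ h2.le
  omega

end SmoothTangent

/-! ### The determinant of a frame -/

section FrameDet

variable {N n k : ℕ} (e : Fin (N + 1) ≃ (Fin k ⊕ Unit) ⊕ Fin n) {L : Type} [CommRing L]

/-- The determinant with rows `F₁, …, F_k`, the basis vector `e_i`, and `w₁, …, w_n`. The bijection
`e` orders the rows; it affects only the sign. -/
def frameDet (F : Fin k → Fin (N + 1) → L) (i : Fin (N + 1)) (w : Fin n → Fin (N + 1) → L) : L :=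
  (Matrix.detRowAlternating.domDomCongr e :
    (Fin (N + 1) → L) [⋀^(Fin k ⊕ Unit) ⊕ Fin n]→ₗ[L] L)
      (Sum.elim (Sum.elim F fun _ ↦ Pi.single i 1) w)

theorem frameDet_eq_det (F : Fin k → Fin (N + 1) → L) (i : Fin (N + 1))
    (w : Fin n → Fin (N + 1) → L) :
    frameDet e F i w =
      Matrix.det (Matrix.of fun r ↦ Sum.elim (Sum.elim F fun _ ↦ Pi.single i 1) w (e r)) := rfl

theorem frameDet_update_add (F : Fin k → Fin (N + 1) → L) (i : Fin (N + 1))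
    (w : Fin n → Fin (N + 1) → L) (t : Fin n) (a b : Fin (N + 1) → L) :
    frameDet e F i (Function.update w t (a + b)) =
      frameDet e F i (Function.update w t a) + frameDet e F i (Function.update w t b) := by
  simp only [frameDet, ← Sum.update_elim_inr]
  exact AlternatingMap.map_update_add _ _ _ _ _

theorem frameDet_update_smul (F : Fin k → Fin (N + 1) → L) (i : Fin (N + 1))
    (w : Fin n → Fin (N + 1) → L) (t : Fin n) (c : L) (a : Fin (N + 1) → L) :
    frameDet e F i (Function.update w t (c • a)) = c * frameDet e F i (Function.update w t a) := by
  simp only [frameDet, ← Sum.update_elim_inr]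
  exact AlternatingMap.map_update_smul _ _ _ _ _

theorem frameDet_eq_zero_of_eq (F : Fin k → Fin (N + 1) → L) (i : Fin (N + 1))
    (w : Fin n → Fin (N + 1) → L) {t t' : Fin n} (h : w t = w t') (ht : t ≠ t') :
    frameDet e F i w = 0 :=
  AlternatingMap.map_eq_zero_of_eq _ _ (i := .inr t) (j := .inr t') h (by simpa using ht)

theorem frameDet_update_mem_span (F : Fin k → Fin (N + 1) → L) (i : Fin (N + 1))
    (w : Fin n → Fin (N + 1) → L) (t : Fin n) {a : Fin (N + 1) → L}
    (ha : a ∈ Submodule.span L (insert (Pi.single i 1) (Set.range F))) :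
    frameDet e F i (Function.update w t a) = 0 := by
  induction ha using Submodule.span_induction with
  | mem x hx =>
    obtain rfl | ⟨j, rfl⟩ := hx
    · exact AlternatingMap.map_eq_zero_of_eq _ _ (i := .inl (.inr ())) (j := .inr t) (by simp)
        (by simp)
    exact AlternatingMap.map_eq_zero_of_eq _ _ (i := .inl (.inl j)) (j := .inr t) (by simp)
      (by simp)
  | zero =>
    have := frameDet_update_smul e F i w t 0 0
    rwa [zero_smul, zero_mul] at this
  | add x y _ _ hx hy => rw [frameDet_update_add, hx, hy, add_zero]
  | smul c x _ hx => rw [frameDet_update_smul, hx, mul_zero]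

/-- The determinant depends on the rows `w` only modulo the span of the rows `F` and `e_i`. -/
theorem frameDet_congr_insert (F : Fin k → Fin (N + 1) → L) (i : Fin (N + 1))
    {w w' : Fin n → Fin (N + 1) → L}
    (h : ∀ t, w t - w' t ∈ Submodule.span L (insert (Pi.single i 1) (Set.range F))) :
    frameDet e F i w = frameDet e F i w' := by
  classical
  have key : ∀ s : Finset (Fin n), frameDet e F i (s.piecewise w w') = frameDet e F i w' := by
    intro s
    induction s using Finset.induction_on with
    | empty => simp
    | insert t s hts ih =>
      have h1 : w t = s.piecewise w w' t + (w t - w' t) := by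
        rw [Finset.piecewise_eq_of_notMem _ _ _ hts]; abel
      rw [Finset.piecewise_insert, h1, frameDet_update_add, Function.update_eq_self,
        frameDet_update_mem_span e F i _ t (h t), ih, add_zero]
  simpa using key Finset.univ

theorem frameDet_congr (F : Fin k → Fin (N + 1) → L) (i : Fin (N + 1))
    {w w' : Fin n → Fin (N + 1) → L} (h : ∀ t, w t - w' t ∈ Submodule.span L (Set.range F)) :
    frameDet e F i w = frameDet e F i w' :=
  frameDet_congr_insert e F i fun t ↦ Submodule.span_mono (Set.subset_insert _ _) (h t)

theorem frameDet_smul (F : Fin k → Fin (N + 1) → L) (i : Fin (N + 1)) (c : Fin n → L)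
    (w : Fin n → Fin (N + 1) → L) :
    frameDet e F i (fun t ↦ c t • w t) = (∏ t, c t) * frameDet e F i w := by
  have h := (Matrix.detRowAlternating.domDomCongr e :
    (Fin (N + 1) → L) [⋀^(Fin k ⊕ Unit) ⊕ Fin n]→ₗ[L] L).toMultilinearMap.map_smul_univ
      (Sum.elim 1 c) (Sum.elim (Sum.elim F fun _ ↦ Pi.single i 1) w)
  rw [Fintype.prod_sum_type] at h
  simp only [Sum.elim_inl, Sum.elim_inr, Pi.one_apply, Finset.prod_const_one, one_mul] at h
  refine Eq.trans ?_ h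
  unfold frameDet
  refine congrArg _ (funext fun r ↦ ?_)
  rcases r with r | r
  · simp
  · rfl

theorem map_frameDet {L' : Type} [CommRing L'] (χ : L →+* L') (F : Fin k → Fin (N + 1) → L)
    (i : Fin (N + 1)) (w : Fin n → Fin (N + 1) → L) :
    χ (frameDet e F i w) = frameDet e (fun j l ↦ χ (F j l)) i (fun t l ↦ χ (w t l)) := by
  rw [frameDet_eq_det, frameDet_eq_det, RingHom.map_det]
  congr 1
  ext r c
  simp only [RingHom.mapMatrix_apply, Matrix.map_apply, Matrix.of_apply]
  rcases e r with (r | r) | r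
  · rfl
  · by_cases h : c = i
    · subst h; simp
    · simp [h]
  · rfl

/-- The adjugate matrix expresses `det • x l` through the values of the rows on `x`. -/
theorem sum_frameDet_mul (F : Fin k → Fin (N + 1) → L) (i : Fin (N + 1))
    (w : Fin n → Fin (N + 1) → L) {M : Type}
    [AddCommGroup M] [Module L M] (x : Fin (N + 1) → M)
    (l : Fin (N + 1)) :
    frameDet e F i w • x l = ∑ r, Matrix.adjugate
      (Matrix.of fun r ↦ Sum.elim (Sum.elim F fun _ ↦ Pi.single i 1) w (e r)) l r •
        ∑ c, Sum.elim (Sum.elim F fun _ ↦ Pi.single i 1) w (e r) c • x c := by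
  set A := Matrix.of fun r ↦ Sum.elim (Sum.elim F fun _ ↦ Pi.single i 1) w (e r) with hA
  have h1 : ∀ c, ∑ r, A.adjugate l r * A r c = if l = c then A.det else 0 := by
    intro c
    have := congrFun (congrFun A.adjugate_mul l) c
    rw [Matrix.mul_apply] at this
    rw [this, Matrix.smul_apply, Matrix.one_apply]
    simp
  have h2 : ∀ r, (Sum.elim (Sum.elim F fun _ ↦ Pi.single i 1) w (e r)) = A r := fun r ↦ rfl
  simp_rw [h2, Finset.smul_sum, smul_smul]
  rw [Finset.sum_comm]
  simp_rw [← Finset.sum_smul, h1, ite_smul, zero_smul]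
  rw [Finset.sum_ite_eq Finset.univ l]
  simp [frameDet_eq_det, hA]

/-- If all rows except `e_i` are orthogonal to `x`, the determinants for different `i` are
proportional to the coordinates of `x`. -/
theorem mul_frameDet_comm (F : Fin k → Fin (N + 1) → L)
    (w : Fin n → Fin (N + 1) → L) (x : Fin (N + 1) → L) (hF : ∀ j, ∑ c, F j c * x c = 0)
    (hw : ∀ t, ∑ c, w t c * x c = 0) (i l : Fin (N + 1)) :
    x l * frameDet e F i w = x i * frameDet e F l w := by
  have h := sum_frameDet_mul e F i w x l
  rw [smul_eq_mul, Finset.sum_eq_single (e.symm (.inl (.inr ())))] at h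
  · rw [mul_comm, h]
    simp only [Equiv.apply_symm_apply, Sum.elim_inl, Sum.elim_inr, smul_eq_mul]
    rw [Finset.sum_eq_single i (fun b _ hb ↦ by simp [hb]) (by simp), Pi.single_eq_same, one_mul,
      mul_comm, Matrix.adjugate_apply, frameDet_eq_det]
    congr 2
    ext r c
    rw [Matrix.updateRow_apply, Matrix.of_apply, Matrix.of_apply]
    split_ifs with hr
    · rw [hr]; simp
    · have hr' : e r ≠ .inl (.inr ()) := fun h ↦ hr (by rw [← h]; simp)
      rcases h : e r with (r | r) | r
      · simp
      · exact absurd h hr'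
      · simp
  · intro r _ hr
    have hr' : e r ≠ .inl (.inr ()) := fun h ↦ hr (by rw [← h]; simp)
    rcases h : e r with (r | r) | r
    · simp [hF]
    · exact absurd h hr'
    · simp [hw]
  · simp

/-- Cramer's rule: linear relations with coefficients `F` and `e_i` express all `x l`, up to the
determinant, through the chosen `x (K t)`. -/
theorem exists_frameDet_smul_eq (F : Fin k → Fin (N + 1) → L) (i : Fin (N + 1)) {M : Type}
    [AddCommGroup M] [Module L M] (x : Fin (N + 1) → M) (hF : ∀ j, ∑ c, F j c • x c = 0)
    (hi : x i = 0) (K : Fin n → Fin (N + 1)) (l : Fin (N + 1)) :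
    ∃ C : Fin n → L, frameDet e F i (fun t ↦ Pi.single (K t) 1) • x l = ∑ t, C t • x (K t) := by
  refine ⟨fun t ↦ Matrix.adjugate (Matrix.of fun r ↦ Sum.elim (Sum.elim F fun _ ↦ Pi.single i 1)
    (fun t ↦ Pi.single (K t) 1) (e r)) l (e.symm (.inr t)), ?_⟩
  have h1 : ∀ q : Fin (N + 1), ∑ c, (Pi.single q 1 : Fin (N + 1) → L) c • x c = x q := fun q ↦ by
    rw [Finset.sum_eq_single q (fun b _ hb ↦ by simp [hb]) (by simp)]; simp
  rw [sum_frameDet_mul, ← e.symm.sum_comp, Fintype.sum_sum_type, Fintype.sum_sum_type]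
  simp [hF, h1, hi]

end FrameDet

/-! ### The gradient as a derivation on the cone -/

section GradientDerivation

variable {N n k : ℕ} {L : Type} [CommRing L]

/-- The gradient of a polynomial, with values in a ring `L` over the polynomial ring. -/
def gradVec (ψ : MvPolynomial (Fin (N + 1)) ℂ →+* L) (p : MvPolynomial (Fin (N + 1)) ℂ) :
    Fin (N + 1) → L := fun l ↦ ψ (pderiv l p)

theorem gradVec_add (ψ : MvPolynomial (Fin (N + 1)) ℂ →+* L) (p q : MvPolynomial (Fin (N + 1)) ℂ) :
    gradVec ψ (p + q) = gradVec ψ p + gradVec ψ q := by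
  ext l; simp [gradVec]

theorem gradVec_mul (ψ : MvPolynomial (Fin (N + 1)) ℂ →+* L) (p q : MvPolynomial (Fin (N + 1)) ℂ) :
    gradVec ψ (p * q) = ψ p • gradVec ψ q + ψ q • gradVec ψ p := by
  ext l; simp [gradVec, Derivation.leibniz]

theorem gradVec_C (ψ : MvPolynomial (Fin (N + 1)) ℂ →+* L) (c : ℂ) : gradVec ψ (C c) = 0 := by
  ext l; simp [gradVec]

theorem gradVec_X (ψ : MvPolynomial (Fin (N + 1)) ℂ →+* L) (i : Fin (N + 1)) :
    gradVec ψ (X i) = Pi.single i 1 := by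
  ext l
  by_cases h : l = i
  · subst h; simp [gradVec]
  · simp [gradVec, pderiv_X, h, Ne.symm h]

/-- Euler's identity. -/
theorem sum_gradVec_mul (ψ : MvPolynomial (Fin (N + 1)) ℂ →+* L) {p : MvPolynomial (Fin (N + 1)) ℂ}
    {t : ℕ} (hp : p.IsHomogeneous t) : ∑ l, gradVec ψ p l * ψ (X l) = t * ψ p := by
  have h := congrArg ψ hp.sum_X_mul_pderiv
  rw [map_sum, map_nsmul, nsmul_eq_mul] at h
  rw [← h]
  exact Finset.sum_congr rfl fun l _ ↦ by rw [map_mul, mul_comm]; rfl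

/-- The span of the gradients of the equations. -/
abbrev gradSpan (ψ : MvPolynomial (Fin (N + 1)) ℂ →+* L)
    (f : Fin k → MvPolynomial (Fin (N + 1)) ℂ) :
    Submodule L (Fin (N + 1) → L) :=
  Submodule.span L (Set.range fun j ↦ gradVec ψ (f j))

/-- The gradient induces a derivation on a localization of the quotient by the equations, with
values in the vectors modulo the gradients of the equations. -/
theorem exists_gradient_derivation (f : Fin k → MvPolynomial (Fin (N + 1)) ℂ)
    {I : Ideal (MvPolynomial (Fin (N + 1)) ℂ)} (hI : I = Ideal.span (Set.range f))
    (M : Submonoid (MvPolynomial (Fin (N + 1)) ℂ ⧸ I))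
    [Algebra (MvPolynomial (Fin (N + 1)) ℂ ⧸ I) L] [IsLocalization M L]
    (ψ : MvPolynomial (Fin (N + 1)) ℂ →+* L)
    (hψ : ∀ p, ψ p = algebraMap _ L (Ideal.Quotient.mk I p)) :
    ∃ D : L → (Fin (N + 1) → L) ⧸ gradSpan ψ f, (∀ a b, D (a + b) = D a + D b) ∧
      (∀ a b, D (a * b) = a • D b + b • D a) ∧
      ∀ p, D (ψ p) = Submodule.Quotient.mk (gradVec ψ p) := by
  -- Derivations correspond to ring homomorphisms to the square-zero extension, and these extend to
  -- quotients and localizations by universal properties.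
  let g : MvPolynomial (Fin (N + 1)) ℂ →+* TrivSqZeroExt L ((Fin (N + 1) → L) ⧸ gradSpan ψ f) :=
    eval₂Hom ((TrivSqZeroExt.inlHom L _).comp (ψ.comp C)) fun l ↦
      TrivSqZeroExt.inl (ψ (X l)) + TrivSqZeroExt.inr (Submodule.Quotient.mk (Pi.single l 1))
  have hg : ∀ p, g p = TrivSqZeroExt.inl (ψ p) +
      TrivSqZeroExt.inr (Submodule.Quotient.mk (gradVec ψ p)) := by
    intro p
    induction p using MvPolynomial.induction_on with
    | C a =>
      rw [gradVec_C]
      simp [g]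
    | add p q hp hq =>
      rw [map_add, hp, hq, gradVec_add, map_add, Submodule.Quotient.mk_add, TrivSqZeroExt.inl_add,
        TrivSqZeroExt.inr_add]
      abel
    | mul_X p i hp =>
      have h1 : g (X i) = TrivSqZeroExt.inl (ψ (X i)) +
        TrivSqZeroExt.inr (Submodule.Quotient.mk (Pi.single i 1)) := by simp [g]
      rw [map_mul, hp, h1, gradVec_mul, gradVec_X]
      ext
      · simp
      · simp
  have hker : I ≤ RingHom.ker g := by
    rw [hI, Ideal.span_le]
    rintro _ ⟨j, rfl⟩
    change g (f j) = 0
    have h1 : (Submodule.Quotient.mk (gradVec ψ (f j)) : _ ⧸ gradSpan ψ f) = 0 :=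
      (Submodule.Quotient.mk_eq_zero _).mpr (Submodule.subset_span ⟨j, rfl⟩)
    rw [hg, hψ, Ideal.Quotient.eq_zero_iff_mem.mpr
      (hI.ge (Ideal.subset_span (Set.mem_range_self j))), map_zero, h1]
    simp
  let g₁ : MvPolynomial (Fin (N + 1)) ℂ ⧸ I →+* TrivSqZeroExt L
    ((Fin (N + 1) → L) ⧸ gradSpan ψ f) :=
    Ideal.Quotient.lift I g fun a ha ↦ hker ha
  have hg₁ : ∀ p, (g₁ (Ideal.Quotient.mk I p)).fst = ψ p := fun p ↦ by
    change (g p).fst = ψ p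
    rw [hg]; simp
  have hu : ∀ s : M, IsUnit (g₁ s) := by
    intro s
    obtain ⟨p, hp⟩ := Ideal.Quotient.mk_surjective (s : MvPolynomial (Fin (N + 1)) ℂ ⧸ I)
    rw [TrivSqZeroExt.isUnit_iff_isUnit_fst, ← hp, hg₁, hψ, hp]
    exact IsLocalization.map_units L s
  let G : L →+* TrivSqZeroExt L ((Fin (N + 1) → L) ⧸ gradSpan ψ f) :=
    IsLocalization.lift (M := M) hu
  have hG : ∀ p, G (ψ p) = g p := fun p ↦ by
    rw [hψ, IsLocalization.lift_eq]; rfl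
  have hfst : ∀ a, (G a).fst = a := by
    have : (TrivSqZeroExt.fstHom L L _).toRingHom.comp G = RingHom.id L :=
      IsLocalization.ringHom_ext M (Ideal.Quotient.ringHom_ext (RingHom.ext fun p ↦ by
        have h1 : (G (ψ p)).fst = ψ p := by rw [hG, hg]; simp
        simp only [hψ] at h1
        exact h1))
    exact RingHom.congr_fun this
  refine ⟨fun a ↦ (G a).snd, fun a b ↦ by simp, fun a b ↦ ?_, fun p ↦ ?_⟩
  · change (G (a * b)).snd = a • (G b).snd + b • (G a).snd
    rw [map_mul, TrivSqZeroExt.snd_mul, hfst, hfst, op_smul_eq_smul]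
  · change (G (ψ p)).snd = _
    rw [hG, hg]; simp

end GradientDerivation

/-! ### The alternating form at a point -/

section PointForm

variable {N n k : ℕ} {L : Type} [CommRing L]

/-- The pairing of the gradient of a fraction `r / s` of degree zero with the coordinates
vanishes. -/
theorem sum_gradVec_fraction_mul (ψ : MvPolynomial (Fin (N + 1)) ℂ →+* L)
    {r s : MvPolynomial (Fin (N + 1)) ℂ} {t : ℕ} (hr : r.IsHomogeneous t) (hs : s.IsHomogeneous t) :
    ∑ l, (ψ s • gradVec ψ r - ψ r • gradVec ψ s) l * ψ (X l) = 0 := by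
  have h1 := sum_gradVec_mul ψ hr
  have h2 := sum_gradVec_mul ψ hs
  simp only [Pi.sub_apply, Pi.smul_apply, smul_eq_mul, sub_mul, Finset.sum_sub_distrib, mul_assoc,
    ← Finset.mul_sum, h1, h2]
  ring

/-- A function on tuples is multilinear and alternating over `ev : B → L`. -/
structure IsSemilinearForm {B M : Type} [CommRing B] [AddCommGroup M] [Module B M]
    (ev : B →+* L) (T : (Fin n → M) → L) : Prop where
  map_update_add : ∀ (ω : Fin n → M) t a b,
    T (Function.update ω t (a + b)) = T (Function.update ω t a) + T (Function.update ω t b)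
  map_update_smul : ∀ (ω : Fin n → M) t c a,
    T (Function.update ω t (c • a)) = ev c * T (Function.update ω t a)
  map_eq_zero : ∀ (ω : Fin n → M) t t', ω t = ω t' → t ≠ t' → T ω = 0

/-- At a point, the determinant of gradients defines a form on the differentials of any ring of
functions near the point. It is the value there of the section `1` of `𝒪(-K) = 𝒪(i_X)`, up to the
twist. -/
theorem exists_pointForm (e : Fin (N + 1) ≃ (Fin k ⊕ Unit) ⊕ Fin n)
    {d : Fin k → ℕ} {f : Fin k → MvPolynomial (Fin (N + 1)) ℂ}
    (hf : ∀ i, (f i).IsHomogeneous (d i))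
    {I : Ideal (MvPolynomial (Fin (N + 1)) ℂ)} (hI : I = Ideal.span (Set.range f))
    (M : Submonoid (MvPolynomial (Fin (N + 1)) ℂ ⧸ I))
    [Algebra (MvPolynomial (Fin (N + 1)) ℂ ⧸ I) L] [IsLocalization M L]
    (ψ : MvPolynomial (Fin (N + 1)) ℂ →+* L)
    (hψ : ∀ p, ψ p = algebraMap _ L (Ideal.Quotient.mk I p))
    {i₀ : Fin (N + 1)} (hi₀ : IsUnit (ψ (X i₀)))
    {B : Type} [CommRing B] [Algebra ℂ B] (ev : B →+* L)
      (hev : ∀ c, ev (algebraMap ℂ B c) = ψ (C c)) :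
    ∃ T : (Fin n → KaehlerDifferential ℂ B) → L, IsSemilinearForm ev T ∧
      ∀ (u : Fin n → B) (r s : Fin n → MvPolynomial (Fin (N + 1)) ℂ) (a : Fin n → ℕ),
        (∀ t, (r t).IsHomogeneous (a t)) → (∀ t, (s t).IsHomogeneous (a t)) →
        (∀ t, ψ (s t) * ev (u t) = ψ (r t)) → ∀ i,
          ψ (X i) * (∏ t, ψ (s t) ^ 2) * T (fun t ↦ KaehlerDifferential.D ℂ B (u t)) =
            frameDet e (fun j ↦ gradVec ψ (f j)) i
              (fun t ↦ ψ (s t) • gradVec ψ (r t) - ψ (r t) • gradVec ψ (s t)) := by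
  obtain ⟨D, hDadd, hDmul, hDψ⟩ := exists_gradient_derivation f hI M ψ hψ
  set F : Fin k → Fin (N + 1) → L := fun j ↦ gradVec ψ (f j) with hF
  let : Module B ((Fin (N + 1) → L) ⧸ gradSpan ψ f) := Module.compHom _ ev
  let : Module ℂ ((Fin (N + 1) → L) ⧸ gradSpan ψ f) := Module.compHom _ (ψ.comp C)
  have hsmul : ∀ (b : B) (x : (Fin (N + 1) → L) ⧸ gradSpan ψ f), b • x = ev b • x := fun _ _ ↦ rfl
  have hsmul' : ∀ (c : ℂ) (x : (Fin (N + 1) → L) ⧸ gradSpan ψ f), c • x = ψ (C c) • x :=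
    fun _ _ ↦ rfl
  have : IsScalarTower ℂ B ((Fin (N + 1) → L) ⧸ gradSpan ψ f) := ⟨fun c b x ↦ by
    rw [hsmul, hsmul, hsmul', Algebra.smul_def, map_mul, hev, mul_smul]⟩
  let δ : Derivation ℂ B ((Fin (N + 1) → L) ⧸ gradSpan ψ f) := Derivation.mk'
    { toFun := fun b ↦ D (ev b)
      map_add' := fun b b' ↦ by rw [map_add, hDadd]
      map_smul' := fun c b ↦ by
        rw [Algebra.smul_def, map_mul, hev, hDmul, hDψ, gradVec_C, Submodule.Quotient.mk_zero,
          smul_zero, add_zero]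
        rfl } (fun a b ↦ by
        change D (ev (a * b)) = ev a • D (ev b) + ev b • D (ev a)
        rw [map_mul, hDmul])
  have hδ : ∀ b, δ.liftKaehlerDifferential (KaehlerDifferential.D ℂ B b) = D (ev b) := fun b ↦
    δ.liftKaehlerDifferential_comp_D b
  let lft : KaehlerDifferential ℂ B →ₗ[B] (Fin (N + 1) → L) ⧸ gradSpan ψ f :=
    δ.liftKaehlerDifferential
  -- Lifts of classes modulo the gradients; the determinant does not depend on them.
  let σ : (Fin (N + 1) → L) ⧸ gradSpan ψ f → (Fin (N + 1) → L) :=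
    Function.surjInv (Submodule.Quotient.mk_surjective _)
  have hσ : ∀ q, Submodule.Quotient.mk (σ q) = q := fun q ↦
    Function.surjInv_eq (Submodule.Quotient.mk_surjective _) q
  obtain ⟨c, hc⟩ := hi₀.exists_left_inv
  have hupd : ∀ (ω : Fin n → KaehlerDifferential ℂ B) t a,
      (fun t' ↦ σ (lft (Function.update ω t a t'))) =
        Function.update (fun t' ↦ σ (lft (ω t'))) t (σ (lft a)) := by
    intro ω t a
    funext t'
    by_cases h : t' = t
    · subst h; simp
    · simp [h]
  have hcongr : ∀ (w : Fin n → Fin (N + 1) → L) t a b,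
      (Submodule.Quotient.mk a : _ ⧸ gradSpan ψ f) = Submodule.Quotient.mk b →
      frameDet e F i₀ (Function.update w t a) = frameDet e F i₀ (Function.update w t b) := by
    intro w t a b hab
    refine frameDet_congr e F i₀ fun t' ↦ ?_
    by_cases h : t' = t
    · subst h
      simpa using (Submodule.Quotient.eq _).mp hab
    · simp [h]
  refine ⟨fun ω ↦ c * frameDet e F i₀ fun t ↦ σ (lft (ω t)), ⟨?_, ?_, ?_⟩, ?_⟩
  · intro ω t a b
    rw [hupd, hupd, hupd, ← mul_add, ← frameDet_update_add,
      hcongr _ t _ (σ (lft a) + σ (lft b))]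
    rw [Submodule.Quotient.mk_add, hσ, hσ, hσ, map_add]
  · intro ω t b a
    rw [hupd, hupd, hcongr _ t _ (ev b • σ (lft a))
      (by rw [Submodule.Quotient.mk_smul, hσ, hσ, map_smul, hsmul]), frameDet_update_smul]
    ring
  · intro ω t t' h h'
    rw [frameDet_eq_zero_of_eq e F i₀ _ (t := t) (t' := t') (by rw [h]) h', mul_zero]
  · intro u r s a hr hs hsu i
    have h1 : ∀ t, (ψ (s t) ^ 2) • D (ev (u t)) =
        Submodule.Quotient.mk (ψ (s t) • gradVec ψ (r t) - ψ (r t) • gradVec ψ (s t)) := by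
      intro t
      have h2 := hDmul (ψ (s t)) (ev (u t))
      rw [hsu, hDψ, hDψ] at h2
      rw [Submodule.Quotient.mk_sub, Submodule.Quotient.mk_smul, Submodule.Quotient.mk_smul, h2,
        ← hsu t]
      module
    have h2 : (∏ t, ψ (s t) ^ 2) * frameDet e F i₀
      (fun t ↦ σ (lft (KaehlerDifferential.D ℂ B (u t)))) =
        frameDet e F i₀ (fun t ↦ ψ (s t) • gradVec ψ (r t) - ψ (r t) • gradVec ψ (s t)) := by
      rw [← frameDet_smul]
      refine frameDet_congr e F i₀ fun t ↦ (Submodule.Quotient.eq _).mp ?_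
      rw [Submodule.Quotient.mk_smul, hσ, ← h1 t, ← hδ]
    have h3 := mul_frameDet_comm e F
      (fun t ↦ ψ (s t) • gradVec ψ (r t) - ψ (r t) • gradVec ψ (s t)) (fun l ↦ ψ (X l))
      (fun j ↦ by
        have hj : ψ (f j) = 0 := by
          rw [hψ, Ideal.Quotient.eq_zero_iff_mem.mpr (hI.ge (Ideal.subset_span ⟨j, rfl⟩)), map_zero]
        rw [sum_gradVec_mul ψ (hf j), hj, mul_zero])
      (fun t ↦ sum_gradVec_fraction_mul ψ (hr t) (hs t)) i₀ i
    linear_combination (c * ψ (X i)) * h2 + c * h3 +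
      frameDet e F i (fun t ↦ ψ (s t) • gradVec ψ (r t) - ψ (r t) • gradVec ψ (s t)) * hc

end PointForm

/-! ### Gluing forms given at the points -/

section GlueForms

/-- Induction over the entries of a tuple of vectors: elements of a spanning set, sums and
multiples. -/
theorem tuple_span_induction {B M : Type} [CommRing B] [AddCommGroup M] [Module B M] {S : Set M}
    (hS : Submodule.span B S = ⊤) (h0 : 0 ∈ S) {n : ℕ} {p : (Fin n → M) → Prop}
    (hmem : ∀ v : Fin n → M, (∀ t, v t ∈ S) → p v)
    (hadd : ∀ ω t a b, p (Function.update ω t a) → p (Function.update ω t b) →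
      p (Function.update ω t (a + b)))
    (hsmul : ∀ ω t (c : B) a, p (Function.update ω t a) → p (Function.update ω t (c • a)))
    (ω : Fin n → M) : p ω := by
  classical
  have key : ∀ (s : Finset (Fin n)) (ω : Fin n → M), (∀ t ∉ s, ω t ∈ S) → p ω := by
    intro s
    induction s using Finset.induction_on with
    | empty => exact fun ω hω ↦ hmem ω fun t ↦ hω t (by simp)
    | insert t s hts ih =>
      intro ω hω
      have h1 : ∀ a, p (Function.update ω t a) := by
        intro a
        have ha : a ∈ Submodule.span B S := by rw [hS]; trivial
        have hS' : ∀ b ∈ S, p (Function.update ω t b) := by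
          intro b hb
          refine ih _ fun t' ht' ↦ ?_
          by_cases h : t' = t
          · subst h; simpa using hb
          · rw [Function.update_of_ne h]
            exact hω t' (by simp [h, ht'])
        induction ha using Submodule.span_induction with
        | mem x hx => exact hS' x hx
        | zero => exact hS' 0 h0
        | add x y _ _ hx hy => exact hadd _ _ _ _ hx hy
        | smul c x _ hx => exact hsmul _ _ _ _ hx
      simpa using h1 (ω t)
  exact key Finset.univ ω (by simp)

/-- Let `ev x` be a jointly injective family of ring homomorphisms on `B`. Forms `T x` over the
`ev x` whose values on exact differentials come from elements of `B` are induced by an alternating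
form over `B`. -/
theorem exists_alternatingMap_of_pointForms {B : Type} [CommRing B] [Algebra ℂ B] {n : ℕ}
    {ι : Type} {L : ι → Type} [∀ x, CommRing (L x)] (ev : ∀ x, B →+* L x)
    (hev : ∀ b c, (∀ x, ev x b = ev x c) → b = c)
    (T : ∀ x, (Fin n → KaehlerDifferential ℂ B) → L x)
    (hT : ∀ x, IsSemilinearForm (ev x) (T x))
    (hD : ∀ u : Fin n → B, ∃ b, ∀ x, ev x b = T x fun t ↦ KaehlerDifferential.D ℂ _ (u t)) :
    ∃ Φ : (KaehlerDifferential ℂ B) [⋀^Fin n]→ₗ[B] B, ∀ ω x, ev x (Φ ω) = T x ω := by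
  have key : ∀ ω : Fin n → KaehlerDifferential ℂ B, ∃ b : B, ∀ x, ev x b = T x ω := by
    intro ω
    induction ω using tuple_span_induction (KaehlerDifferential.span_range_derivation ℂ B)
      ⟨0, map_zero _⟩ with
    | hmem v hv =>
      choose u hu using hv
      rw [show v = fun t ↦ KaehlerDifferential.D ℂ B (u t) from funext fun t ↦ (hu t).symm]
      exact hD u
    | hadd ω t a b ha hb =>
      obtain ⟨a', ha⟩ := ha
      obtain ⟨b', hb⟩ := hb
      exact ⟨a' + b', fun x ↦ by rw [map_add, ha, hb, (hT x).map_update_add]⟩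
    | hsmul ω t c a ha =>
      obtain ⟨a', ha⟩ := ha
      exact ⟨c * a', fun x ↦ by rw [map_mul, ha, (hT x).map_update_smul]⟩
  choose Φ hΦ using key
  refine ⟨{ toFun := Φ
            map_update_add' := ?_
            map_update_smul' := ?_
            map_eq_zero_of_eq' := ?_ }, hΦ⟩
  · intro inst ω t a b
    rw [Subsingleton.elim inst (instDecidableEqFin n)]
    exact hev _ _ fun x ↦ by rw [map_add, hΦ, hΦ, hΦ, (hT x).map_update_add]
  · intro inst ω t a b
    rw [Subsingleton.elim inst (instDecidableEqFin n)]
    exact hev _ _ fun x ↦ by rw [smul_eq_mul, map_mul, hΦ, hΦ, (hT x).map_update_smul]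
  · intro ω t t' h h'
    exact hev _ _ fun x ↦ by rw [hΦ, map_zero, (hT x).map_eq_zero ω t t' h h']

end GlueForms

/-! ### The degree of the determinant -/

section FrameDetDegree

variable {N n k : ℕ} (e : Fin (N + 1) ≃ (Fin k ⊕ Unit) ⊕ Fin n)

theorem isHomogeneous_frameDet {F : Fin k → Fin (N + 1) → MvPolynomial (Fin (N + 1)) ℂ}
    {α : Fin k → ℕ} (hF : ∀ j l, (F j l).IsHomogeneous (α j)) (i : Fin (N + 1))
    {w : Fin n → Fin (N + 1) → MvPolynomial (Fin (N + 1)) ℂ} {β : Fin n → ℕ}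
    (hw : ∀ t l, (w t l).IsHomogeneous (β t)) :
    (frameDet e F i w).IsHomogeneous (∑ j, α j + ∑ t, β t) := by
  rw [frameDet_eq_det, Matrix.det_apply]
  refine IsHomogeneous.sum _ _ _ fun τ _ ↦ ?_
  have h1 : (∏ r, Matrix.of (fun r ↦ Sum.elim (Sum.elim F fun _ ↦ Pi.single i 1) w (e r)) (τ r) r
      : MvPolynomial (Fin (N + 1)) ℂ).IsHomogeneous
      (∑ r, Sum.elim (Sum.elim α fun _ ↦ 0) β (e (τ r))) := by
    refine IsHomogeneous.prod _ _ _ fun r _ ↦ ?_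
    rw [Matrix.of_apply]
    rcases e (τ r) with (q | q) | q
    · exact hF q r
    · by_cases h : r = i
      · subst h; simpa using isHomogeneous_one _ _
      · simpa [h] using isHomogeneous_zero _ _ _
    · exact hw q r
  rw [Equiv.sum_comp τ (fun r ↦ Sum.elim (Sum.elim α fun _ ↦ 0) β (e r)),
    e.sum_comp (Sum.elim (Sum.elim α fun _ ↦ 0) β), Fintype.sum_sum_type,
    Fintype.sum_sum_type] at h1
  simp only [Sum.elim_inl, Sum.elim_inr, Finset.sum_const_zero, add_zero] at h1
  rcases Int.units_eq_one_or (Equiv.Perm.sign τ) with h | h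
  · rw [h, one_smul]; exact h1
  · rw [h, Units.neg_smul, one_smul]; exact h1.neg

end FrameDetDegree

/-! ### Functions on the intersection as fractions -/

section ConePoints

variable {N n k : ℕ} (d : Fin k → ℕ) (f : Fin k → MvPolynomial (Fin (N + 1)) ℂ)
  (hf : ∀ i, (f i).IsHomogeneous (d i))

/-- The grading on the homogeneous coordinate ring of the intersection. -/
abbrev coneGrading : ℕ → Submodule ℂ (MvPolynomial (Fin (N + 1)) ℂ ⧸
    (hypersurfacesIdeal d f hf).toIdeal) :=
  quotientGrading (hypersurfacesIdeal d f hf)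

variable {d f hf}

/-- The value of a polynomial in the local ring of the affine cone at a point of the
intersection. -/
def coordHom (x : Proj (coneGrading d f hf)) :
    MvPolynomial (Fin (N + 1)) ℂ →+* Loc (coneGrading d f hf) x :=
  (algebraMap _ _).comp (Ideal.Quotient.mk (hypersurfacesIdeal d f hf).toIdeal)

theorem coordHom_apply (x : Proj (coneGrading d f hf)) (p : MvPolynomial (Fin (N + 1)) ℂ) :
    coordHom x p = algebraMap _ (Loc (coneGrading d f hf) x)
      (Ideal.Quotient.mk (hypersurfacesIdeal d f hf).toIdeal p) := rfl

theorem coordHom_eq_zero (x : Proj (coneGrading d f hf)) {p : MvPolynomial (Fin (N + 1)) ℂ}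
    (hp : p ∈ Ideal.span (Set.range f)) : coordHom x p = 0 := by
  have h : Ideal.Quotient.mk (hypersurfacesIdeal d f hf).toIdeal p = 0 :=
    Ideal.Quotient.eq_zero_iff_mem.mpr hp
  rw [coordHom_apply, h, map_zero]

theorem coordHom_C (x : Proj (coneGrading d f hf)) (c : ℂ) :
    coordHom x (C c) = algebraMap ℂ (Loc (coneGrading d f hf) x) c := by
  rw [IsScalarTower.algebraMap_apply ℂ (MvPolynomial (Fin (N + 1)) ℂ ⧸
    (hypersurfacesIdeal d f hf).toIdeal)]
  rfl

/-- The class of a coordinate in the homogeneous coordinate ring. -/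
def coordClass (i : Fin (N + 1)) :
    MvPolynomial (Fin (N + 1)) ℂ ⧸ (hypersurfacesIdeal d f hf).toIdeal :=
  Ideal.Quotient.mk _ (X i)

theorem coordClass_mem (i : Fin (N + 1)) :
    coordClass i ∈ coneGrading d f hf 1 :=
  mk_mem_quotientGrading _ (isHomogeneous_X ℂ i)

theorem isUnit_coordHom_iff (x : Proj (coneGrading d f hf)) (p : MvPolynomial (Fin (N + 1)) ℂ) :
    IsUnit (coordHom x p) ↔
      Ideal.Quotient.mk (hypersurfacesIdeal d f hf).toIdeal p ∉ primeAt (coneGrading d f hf) x :=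
  IsLocalization.AtPrime.isUnit_to_map_iff (Loc (coneGrading d f hf) x)
    (primeAt (coneGrading d f hf) x) (Ideal.Quotient.mk (hypersurfacesIdeal d f hf).toIdeal p)

theorem iSup_basicOpen_coordClass :
    ⨆ i, Proj.basicOpen (coneGrading d f hf) (coordClass i) = ⊤ := by
  refine Proj.iSup_basicOpen_eq_top' _ _ (fun i ↦ ⟨1, coordClass_mem i⟩) ?_
  rw [eq_top_iff]
  rintro a -
  obtain ⟨p, rfl⟩ := Ideal.Quotient.mk_surjective a
  induction p using MvPolynomial.induction_on with
  | C c =>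
    exact Subalgebra.algebraMap_mem _ (algebraMap ℂ (coneGrading d f hf 0) c)
  | add p q hp hq => rw [map_add]; exact add_mem hp hq
  | mul_X p i hp =>
    rw [map_mul]
    exact mul_mem hp (Algebra.subset_adjoin ⟨i, rfl⟩)

theorem exists_mem_basicOpen_coordClass (x : Proj (coneGrading d f hf)) :
    ∃ i, x ∈ Proj.basicOpen (coneGrading d f hf) (coordClass i) := by
  have h : x ∈ ⨆ i, Proj.basicOpen (coneGrading d f hf) (coordClass i) := by
    rw [iSup_basicOpen_coordClass]; trivial
  exact TopologicalSpace.Opens.mem_iSup.mp h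

theorem isUnit_coordHom_X {x : Proj (coneGrading d f hf)} {i : Fin (N + 1)}
    (hx : x ∈ Proj.basicOpen (coneGrading d f hf) (coordClass i)) : IsUnit (coordHom x (X i)) :=
  (isUnit_coordHom_iff x _).mpr hx

/-- The value of a function on an open subset of the intersection at a point. -/
def valueAt {U : (hypersurfacesIntersection d f hf).Opens} {x : Proj (coneGrading d f hf)}
    (hx : x ∈ U) :
    Γ(hypersurfacesIntersection d f hf, U) →+* Loc (coneGrading d f hf) x :=
  evalAt (coneGrading d f hf) hx

theorem valueAt_algebraMap {U : (hypersurfacesIntersection d f hf).Opens}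
    {x : Proj (coneGrading d f hf)} (hx : x ∈ U) (c : ℂ) :
    valueAt hx (algebraMap ℂ Γ(hypersurfacesIntersection d f hf, U) c) = coordHom x (C c) := by
  rw [coordHom_C]
  exact evalAt_structure (coneGrading d f hf) hx c

theorem valueAt_ext {U : (hypersurfacesIntersection d f hf).Opens}
    {u v : Γ(hypersurfacesIntersection d f hf, U)}
    (h : ∀ x (hx : x ∈ U), valueAt hx u = valueAt hx v) : u = v :=
  evalAt_ext _ h

theorem valueAt_res {U V : (hypersurfacesIntersection d f hf).Opens} (h : V ≤ U)
    {x : Proj (coneGrading d f hf)} (hx : x ∈ V) (u : Γ(hypersurfacesIntersection d f hf, U)) :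
    valueAt hx ((hypersurfacesIntersection d f hf).presheaf.map (homOfLE h).op u) =
      valueAt (h hx) u := rfl

/-- Near a point of `D₊(X_i)`, a function is a fraction of two forms of positive degree. -/
theorem exists_valueAt_fraction {U : (hypersurfacesIntersection d f hf).Opens}
    {x : Proj (coneGrading d f hf)} (hx : x ∈ U) (i : Fin (N + 1))
    (hxi : x ∈ Proj.basicOpen (coneGrading d f hf) (coordClass i))
    (u : Γ(hypersurfacesIntersection d f hf, U)) :
    ∃ V : (Proj (coneGrading d f hf)).Opens, x ∈ V ∧ ∃ hVU : V ≤ U, ∃ (a : ℕ)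
      (r s : MvPolynomial (Fin (N + 1)) ℂ), 1 ≤ a ∧ r.IsHomogeneous a ∧ s.IsHomogeneous a ∧
        ∀ y (hy : y ∈ V), IsUnit (coordHom y (X i)) ∧ IsUnit (coordHom y s) ∧
          coordHom y s * valueAt (hVU hy) u = coordHom y r := by
  obtain ⟨V, hxV, hVU, a, r, s, hr, hs, h⟩ := isLocallyFrac_evalAt (coneGrading d f hf) u x hx
  obtain ⟨r, hr, rfl⟩ := hr
  obtain ⟨s, hs, rfl⟩ := hs
  refine ⟨V ⊓ Proj.basicOpen _ (coordClass i), ⟨hxV, hxi⟩, inf_le_left.trans hVU, 1 + a, X i * r,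
    X i * s, by omega, (isHomogeneous_X ℂ i).mul hr, (isHomogeneous_X ℂ i).mul hs, fun y hy ↦ ?_⟩
  have h1 := isUnit_coordHom_X hy.2
  have h2 : IsUnit (coordHom y s) := (isUnit_coordHom_iff y s).mpr (h y hy.1).1
  refine ⟨h1, by rw [map_mul]; exact h1.mul h2, ?_⟩
  have h3 : coordHom y s * valueAt (hVU hy.1) u = coordHom y r := (h y hy.1).2
  rw [map_mul, map_mul, mul_assoc, h3]

end ConePoints

/-! ### Forms defined by determinants of gradients -/

section CanonicalForms

variable {N n k m : ℕ} {d : Fin k → ℕ} {f : Fin k → MvPolynomial (Fin (N + 1)) ℂ}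
  {hf : ∀ i, (f i).IsHomogeneous (d i)}

/-- The form on `n`-forms over `U` defined by the polynomial `a` of degree `i_X`: on the
differentials of fractions `u_t = r_t / s_t` it is given by a determinant of gradients,
`X_i ∏ s_t² φ(du₁ ∧ … ∧ duₙ) = a det(∇f₁, …, ∇f_k, e_i, s₁∇r₁ - r₁∇s₁, …, sₙ∇rₙ - rₙ∇sₙ)`.
The equation is to hold in the local ring of the affine cone at each point of `U`, for all `i` and
all presentations of the `u_t` as fractions at the point. -/
def IsGradientForm (e : Fin (N + 1) ≃ (Fin k ⊕ Unit) ⊕ Fin n) (a : MvPolynomial (Fin (N + 1)) ℂ)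
    (U : (hypersurfacesIntersection d f hf).affineOpens)
    (φ : Module.Dual Γ(hypersurfacesIntersection d f hf,
      (U : (hypersurfacesIntersection d f hf).Opens))
      (TopForms (hypersurfacesIntersection d f hf) n U)) : Prop :=
  ∀ (u : Fin n → Γ(hypersurfacesIntersection d f hf,
    (U : (hypersurfacesIntersection d f hf).Opens)))
    (x : Proj (coneGrading d f hf)) (hx : x ∈ (U : (hypersurfacesIntersection d f hf).Opens))
    (r s : Fin n → MvPolynomial (Fin (N + 1)) ℂ) (c : Fin n → ℕ),
    (∀ t, (r t).IsHomogeneous (c t)) → (∀ t, (s t).IsHomogeneous (c t)) →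
    (∀ t, coordHom x (s t) * valueAt hx (u t) = coordHom x (r t)) → ∀ i,
      coordHom x (X i) * (∏ t, coordHom x (s t) ^ 2) *
        valueAt hx (φ (wedgeD (hypersurfacesIntersection d f hf) n U u)) =
      coordHom x (a * frameDet e (fun j ↦ gradVec (RingHom.id _) (f j)) i
        (fun t ↦ s t • gradVec (RingHom.id _) (r t) - r t • gradVec (RingHom.id _) (s t)))

theorem coordHom_frameDet (e : Fin (N + 1) ≃ (Fin k ⊕ Unit) ⊕ Fin n) {x : Proj (coneGrading d f hf)}
    (i : Fin (N + 1)) (r s : Fin n → MvPolynomial (Fin (N + 1)) ℂ) :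
    coordHom x (frameDet e (fun j ↦ gradVec (RingHom.id _) (f j)) i
        (fun t ↦ s t • gradVec (RingHom.id _) (r t) - r t • gradVec (RingHom.id _) (s t))) =
      frameDet e (fun j ↦ gradVec (coordHom x) (f j)) i (fun t ↦ coordHom x (s t) •
        gradVec (coordHom x) (r t) - coordHom x (r t) • gradVec (coordHom x) (s t)) := by
  rw [map_frameDet]
  congr 1
  funext t l
  simp [gradVec]

/-- Forms at the points which are given by determinants of gradients of fractions have values
in the structure sheaf on exact differentials. -/
theorem exists_valueAt_eq_of_frameDet (e : Fin (N + 1) ≃ (Fin k ⊕ Unit) ⊕ Fin n)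
    (hd : ∀ i, 1 ≤ d i) (hn : n + k = N) (hm : m + ∑ i, d i = N + 1)
    {a : MvPolynomial (Fin (N + 1)) ℂ} (ha : a.IsHomogeneous m)
    {U : (hypersurfacesIntersection d f hf).Opens}
    (u : Fin n → Γ(hypersurfacesIntersection d f hf, U))
    (T : ∀ x : Proj (coneGrading d f hf), x ∈ U → Loc (coneGrading d f hf) x)
    (hT : ∀ x (hx : x ∈ U) (r s : Fin n → MvPolynomial (Fin (N + 1)) ℂ) (c : Fin n → ℕ),
      (∀ t, (r t).IsHomogeneous (c t)) → (∀ t, (s t).IsHomogeneous (c t)) →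
      (∀ t, coordHom x (s t) * valueAt hx (u t) = coordHom x (r t)) → ∀ i,
      coordHom x (X i) * (∏ t, coordHom x (s t) ^ 2) * T x hx =
      coordHom x (a * frameDet e (fun j ↦ gradVec (RingHom.id _) (f j)) i
        (fun t ↦ s t • gradVec (RingHom.id _) (r t) - r t • gradVec (RingHom.id _) (s t)))) :
    ∃ b : Γ(hypersurfacesIntersection d f hf, U), ∀ x (hx : x ∈ U), valueAt hx b = T x hx := by
  refine exists_evalAt_eq (coneGrading d f hf) (U := U) (φ := T) ?_
  intro x hx
  obtain ⟨i, hi⟩ := exists_mem_basicOpen_coordClass x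
  choose V hxV hVU c r s hc hr hs h using fun t ↦ exists_valueAt_fraction hx i hi (u t)
  let W : (Proj (coneGrading d f hf)).Opens :=
    U ⊓ Proj.basicOpen (coneGrading d f hf) (coordClass i) ⊓ Finset.univ.inf V
  have hWV : ∀ t, W ≤ V t := fun t ↦ inf_le_right.trans (Finset.inf_le (Finset.mem_univ t))
  have hxW : x ∈ W := by
    refine ⟨⟨hx, hi⟩, ?_⟩
    change x ∈ Finset.univ.inf V
    refine Finset.inf_induction (p := fun V : (Proj (coneGrading d f hf)).Opens ↦ x ∈ V)
      trivial (fun _ h1 _ h2 ↦ ⟨h1, h2⟩) fun t _ ↦ hxV t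
  have hWU : W ≤ U := inf_le_left.trans inf_le_left
  set Δ := frameDet e (fun j ↦ gradVec (RingHom.id _) (f j)) i
      (fun t ↦ s t • gradVec (RingHom.id _) (r t) - r t • gradVec (RingHom.id _) (s t)) with hΔ
  have hΔdeg : Δ.IsHomogeneous (∑ j, (d j - 1) + ∑ t, (c t + (c t - 1))) := by
    refine isHomogeneous_frameDet e (fun j l ↦ (hf j).pderiv) _ fun t l ↦ ?_
    have h2 := (hs t).mul ((hr t).pderiv (i := l))
    have h3 := (hr t).mul ((hs t).pderiv (i := l))
    exact h2.sub h3
  -- The fraction `a Δ / (X_i ∏ s_t²)` has degree zero, because `m = N + 1 - ∑ d_j` and `n + k = N`.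
  have hdeg : 1 + ∑ t, c t * 2 = m + (∑ j, (d j - 1) + ∑ t, (c t + (c t - 1))) := by
    have h3 : ∑ j, (d j - 1) + ∑ _j : Fin k, 1 = ∑ j, d j := by
      rw [← Finset.sum_add_distrib]
      exact Finset.sum_congr rfl fun j _ ↦ Nat.sub_add_cancel (hd j)
    have h4 : ∑ t, (c t + (c t - 1)) + ∑ _t : Fin n, 1 = ∑ t, c t * 2 := by
      rw [← Finset.sum_add_distrib]
      exact Finset.sum_congr rfl fun j _ ↦ by have := hc j; omega
    simp only [Finset.sum_const, Finset.card_univ, Fintype.card_fin, smul_eq_mul, mul_one] at h3 h4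
    omega
  refine ⟨W, hxW, hWU, 1 + ∑ t, c t * 2,
    Ideal.Quotient.mk (hypersurfacesIdeal d f hf).toIdeal (a * Δ),
    Ideal.Quotient.mk (hypersurfacesIdeal d f hf).toIdeal (X i * ∏ t, s t ^ 2),
    mk_mem_quotientGrading _ ?_, mk_mem_quotientGrading _ ?_, fun y hy ↦ ⟨?_, ?_⟩⟩
  · rw [hdeg]
    exact ha.mul hΔdeg
  · exact (isHomogeneous_X ℂ _).mul (IsHomogeneous.prod _ _ _ fun t _ ↦ (hs t).pow 2)
  · refine (isUnit_coordHom_iff y _).mp ?_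
    rw [map_mul, map_prod]
    refine (isUnit_coordHom_X hy.1.2).mul (IsUnit.prod_univ_iff.mpr fun t ↦ ?_)
    rw [map_pow]
    exact (h t y (hWV t hy)).2.1.pow 2
  · have h2 := hT y (hWU hy) r s c hr hs (fun t ↦ (h t y (hWV t hy)).2.2) i
    refine Eq.trans ?_ h2
    rw [← coordHom_apply, map_mul, map_prod]
    simp only [map_pow]

/-- Every form of degree `i_X` defines a linear form on the top differential forms over `U`. -/
theorem exists_isGradientForm (e : Fin (N + 1) ≃ (Fin k ⊕ Unit) ⊕ Fin n)
    (hd : ∀ i, 1 ≤ d i) (hn : n + k = N) (hm : m + ∑ i, d i = N + 1)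
    {a : MvPolynomial (Fin (N + 1)) ℂ} (ha : a.IsHomogeneous m)
    (U : (hypersurfacesIntersection d f hf).affineOpens) :
    ∃ φ, IsGradientForm e a U φ := by
  choose i hi using exists_mem_basicOpen_coordClass (d := d) (f := f) (hf := hf)
  have h1 := fun (x : {x : Proj (coneGrading d f hf) //
      x ∈ (U : (hypersurfacesIntersection d f hf).Opens)}) ↦
    exists_pointForm e hf (I := (hypersurfacesIdeal d f hf).toIdeal) rfl
      (primeAt (coneGrading d f hf) x.1).primeCompl (coordHom x.1) (coordHom_apply x.1)
      (isUnit_coordHom_X (hi x.1)) (valueAt x.2) (valueAt_algebraMap x.2)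
  choose T hT1 hT2 using h1
  have hT3 : ∀ (u : Fin n → Γ(hypersurfacesIntersection d f hf,
      (U : (hypersurfacesIntersection d f hf).Opens)))
    (x : Proj (coneGrading d f hf)) (hx : x ∈ (U : (hypersurfacesIntersection d f hf).Opens))
    (r s : Fin n → MvPolynomial (Fin (N + 1)) ℂ) (c : Fin n → ℕ),
    (∀ t, (r t).IsHomogeneous (c t)) → (∀ t, (s t).IsHomogeneous (c t)) →
    (∀ t, coordHom x (s t) * valueAt hx (u t) = coordHom x (r t)) → ∀ i,
      coordHom x (X i) * (∏ t, coordHom x (s t) ^ 2) *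
        (coordHom x a * T ⟨x, hx⟩ fun t ↦ KaehlerDifferential.D ℂ _ (u t)) =
      coordHom x (a * frameDet e (fun j ↦ gradVec (RingHom.id _) (f j)) i
        (fun t ↦ s t • gradVec (RingHom.id _) (r t) - r t • gradVec (RingHom.id _) (s t))) := by
    intro u x hx r s c hr hs h i
    rw [map_mul, coordHom_frameDet, ← hT2 ⟨x, hx⟩ u r s c hr hs h i]
    ring
  obtain ⟨Φ, hΦ⟩ := exists_alternatingMap_of_pointForms
    (fun x : {x : Proj (coneGrading d f hf) //
      x ∈ (U : (hypersurfacesIntersection d f hf).Opens)} ↦ valueAt x.2)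
    (fun b c h ↦ valueAt_ext fun x hx ↦ h ⟨x, hx⟩)
    (fun x ω ↦ coordHom x.1 a * T x ω)
    (fun x ↦ ⟨fun ω t b c ↦ by rw [(hT1 x).map_update_add, mul_add],
      fun ω t b c ↦ by rw [(hT1 x).map_update_smul]; exact mul_left_comm _ _ _,
      fun ω t t' h h' ↦ by rw [(hT1 x).map_eq_zero ω t t' h h', mul_zero]⟩)
    (fun u ↦ by
      obtain ⟨b, hb⟩ := exists_valueAt_eq_of_frameDet e hd hn hm ha u _ (hT3 u)
      exact ⟨b, fun x ↦ hb x.1 x.2⟩)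
  refine ⟨exteriorPower.alternatingMapLinearEquiv Φ, fun u x hx r s c hr hs h i ↦ ?_⟩
  rw [wedgeD, exteriorPower.alternatingMapLinearEquiv_apply_ιMulti, hΦ _ ⟨x, hx⟩]
  exact hT3 u x hx r s c hr hs h i

end CanonicalForms

/-! ### The minors have no common zero -/

section FrameNullstellensatz

/-- Linearly independent vectors can be completed to a basis by vectors of the standard basis. -/
theorem exists_linearIndependent_sumElim_single {N n : ℕ} {ι : Type} [Fintype ι]
    {v : ι → Fin (N + 1) → ℂ} (hv : LinearIndependent ℂ v) (hn : n + Fintype.card ι = N + 1) :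
    ∃ K : Fin n → Fin (N + 1),
      LinearIndependent ℂ (Sum.elim v fun t ↦ (Pi.single (K t) 1 : Fin (N + 1) → ℂ)) := by
  set W := Submodule.span ℂ (Set.range v) with hW
  obtain ⟨κ, a, ha, hspan, hli⟩ := exists_linearIndependent' ℂ
    (fun l : Fin (N + 1) ↦ W.mkQ (Pi.single l (1 : ℂ)))
  have : Fintype κ := Fintype.ofInjective a ha
  have htop : Submodule.span ℂ (Set.range fun l : Fin (N + 1) ↦ W.mkQ (Pi.single l (1 : ℂ))) =
    ⊤ := by
    have h1 : (Set.range fun l : Fin (N + 1) ↦ W.mkQ (Pi.single l (1 : ℂ))) =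
        W.mkQ '' Set.range (Pi.basisFun ℂ (Fin (N + 1))) := by
      rw [← Set.range_comp]; congr 1; ext l; simp
    rw [h1, ← Submodule.map_span, (Pi.basisFun ℂ (Fin (N + 1))).span_eq, Submodule.map_top,
      Submodule.range_mkQ]
  have hcard : Fintype.card κ = n := by
    have h1 := finrank_span_eq_card hli
    rw [hspan, htop, finrank_top] at h1
    have h2 := W.finrank_quotient_add_finrank
    rw [finrank_span_eq_card hv, Module.finrank_fin_fun, h1] at h2
    omega
  let E : Fin n ≃ κ := (finCongr hcard.symm).trans (Fintype.equivFin κ).symm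
  refine ⟨a ∘ E, ?_⟩
  exact LinearIndependent.sumElim_of_quotient (M' := W)
    (f := fun i ↦ ⟨v i, Submodule.subset_span ⟨i, rfl⟩⟩)
    (LinearIndependent.of_comp W.subtype hv) _ (hli.comp E E.injective)

variable {N n k : ℕ} (e : Fin (N + 1) ≃ (Fin k ⊕ Unit) ⊕ Fin n)

theorem frameDet_ne_zero {F : Fin k → Fin (N + 1) → ℂ} {i : Fin (N + 1)}
    {w : Fin n → Fin (N + 1) → ℂ}
    (h : LinearIndependent ℂ (Sum.elim (Sum.elim F fun _ : Unit ↦ Pi.single i 1) w)) :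
    frameDet e F i w ≠ 0 := by
  rw [frameDet_eq_det]
  have h1 : LinearIndependent ℂ
      (Matrix.of fun r ↦ Sum.elim (Sum.elim F fun _ ↦ Pi.single i 1) w (e r)).row :=
    h.comp e e.injective
  rw [Matrix.linearIndependent_rows_iff_isUnit, Matrix.isUnit_iff_isUnit_det] at h1
  exact h1.ne_zero

/-- The Nullstellensatz for the maximal minors of the Jacobian matrix extended by `e_i`: they have
no common zero on the part `X_i ≠ 0` of the cone. -/
theorem exists_X_pow_mem_frameDet {d : Fin k → ℕ} {f : Fin k → MvPolynomial (Fin (N + 1)) ℂ}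
    (hf : ∀ i, (f i).IsHomogeneous (d i)) (hn : n + k = N)
    (hJ : ∀ z : Fin (N + 1) → ℂ, z ≠ 0 → (∀ j, eval z (f j) = 0) →
      LinearIndependent ℂ fun j l ↦ eval z (pderiv l (f j))) (i : Fin (N + 1)) :
    ∃ M, X i ^ M ∈ Ideal.span (Set.range f) ⊔ Ideal.span (Set.range fun K : Fin n → Fin (N + 1) ↦
      frameDet e (fun j ↦ gradVec (RingHom.id _) (f j)) i fun t ↦ Pi.single (K t) 1) := by
  rw [← Ideal.mem_radical_iff, ← vanishingIdeal_zeroLocus_eq_radical (K := ℂ),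
    mem_vanishingIdeal_iff]
  intro z hz
  rw [mem_zeroLocus_iff] at hz
  by_contra hzi
  rw [aeval_X] at hzi
  have hz0 : z ≠ 0 := by rintro rfl; exact hzi rfl
  have hfz : ∀ j, eval z (f j) = 0 := fun j ↦ by
    simpa [aeval_eq_eval] using hz (f j) (Ideal.mem_sup_left (Ideal.subset_span ⟨j, rfl⟩))
  have heuler : ∀ j, ∑ l, eval z (pderiv l (f j)) * z l = 0 := fun j ↦ by
    have h1 := congrArg (eval z) (hf j).sum_X_mul_pderiv
    simp only [map_sum, map_mul, eval_X, map_nsmul, hfz, smul_zero] at h1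
    rw [← h1]
    exact Finset.sum_congr rfl fun l _ ↦ mul_comm _ _
  -- By Euler's identity the gradients are orthogonal to `z`, while `e_i` is not, as `z_i ≠ 0`.
  have hli : LinearIndependent ℂ (Sum.elim (fun j l ↦ eval z (pderiv l (f j)))
      fun _ : Unit ↦ (Pi.single i 1 : Fin (N + 1) → ℂ)) := by
    refine (hJ z hz0 hfz).sum_type (LinearIndependent.of_subsingleton () (by simp)) ?_
    rw [Submodule.disjoint_def]
    intro x hx1 hx2
    have h1 : ∑ l, x l * z l = 0 := by
      clear hx2
      induction hx1 using Submodule.span_induction with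
      | mem x hx => obtain ⟨j, rfl⟩ := hx; exact heuler j
      | zero => simp
      | add x y _ _ hx hy => simp only
        [Pi.add_apply, add_mul, Finset.sum_add_distrib, hx, hy, add_zero]
      | smul c x _ hx =>
        simp only [Pi.smul_apply, smul_eq_mul, mul_assoc, ← Finset.mul_sum, hx, mul_zero]
    rw [Set.range_const, Submodule.mem_span_singleton] at hx2
    obtain ⟨c, rfl⟩ := hx2
    rw [Finset.sum_eq_single i (fun b _ hb ↦ by simp [hb]) (by simp)] at h1
    have : c = 0 := by simpa [hzi] using h1
    rw [this, zero_smul]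
  obtain ⟨K, hK⟩ := exists_linearIndependent_sumElim_single (n := n) hli (by simp; omega)
  refine frameDet_ne_zero e hK ?_
  have h1 := hz _ (Ideal.mem_sup_right (Ideal.subset_span ⟨K, rfl⟩))
  rw [aeval_eq_eval] at h1
  dsimp only at h1
  rw [← h1, map_frameDet]
  congr 1
  funext t l
  by_cases h : l = K t
  · subst h; simp
  · simp [h]

end FrameNullstellensatz

/-! ### Homogeneous elements vanishing on a basic open set -/

section ProjVanishing

variable {A : Type} [CommRing A] [Algebra ℂ A] (𝒜 : ℕ → Submodule ℂ A) [GradedAlgebra 𝒜]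

/-- A homogeneous element which vanishes in the localizations at all points of `D₊(a)` is killed by
a power of `a`. -/
theorem exists_pow_mul_eq_zero {a p : A} {e c : ℕ} (ha : a ∈ 𝒜 e) (he : 0 < e) (hp : p ∈ 𝒜 c)
    (h : ∀ x ∈ Proj.basicOpen 𝒜 a, algebraMap A (Loc 𝒜 x) p = 0) : ∃ q, a ^ q * p = 0 := by
  set J : Ideal A := LinearMap.ker (LinearMap.toSpanSingleton A A p) with hJ
  have hmem : ∀ r, r ∈ J ↔ r * p = 0 := fun r ↦ by
    rw [hJ, LinearMap.mem_ker, LinearMap.toSpanSingleton_apply, smul_eq_mul]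
  have hJh : J.IsHomogeneous 𝒜 := by
    intro i r hr
    rw [hmem] at hr ⊢
    rw [← DirectSum.coe_decompose_mul_add_of_right_mem 𝒜 hp, hr]
    simp
  -- The annihilator of `p` is homogeneous, so its radical is the intersection of homogeneous
  -- primes.
  have hrad : a ∈ J.radical := by
    rw [hJh.radical_eq, Ideal.mem_sInf]
    rintro Q ⟨hQh, hJQ, hQ⟩
    by_contra haQ
    let x : Proj 𝒜 := (⟨⟨Q, hQh⟩, hQ, fun hle ↦ haQ (hle
      (HomogeneousIdeal.mem_irrelevant_of_mem 𝒜 he ha))⟩ : ProjectiveSpectrum 𝒜)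
    have h1 := h x haQ
    rw [IsLocalization.map_eq_zero_iff (primeAt 𝒜 x).primeCompl] at h1
    obtain ⟨s, hs⟩ := h1
    exact s.2 (hJQ ((hmem _).mpr hs))
  obtain ⟨q, hq⟩ := hrad
  exact ⟨q, (hmem _).mp hq⟩

end ProjVanishing

/-! ### Proportionality of alternating forms -/

section AlternatingProportional

variable {B M : Type} [CommRing B] [AddCommGroup M] [Module B M] {n : ℕ}

theorem AlternatingMap.map_sum_smul (φ : M [⋀^Fin n]→ₗ[B] B) (v : Fin n → M)
    (C : Matrix (Fin n) (Fin n) B) :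
    φ (fun t ↦ ∑ t', C t t' • v t') = C.det * φ v := by
  have h := (φ.compLinearMap (Fintype.linearCombination B v)).eq_smul_basis_det
    (Pi.basisFun B (Fin n))
  have h1 := DFunLike.congr_fun h fun t ↦ C t
  rw [AlternatingMap.smul_apply, smul_eq_mul, mul_comm] at h1
  refine Eq.trans ?_ (h1.trans ?_)
  · rfl
  · congr 1
    · exact Pi.basisFun_det_apply C
    rw [AlternatingMap.compLinearMap_apply]
    congr 1
    funext t
    simp [Fintype.linearCombination_apply, Pi.basisFun_apply, Pi.single_apply]

/-- Two alternating forms on a module whose elements are combinations of `v₁, …, vₙ` up to the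
factor `δ` are proportional up to a power of `δ`. -/
theorem AlternatingMap.pow_mul_comm_of_smul_mem (φ ψ : M [⋀^Fin n]→ₗ[B] B) {v : Fin n → M} {δ : B}
    (hδ : ∀ x : M, δ • x ∈ Submodule.span B (Set.range v)) (ω : Fin n → M) :
    δ ^ n * (φ ω * ψ v) = δ ^ n * (ψ ω * φ v) := by
  choose C hC using fun t ↦ (Submodule.mem_span_range_iff_exists_fun B).mp (hδ (ω t))
  have key : ∀ χ : M [⋀^Fin n]→ₗ[B] B, δ ^ n * χ ω = (Matrix.of C).det * χ v := by
    intro χ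
    rw [← AlternatingMap.map_sum_smul]
    simp only [Matrix.of_apply, hC]
    have := χ.toMultilinearMap.map_smul_univ (fun _ ↦ δ) ω
    simpa using this.symm
  rw [← mul_assoc, key, ← mul_assoc, key]
  ring

end AlternatingProportional

/-! ### Linear forms on top differential forms -/

section FormsOnLocalizations

/-- The differentials of a localization are spanned by those of the fractions with
denominator `1`. -/
theorem span_D_range_eq_top {A B : Type} [CommRing A] [CommRing B] [Algebra ℂ B] (ρ : A →+* B)
    {g : A} (hg : IsUnit (ρ g)) (hρ : ∀ v : B, ∃ (q : ℕ) (u : A), ρ (g ^ q) * v = ρ u) :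
    Submodule.span B (KaehlerDifferential.D ℂ B '' Set.range ρ) = ⊤ := by
  rw [eq_top_iff, ← KaehlerDifferential.span_range_derivation, Submodule.span_le]
  rintro _ ⟨v, rfl⟩
  obtain ⟨q, u, h⟩ := hρ v
  have h1 := congrArg (KaehlerDifferential.D ℂ B) h
  rw [Derivation.leibniz] at h1
  have hgq : IsUnit (ρ (g ^ q)) := by rw [map_pow]; exact hg.pow q
  have h2 : ρ (g ^ q) • KaehlerDifferential.D ℂ B v =
      KaehlerDifferential.D ℂ B (ρ u) - v • KaehlerDifferential.D ℂ B (ρ (g ^ q)) := by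
    rw [← h1]; abel
  have h3 : ρ (g ^ q) • KaehlerDifferential.D ℂ B v ∈
      Submodule.span B (KaehlerDifferential.D ℂ B '' Set.range ρ) := by
    rw [h2]
    exact sub_mem (Submodule.subset_span ⟨_, ⟨u, rfl⟩, rfl⟩)
      (Submodule.smul_mem _ _ (Submodule.subset_span ⟨_, ⟨_, rfl⟩, rfl⟩))
  obtain ⟨c, hc⟩ := hgq.exists_left_inv
  have h4 := Submodule.smul_mem _ c h3
  rwa [smul_smul, hc, one_smul] at h4

variable {X : Scheme} [X.Over (Spec (CommRingCat.of ℂ))] {n : ℕ}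

/-- A form on `n`-forms as an alternating form on differentials. -/
def toAlternating {U : X.affineOpens}
    (φ : Module.Dual Γ(X, (U : X.Opens)) (TopForms X n U)) :
    (KaehlerDifferential ℂ Γ(X, (U : X.Opens))) [⋀^Fin n]→ₗ[Γ(X, (U : X.Opens))]
      Γ(X, (U : X.Opens)) :=
  exteriorPower.alternatingMapLinearEquiv.symm φ

theorem toAlternating_D {U : X.affineOpens}
    (φ : Module.Dual Γ(X, (U : X.Opens)) (TopForms X n U)) (u : Fin n → Γ(X, (U : X.Opens))) :
    toAlternating φ (fun t ↦ KaehlerDifferential.D ℂ _ (u t)) = φ (wedgeD X n U u) := rfl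

/-- A linear form on `n`-forms is determined by its values on the `du₁ ∧ … ∧ duₙ` for functions
`u_t` whose differentials span. -/
theorem dual_topForms_ext_of_span {U : X.affineOpens}
    {φ φ' : Module.Dual Γ(X, (U : X.Opens)) (TopForms X n U)} {S : Set Γ(X, (U : X.Opens))}
    (hS : Submodule.span Γ(X, (U : X.Opens)) (KaehlerDifferential.D ℂ _ '' S) = ⊤) (h0 : 0 ∈ S)
    (h : ∀ u : Fin n → Γ(X, (U : X.Opens)), (∀ t, u t ∈ S) →
      φ (wedgeD X n U u) = φ' (wedgeD X n U u)) : φ = φ' := by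
  apply exteriorPower.alternatingMapLinearEquiv.symm.injective
  refine AlternatingMap.ext fun ω ↦ ?_
  change toAlternating φ ω = toAlternating φ' ω
  induction ω using tuple_span_induction hS ⟨0, h0, map_zero _⟩ with
  | hmem v hv =>
    choose u hu hu' using hv
    rw [show v = fun t ↦ KaehlerDifferential.D ℂ _ (u t) from funext fun t ↦ (hu' t).symm]
    exact h u hu
  | hadd ω t a b ha hb => rw [AlternatingMap.map_update_add, AlternatingMap.map_update_add, ha, hb]
  | hsmul ω t c a ha => rw [AlternatingMap.map_update_smul, AlternatingMap.map_update_smul, ha]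

theorem dual_topForms_ext {U : X.affineOpens}
    {φ φ' : Module.Dual Γ(X, (U : X.Opens)) (TopForms X n U)}
    (h : ∀ u : Fin n → Γ(X, (U : X.Opens)), φ (wedgeD X n U u) = φ' (wedgeD X n U u)) :
    φ = φ' :=
  dual_topForms_ext_of_span (S := Set.univ)
    (by rw [Set.image_univ, KaehlerDifferential.span_range_derivation]) trivial fun u _ ↦ h u

/-- A form over a basic open subset is determined by its values on differentials of functions on
the larger affine open set. -/
theorem dual_topForms_ext_of_basicOpen {U V : X.affineOpens} (hVU : (V : X.Opens) ≤ (U : X.Opens))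
    (g : Γ(X, (U : X.Opens))) (hg : (V : X.Opens) = X.basicOpen g)
    {φ φ' : Module.Dual Γ(X, (V : X.Opens)) (TopForms X n V)}
    (h : ∀ u : Fin n → Γ(X, (U : X.Opens)),
      φ (wedgeD X n V fun t ↦ X.presheaf.map (homOfLE hVU).op (u t)) =
        φ' (wedgeD X n V fun t ↦ X.presheaf.map (homOfLE hVU).op (u t))) : φ = φ' := by
  refine dual_topForms_ext_of_span (S := Set.range (X.presheaf.map (homOfLE hVU).op).hom) ?_
    ⟨0, map_zero _⟩ fun u hu ↦ ?_
  · obtain ⟨V, hV⟩ := V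
    dsimp only at hg
    subst hg
    have := U.2.isLocalization_basicOpen g
    refine span_D_range_eq_top (X.presheaf.map (homOfLE hVU).op).hom (g := g) ?_ fun v ↦ ?_
    · exact IsLocalization.Away.algebraMap_isUnit (S := Γ(X, X.basicOpen g)) g
    · obtain ⟨⟨u, ⟨_, q, rfl⟩⟩, hu⟩ := IsLocalization.surj (Submonoid.powers g) v
      exact ⟨q, u, by rw [mul_comm]; exact hu⟩
  · choose u' hu' using hu
    rw [show u = fun t ↦ X.presheaf.map (homOfLE hVU).op (u' t) from funext fun t ↦ (hu' t).symm]
    exact h u'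

theorem exists_affine_basicOpen {X : Scheme} {U V : X.affineOpens} {x : X} (hU : x ∈ (U : X.Opens))
    (hV : x ∈ (V : X.Opens)) : ∃ W : X.affineOpens, x ∈ (W : X.Opens) ∧ (W : X.Opens) ≤ U ∧
      (W : X.Opens) ≤ V ∧ (∃ g : Γ(X, (U : X.Opens)), (W : X.Opens) = X.basicOpen g) ∧
        ∃ g : Γ(X, (V : X.Opens)), (W : X.Opens) = X.basicOpen g := by
  obtain ⟨g, g', hgg, hx⟩ := exists_basicOpen_le_affine_inter U.2 V.2 x ⟨hU, hV⟩
  exact ⟨⟨_, U.2.basicOpen g⟩, hx, X.basicOpen_le g, hgg.trans_le (X.basicOpen_le g'), ⟨g, rfl⟩,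
    ⟨g', hgg⟩⟩

end FormsOnLocalizations

/-! ### Anticanonical sections defined by polynomials -/

section GradientSections

variable {N n k m : ℕ} {d : Fin k → ℕ} {f : Fin k → MvPolynomial (Fin (N + 1)) ℂ}
  {hf : ∀ i, (f i).IsHomogeneous (d i)} {e : Fin (N + 1) ≃ (Fin k ⊕ Unit) ⊕ Fin n}

/-- The value of a gradient form at a point depends only on the values there of the polynomial and
of the functions, as the functions can be presented as fractions with invertible denominators. -/
theorem IsGradientForm.valueAt_eq {a a' : MvPolynomial (Fin (N + 1)) ℂ}
    {U V : (hypersurfacesIntersection d f hf).affineOpens}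
    {φ : Module.Dual Γ(hypersurfacesIntersection d f hf,
      (U : (hypersurfacesIntersection d f hf).Opens))
      (TopForms (hypersurfacesIntersection d f hf) n U)}
    {φ' : Module.Dual Γ(hypersurfacesIntersection d f hf,
      (V : (hypersurfacesIntersection d f hf).Opens))
      (TopForms (hypersurfacesIntersection d f hf) n V)}
    (h : IsGradientForm e a U φ) (h' : IsGradientForm e a' V φ') {x : Proj (coneGrading d f hf)}
    (hU : x ∈ (U : (hypersurfacesIntersection d f hf).Opens))
    (hV : x ∈ (V : (hypersurfacesIntersection d f hf).Opens))
    (ha : coordHom x a = coordHom x a')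
    {u : Fin n → Γ(hypersurfacesIntersection d f hf,
      (U : (hypersurfacesIntersection d f hf).Opens))}
    {u' : Fin n → Γ(hypersurfacesIntersection d f hf,
      (V : (hypersurfacesIntersection d f hf).Opens))}
    (hu : ∀ t, valueAt hU (u t) = valueAt hV (u' t)) :
    valueAt hU (φ (wedgeD (hypersurfacesIntersection d f hf) n U u)) =
      valueAt hV (φ' (wedgeD (hypersurfacesIntersection d f hf) n V u')) := by
  obtain ⟨i, hi⟩ := exists_mem_basicOpen_coordClass x
  choose W hxW hWU c r s hc hr hs hrs using fun t ↦ exists_valueAt_fraction hU i hi (u t)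
  have h1 := h u x hU r s c hr hs (fun t ↦ (hrs t x (hxW t)).2.2) i
  have h2 := h' u' x hV r s c hr hs (fun t ↦ by rw [← hu]; exact (hrs t x (hxW t)).2.2) i
  rw [map_mul, ha, ← map_mul, ← h2] at h1
  refine IsUnit.mul_left_cancel ?_ h1
  exact (isUnit_coordHom_X hi).mul (IsUnit.prod_univ_iff.mpr fun t ↦ (hrs t x (hxW t)).2.1.pow 2)

theorem IsGradientForm.add {a a' : MvPolynomial (Fin (N + 1)) ℂ}
    {U : (hypersurfacesIntersection d f hf).affineOpens}
    {φ φ' : Module.Dual Γ(hypersurfacesIntersection d f hf,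
      (U : (hypersurfacesIntersection d f hf).Opens))
      (TopForms (hypersurfacesIntersection d f hf) n U)}
    (h : IsGradientForm e a U φ) (h' : IsGradientForm e a' U φ') :
    IsGradientForm e (a + a') U (φ + φ') := by
  intro u x hx r s c hr hs hrs i
  rw [LinearMap.add_apply, map_add, mul_add, h u x hx r s c hr hs hrs i,
    h' u x hx r s c hr hs hrs i, add_mul, map_add]

theorem IsGradientForm.smul {a : MvPolynomial (Fin (N + 1)) ℂ}
    {U : (hypersurfacesIntersection d f hf).affineOpens}
    {φ : Module.Dual Γ(hypersurfacesIntersection d f hf,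
      (U : (hypersurfacesIntersection d f hf).Opens))
      (TopForms (hypersurfacesIntersection d f hf) n U)}
    (h : IsGradientForm e a U φ) (b : ℂ) : IsGradientForm e (b • a) U (b • φ) := by
  intro u x hx r s c hr hs hrs i
  rw [LinearMap.smul_apply, Algebra.smul_def, map_mul, valueAt_algebraMap, mul_left_comm,
    h u x hx r s c hr hs hrs i, smul_eq_C_mul, mul_assoc, map_mul _ (C b)]

theorem IsGradientForm.ext {a a' : MvPolynomial (Fin (N + 1)) ℂ}
    {U : (hypersurfacesIntersection d f hf).affineOpens}
    {φ φ' : Module.Dual Γ(hypersurfacesIntersection d f hf,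
      (U : (hypersurfacesIntersection d f hf).Opens))
      (TopForms (hypersurfacesIntersection d f hf) n U)}
    (h : IsGradientForm e a U φ) (h' : IsGradientForm e a' U φ')
    (ha : ∀ x ∈ (U : (hypersurfacesIntersection d f hf).Opens),
      coordHom (hf := hf) x a = coordHom x a') : φ = φ' :=
  dual_topForms_ext fun _ ↦ valueAt_ext fun x hx ↦ h.valueAt_eq h' hx hx (ha x hx) fun _ ↦ rfl

variable (e) in
/-- The form over `U` defined by a homogeneous polynomial of degree `i_X`. It is chosen among those
satisfying `IsGradientForm`, which is harmless by `IsGradientForm.ext`. -/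
def gradientForm (hd : ∀ i, 1 ≤ d i) (hn : n + k = N) (hm : m + ∑ i, d i = N + 1)
    (U : (hypersurfacesIntersection d f hf).affineOpens)
    (a : homogeneousSubmodule (Fin (N + 1)) ℂ m) :
    Module.Dual Γ(hypersurfacesIntersection d f hf, (U : (hypersurfacesIntersection d f hf).Opens))
      (TopForms (hypersurfacesIntersection d f hf) n U) :=
  (exists_isGradientForm e hd hn hm a.2 U).choose

theorem isGradientForm_gradientForm (hd : ∀ i, 1 ≤ d i) (hn : n + k = N)
    (hm : m + ∑ i, d i = N + 1) (U : (hypersurfacesIntersection d f hf).affineOpens)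
    (a : homogeneousSubmodule (Fin (N + 1)) ℂ m) :
    IsGradientForm e a U (gradientForm e hd hn hm U a) :=
  (exists_isGradientForm e hd hn hm a.2 U).choose_spec

variable (e) in
/-- The section of the anticanonical sheaf defined by a homogeneous polynomial of degree `i_X`. -/
def gradientSection (hd : ∀ i, 1 ≤ d i) (hn : n + k = N) (hm : m + ∑ i, d i = N + 1) :
    homogeneousSubmodule (Fin (N + 1)) ℂ m →ₗ[ℂ]
      anticanonicalSections (hypersurfacesIntersection d f hf) n :=
  LinearMap.codRestrict _
    (LinearMap.pi fun U ↦
      { toFun := gradientForm e hd hn hm U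
        map_add' := fun a b ↦ (isGradientForm_gradientForm hd hn hm U (a + b)).ext
          ((isGradientForm_gradientForm hd hn hm U a).add
            (isGradientForm_gradientForm hd hn hm U b)) fun _ _ ↦ rfl
        map_smul' := fun c a ↦ (isGradientForm_gradientForm hd hn hm U (c • a)).ext
          ((isGradientForm_gradientForm hd hn hm U a).smul c) fun _ _ ↦ rfl })
    (fun a U V h u ↦ by
      refine valueAt_ext fun x hx ↦ ?_
      rw [valueAt_res h hx]
      exact (isGradientForm_gradientForm hd hn hm V a).valueAt_eq
        (isGradientForm_gradientForm hd hn hm U a) hx (h hx) rfl fun t ↦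
          valueAt_res h hx (u t))

theorem isGradientForm_gradientSection (hd : ∀ i, 1 ≤ d i) (hn : n + k = N)
    (hm : m + ∑ i, d i = N + 1) (a : homogeneousSubmodule (Fin (N + 1)) ℂ m)
    (U : (hypersurfacesIntersection d f hf).affineOpens) :
    IsGradientForm e a U ((gradientSection e hd hn hm a).1 U) :=
  isGradientForm_gradientForm hd hn hm U a

variable (hf) in
/-- The standard affine open subset `X_i ≠ 0` of the intersection. -/
def coordOpen (i : Fin (N + 1)) : (hypersurfacesIntersection d f hf).affineOpens :=
  ⟨Proj.basicOpen (coneGrading d f hf) (coordClass i),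
    Proj.isAffineOpen_basicOpen _ _ (coordClass_mem i) one_pos⟩

/-- Two sections agree over a basic open subset of an affine open subset over which they agree. -/
theorem anticanonicalSections_eq_of_basicOpen {X : Scheme} [X.Over (Spec (CommRingCat.of ℂ))]
    {s s' : anticanonicalSections X n} {U W : X.affineOpens} (h : s.1 U = s'.1 U)
    (hWU : (W : X.Opens) ≤ U) (g : Γ(X, (U : X.Opens))) (hW : (W : X.Opens) = X.basicOpen g) :
    s.1 W = s'.1 W :=
  dual_topForms_ext_of_basicOpen hWU g hW fun u ↦ by rw [s.2 U W hWU, s'.2 U W hWU, h]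

/-- Two sections which agree over `U` have the same values at the points of `U`. -/
theorem valueAt_eq_of_agree {s s' : anticanonicalSections (hypersurfacesIntersection d f hf) n}
    {U V : (hypersurfacesIntersection d f hf).affineOpens} (h : s.1 U = s'.1 U)
    {x : Proj (coneGrading d f hf)} (hU : x ∈ (U : (hypersurfacesIntersection d f hf).Opens))
    (hV : x ∈ (V : (hypersurfacesIntersection d f hf).Opens))
    (u : Fin n → Γ(hypersurfacesIntersection d f hf,
      (V : (hypersurfacesIntersection d f hf).Opens))) :
    valueAt hV (s.1 V (wedgeD (hypersurfacesIntersection d f hf) n V u)) =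
      valueAt hV (s'.1 V (wedgeD (hypersurfacesIntersection d f hf) n V u)) := by
  obtain ⟨W, hx, hWU, hWV, ⟨g, hW⟩, -⟩ := exists_affine_basicOpen hU hV
  have hsW : s.1 W = s'.1 W := anticanonicalSections_eq_of_basicOpen h hWU g hW
  have h1 := s.2 V W hWV u
  rw [hsW] at h1
  have h2 := congrArg (valueAt hx) (h1.symm.trans (s'.2 V W hWV u))
  rwa [valueAt_res hWV hx, valueAt_res hWV hx] at h2

/-- Sections are determined on the standard open cover. -/
theorem anticanonicalSections_ext
    {s s' : anticanonicalSections (hypersurfacesIntersection d f hf) n}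
    (h : ∀ i, s.1 (coordOpen hf i) = s'.1 (coordOpen hf i)) : s = s' := by
  refine Subtype.ext <| funext fun V ↦ dual_topForms_ext fun u ↦ valueAt_ext fun x hx ↦ ?_
  obtain ⟨i, hi⟩ := exists_mem_basicOpen_coordClass x
  exact valueAt_eq_of_agree (h i) hi hx u

end GradientSections

/-! ### Affine coordinates and dehomogenization -/

section AffineCoordinates

variable {N n k m : ℕ} {d : Fin k → ℕ} {f : Fin k → MvPolynomial (Fin (N + 1)) ℂ}
  {hf : ∀ i, (f i).IsHomogeneous (d i)}

variable (hf) in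
/-- The affine coordinate `X_l / X_i` on the open set `X_i ≠ 0`. -/
def affineCoord (i l : Fin (N + 1)) : Γ(hypersurfacesIntersection d f hf,
    (coordOpen hf i : (hypersurfacesIntersection d f hf).Opens)) :=
  Proj.awayToSection (coneGrading d f hf) (coordClass i) (HomogeneousLocalization.mk
    ⟨1, ⟨coordClass l, coordClass_mem l⟩, ⟨coordClass i, coordClass_mem i⟩,
      Submonoid.mem_powers _⟩)

theorem valueAt_affineCoord {i : Fin (N + 1)} {x : Proj (coneGrading d f hf)}
    (hx : x ∈ (coordOpen hf i : (hypersurfacesIntersection d f hf).Opens)) (l : Fin (N + 1)) :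
    coordHom x (X i) * valueAt hx (affineCoord hf i l) = coordHom x (X l) :=
  evalAt_awayToSection (coneGrading d f hf) hx 1 (coordClass l) (coordClass i) (coordClass_mem l)
    (coordClass_mem i) (Submonoid.mem_powers _)

variable (hf) in
/-- Dehomogenization of polynomials with respect to `X_i`. -/
def dehomogenize (i : Fin (N + 1)) : MvPolynomial (Fin (N + 1)) ℂ →ₐ[ℂ]
    Γ(hypersurfacesIntersection d f hf,
      (coordOpen hf i : (hypersurfacesIntersection d f hf).Opens)) :=
  aeval (affineCoord hf i)

/-- Dehomogenization divides a form of degree `q` by `X_i ^ q`. -/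
theorem valueAt_dehomogenize {i : Fin (N + 1)} {x : Proj (coneGrading d f hf)}
    (hx : x ∈ (coordOpen hf i : (hypersurfacesIntersection d f hf).Opens))
    {p : MvPolynomial (Fin (N + 1)) ℂ} {q : ℕ} (hp : p.IsHomogeneous q) :
    coordHom x (X i) ^ q * valueAt hx (dehomogenize hf i p) = coordHom x p := by
  conv_lhs => rw [p.as_sum]
  conv_rhs => rw [p.as_sum]
  simp only [map_sum, Finset.mul_sum]
  refine Finset.sum_congr rfl fun s hs ↦ ?_
  have hsq : ∑ l, s l = q := by
    rw [← hp (mem_support_iff.mp hs), Finsupp.weight_apply, Finsupp.sum_fintype _ _ (by simp)]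
    simp
  have h1 : (monomial s) (coeff s p) = C (coeff s p) * ∏ l, X l ^ s l := by
    rw [monomial_eq, Finsupp.prod_fintype _ _ (by simp)]
  rw [h1, map_mul, map_mul, map_mul, map_prod, map_prod, map_prod, dehomogenize, ← algebraMap_eq,
    AlgHom.commutes, valueAt_algebraMap, algebraMap_eq, mul_left_comm, ← hsq,
    ← Finset.prod_pow_eq_pow_sum, ← Finset.prod_mul_distrib]
  congr 1
  refine Finset.prod_congr rfl fun l _ ↦ ?_
  rw [map_pow, map_pow, map_pow, aeval_X, ← mul_pow, valueAt_affineCoord hx]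

theorem dehomogenize_X_self (i : Fin (N + 1)) : dehomogenize hf i (X i) = 1 :=
  valueAt_ext fun x hx ↦ (isUnit_coordHom_X hx).mul_left_cancel (by
    have := valueAt_dehomogenize hx (isHomogeneous_X ℂ i)
    rw [pow_one] at this
    rw [this, map_one, mul_one])

theorem dehomogenize_equation (i : Fin (N + 1)) (j : Fin k) : dehomogenize hf i (f j) = 0 :=
  valueAt_ext fun x hx ↦ ((isUnit_coordHom_X hx).pow (d j)).mul_left_cancel (by
    rw [valueAt_dehomogenize hx (hf j), map_zero, mul_zero]
    exact coordHom_eq_zero x (Ideal.subset_span ⟨j, rfl⟩))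

/-- A function on `X_i ≠ 0` is a form divided by a power of `X_i`. -/
theorem exists_coordOpen_fraction (i : Fin (N + 1)) (u : Γ(hypersurfacesIntersection d f hf,
    (coordOpen hf i : (hypersurfacesIntersection d f hf).Opens))) :
    ∃ (q : ℕ) (r : MvPolynomial (Fin (N + 1)) ℂ), r.IsHomogeneous q ∧ ∀ x
      (hx : x ∈ (coordOpen hf i : (hypersurfacesIntersection d f hf).Opens)),
      coordHom x (X i) ^ q * valueAt hx u = coordHom x r := by
  obtain ⟨q, r, hr, h⟩ := exists_frac_of_basicOpen (coneGrading d f hf) (coordClass_mem i)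
    one_pos u
  rw [mul_one] at hr
  obtain ⟨r, hr, rfl⟩ := hr
  refine ⟨q, r, hr, fun x hx ↦ ?_⟩
  have := h x hx
  rw [map_pow] at this
  exact this

theorem dehomogenize_surjective (i : Fin (N + 1)) : Function.Surjective (dehomogenize hf i) := by
  intro u
  obtain ⟨q, r, hr, h⟩ := exists_coordOpen_fraction i u
  refine ⟨r, valueAt_ext fun x hx ↦ ((isUnit_coordHom_X hx).pow q).mul_left_cancel ?_⟩
  rw [valueAt_dehomogenize hx hr, h x hx]

/-- The chain rule. -/
theorem D_aeval {B : Type} [CommRing B] [Algebra ℂ B] {σ : Type} [Fintype σ] (y : σ → B)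
    (p : MvPolynomial σ ℂ) : KaehlerDifferential.D ℂ B (aeval y p) =
      ∑ l, aeval y (pderiv l p) • KaehlerDifferential.D ℂ B (y l) := by
  classical
  induction p using MvPolynomial.induction_on with
  | C c => simp [← algebraMap_eq]
  | add p q hp hq =>
    rw [map_add, map_add, hp, hq, ← Finset.sum_add_distrib]
    simp only [map_add, add_smul]
  | mul_X p i hp =>
    rw [map_mul, Derivation.leibniz, hp, aeval_X]
    simp only [Derivation.leibniz, map_add, smul_eq_mul, map_mul, aeval_X, pderiv_X, add_smul,
      Finset.sum_add_distrib]
    congr 1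
    · rw [Finset.sum_eq_single i (fun b _ hb ↦ by simp [hb.symm]) (by simp)]
      simp
    · rw [Finset.smul_sum]
      simp only [mul_smul]

end AffineCoordinates

/-! ### Minors in affine coordinates -/

section CoordinateForms

variable {N n k m : ℕ} {d : Fin k → ℕ} {f : Fin k → MvPolynomial (Fin (N + 1)) ℂ}
  {hf : ∀ i, (f i).IsHomogeneous (d i)} (e : Fin (N + 1) ≃ (Fin k ⊕ Unit) ⊕ Fin n)

/-- The minor of the Jacobian matrix extended by `e_i` in which the remaining rows are the vectors
`e_{K(1)}, …, e_{K(n)}` of the standard basis. -/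
def coordMinor (f : Fin k → MvPolynomial (Fin (N + 1)) ℂ) (i : Fin (N + 1))
    (K : Fin n → Fin (N + 1)) : MvPolynomial (Fin (N + 1)) ℂ :=
  frameDet e (fun j ↦ gradVec (RingHom.id _) (f j)) i fun t ↦ Pi.single (K t) 1

theorem isHomogeneous_coordMinor (hf : ∀ i, (f i).IsHomogeneous (d i)) (i : Fin (N + 1))
    (K : Fin n → Fin (N + 1)) :
    (coordMinor e f i K).IsHomogeneous (∑ j, (d j - 1)) := by
  have h := isHomogeneous_frameDet e (F := fun j ↦ gradVec (RingHom.id _) (f j))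
    (α := fun j ↦ d j - 1) (fun j l ↦ (hf j).pderiv) i
    (w := fun t ↦ Pi.single (K t) 1) (β := fun _ ↦ 0) fun t l ↦ by
      by_cases h : l = K t
      · subst h; simpa using isHomogeneous_one _ _
      · simpa [h] using isHomogeneous_zero _ _ _
  rw [Finset.sum_const_zero, add_zero] at h
  exact h

/-- The differentials of the affine coordinates `y_{K(1)}, …, y_{K(n)}` span the differentials on
`X_i ≠ 0` up to the corresponding minor. -/
theorem dehomogenize_coordMinor_smul_mem (i : Fin (N + 1)) (K : Fin n → Fin (N + 1))
    (ω : KaehlerDifferential ℂ Γ(hypersurfacesIntersection d f hf,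
      (coordOpen hf i : (hypersurfacesIntersection d f hf).Opens))) :
    dehomogenize hf i (coordMinor e f i K) • ω ∈ Submodule.span
      Γ(hypersurfacesIntersection d f hf,
        (coordOpen hf i : (hypersurfacesIntersection d f hf).Opens)) (Set.range fun t ↦
      KaehlerDifferential.D ℂ _ (affineCoord hf i (K t))) := by
  have hD : ∀ p, KaehlerDifferential.D ℂ _ (dehomogenize hf i p) =
      ∑ l, dehomogenize hf i (pderiv l p) • KaehlerDifferential.D ℂ _ (affineCoord hf i l) :=
    fun p ↦ D_aeval _ p
  have hminor : dehomogenize hf i (coordMinor e f i K) =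
      frameDet e (fun j l ↦ dehomogenize hf i (pderiv l (f j))) i fun t ↦ Pi.single (K t) 1 := by
    rw [coordMinor]
    refine (map_frameDet e (dehomogenize hf i).toRingHom _ _ _).trans ?_
    congr 1
    funext t l
    by_cases h : l = K t
    · subst h; simp
    · simp [h]
  have hspan : ω ∈ Submodule.span Γ(hypersurfacesIntersection d f hf,
      (coordOpen hf i : (hypersurfacesIntersection d f hf).Opens))
        (Set.range (KaehlerDifferential.D ℂ
      Γ(hypersurfacesIntersection d f hf,
        (coordOpen hf i : (hypersurfacesIntersection d f hf).Opens)))) := by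
    rw [KaehlerDifferential.span_range_derivation]; trivial
  induction hspan using Submodule.span_induction with
  | zero => rw [smul_zero]; exact zero_mem _
  | add x y _ _ hx hy => rw [smul_add]; exact add_mem hx hy
  | smul c x _ hx => rw [smul_comm]; exact Submodule.smul_mem _ c hx
  | mem x hx =>
    obtain ⟨u, rfl⟩ := hx
    obtain ⟨p, rfl⟩ := dehomogenize_surjective i u
    rw [hD, Finset.smul_sum]
    refine Submodule.sum_mem _ fun l _ ↦ ?_
    rw [smul_comm]
    refine Submodule.smul_mem _ (dehomogenize hf i (pderiv l p)) ?_
    -- The differentials of the affine coordinates satisfy the relations `∑ ∂f_j/∂X_l dy_l = 0` and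
    -- `dy_i = 0`.
    obtain ⟨C, hC⟩ := exists_frameDet_smul_eq e
      (fun j l ↦ dehomogenize hf i (pderiv l (f j))) i
      (fun l ↦ KaehlerDifferential.D ℂ _ (affineCoord hf i l))
      (fun j ↦ by rw [← hD, dehomogenize_equation, map_zero])
      (by
        have h1 : affineCoord hf i i = 1 := by
          rw [← dehomogenize_X_self, dehomogenize, aeval_X]
        rw [h1, Derivation.map_one_eq_zero]) K l
    rw [hminor, hC]
    exact Submodule.sum_mem _ fun t _ ↦ Submodule.smul_mem _ _ (Submodule.subset_span ⟨t, rfl⟩)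

variable {e}

/-- The value of a gradient form on the differentials of affine coordinates. -/
theorem IsGradientForm.valueAt_coord {a : MvPolynomial (Fin (N + 1)) ℂ}
    {U : (hypersurfacesIntersection d f hf).affineOpens}
    {φ : Module.Dual Γ(hypersurfacesIntersection d f hf,
      (U : (hypersurfacesIntersection d f hf).Opens))
      (TopForms (hypersurfacesIntersection d f hf) n U)}
    (h : IsGradientForm e a U φ) {x : Proj (coneGrading d f hf)}
    (hU : x ∈ (U : (hypersurfacesIntersection d f hf).Opens)) {i : Fin (N + 1)}
    (hi : x ∈ (coordOpen hf i : (hypersurfacesIntersection d f hf).Opens))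
    {K : Fin n → Fin (N + 1)}
    {u : Fin n → Γ(hypersurfacesIntersection d f hf,
      (U : (hypersurfacesIntersection d f hf).Opens))}
    (hu : ∀ t, coordHom x (X i) * valueAt hU (u t) = coordHom x (X (K t))) :
    coordHom x (X i) ^ (n + 1) * valueAt hU (φ (wedgeD (hypersurfacesIntersection d f hf) n U u)) =
      coordHom x a * coordHom x (coordMinor e f i K) := by
  have h1 := h u x hU (fun t ↦ X (K t)) (fun _ ↦ X i) (fun _ ↦ 1) (fun t ↦ isHomogeneous_X ℂ _)
    (fun t ↦ isHomogeneous_X ℂ _) hu i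
  -- The gradient of `X_K / X_i` is `e_K / X_i` up to a multiple of the row `e_i`.
  have h2 : frameDet e (fun j ↦ gradVec (RingHom.id _) (f j)) i
      (fun t ↦ (X i : MvPolynomial (Fin (N + 1)) ℂ) • gradVec (RingHom.id _) (X (K t)) -
        (X (K t) : MvPolynomial (Fin (N + 1)) ℂ) • gradVec (RingHom.id _) (X i)) =
          X i ^ n * coordMinor e f i K := by
    have h3 : X i ^ n * coordMinor e f i K = frameDet e (fun j ↦ gradVec (RingHom.id _) (f j)) i
        (fun t ↦ (X i : MvPolynomial (Fin (N + 1)) ℂ) •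
          (Pi.single (K t) 1 : Fin (N + 1) → MvPolynomial (Fin (N + 1)) ℂ)) := by
      rw [frameDet_smul, coordMinor]; simp
    rw [h3]
    refine frameDet_congr_insert e _ i fun t ↦ ?_
    rw [gradVec_X, gradVec_X, sub_sub_cancel_left, ← neg_smul]
    exact Submodule.smul_mem _ _ (Submodule.subset_span (Set.mem_insert _ _))
  rw [h2, map_mul, map_mul, map_pow, mul_left_comm (coordHom x a)] at h1
  refine ((isUnit_coordHom_X hi).pow n).mul_left_cancel (Eq.trans ?_ h1)
  simp only [Finset.prod_const, Finset.card_univ, Fintype.card_fin]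
  ring

/-- The form defined by `X_i^m` takes the value `δ_K` on `dy_{K(1)} ∧ … ∧ dy_{K(n)}`. -/
theorem IsGradientForm.apply_affineCoord (hd : ∀ i, 1 ≤ d i) (hn : n + k = N)
    (hm : m + ∑ i, d i = N + 1) {i : Fin (N + 1)}
    {φ : Module.Dual Γ(hypersurfacesIntersection d f hf,
        (coordOpen hf i : (hypersurfacesIntersection d f hf).Opens))
      (TopForms (hypersurfacesIntersection d f hf) n (coordOpen hf i))}
    (h : IsGradientForm e (X i ^ m) (coordOpen hf i) φ) (K : Fin n → Fin (N + 1)) :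
    φ (wedgeD (hypersurfacesIntersection d f hf) n (coordOpen hf i)
      fun t ↦ affineCoord hf i (K t)) = dehomogenize hf i (coordMinor e f i K) := by
  refine valueAt_ext fun x hx ↦ ((isUnit_coordHom_X hx).pow (n + 1)).mul_left_cancel ?_
  rw [h.valueAt_coord hx hx fun t ↦ valueAt_affineCoord hx (K t),
    ← valueAt_dehomogenize hx (isHomogeneous_coordMinor e hf i K), map_pow, ← mul_assoc, ← pow_add]
  -- The minor has degree `∑ (d_j - 1)`, and `m + ∑ (d_j - 1) = n + 1`.
  congr 2
  have h3 : ∑ j, (d j - 1) + ∑ _j : Fin k, 1 = ∑ j, d j := by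
    rw [← Finset.sum_add_distrib]
    exact Finset.sum_congr rfl fun j _ ↦ Nat.sub_add_cancel (hd j)
  simp only [Finset.sum_const, Finset.card_univ, Fintype.card_fin, smul_eq_mul, mul_one] at h3
  omega

end CoordinateForms

/-! ### Multipliers of anticanonical sections -/

section AnticanonicalSections

variable {N n k m : ℕ} {d : Fin k → ℕ} {f : Fin k → MvPolynomial (Fin (N + 1)) ℂ}
  {hf : ∀ i, (f i).IsHomogeneous (d i)} {e : Fin (N + 1) ≃ (Fin k ⊕ Unit) ⊕ Fin n}

/-- The minors have no common zero on `X_i ≠ 0`. -/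
theorem eq_zero_of_mul_coordMinor_eq_zero (hn : n + k = N)
    (hJ : ∀ z : Fin (N + 1) → ℂ, z ≠ 0 → (∀ j, eval z (f j) = 0) →
      LinearIndependent ℂ fun j l ↦ eval z (pderiv l (f j)))
    {x : Proj (coneGrading d f hf)} {i : Fin (N + 1)}
    (hx : x ∈ (coordOpen hf i : (hypersurfacesIntersection d f hf).Opens))
    {b : Loc (coneGrading d f hf) x}
    (hb : ∀ K, b * coordHom x (coordMinor e f i K) = 0) : b = 0 := by
  obtain ⟨M, hM⟩ := exists_X_pow_mem_frameDet e hf hn hJ i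
  have h1 : Ideal.span (Set.range f) ⊔ Ideal.span (Set.range (coordMinor e f i)) ≤
      Ideal.comap (coordHom x) (LinearMap.ker
        (LinearMap.toSpanSingleton (Loc (coneGrading d f hf) x) (Loc (coneGrading d f hf) x)
          b)) := by
    refine sup_le (Ideal.span_le.mpr ?_) (Ideal.span_le.mpr ?_)
    · rintro _ ⟨j, rfl⟩
      change coordHom x (f j) • b = 0
      rw [coordHom_eq_zero x (Ideal.subset_span ⟨j, rfl⟩), zero_smul]
    · rintro _ ⟨K, rfl⟩
      change coordHom x (coordMinor e f i K) • b = 0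
      rw [smul_eq_mul, mul_comm, hb]
  have h2 : coordHom x (X i ^ M) * b = 0 := h1 hM
  rw [map_pow] at h2
  exact ((isUnit_coordHom_X hx).pow M).mul_right_eq_zero.mp h2

/-- Over `X_i ≠ 0` every form is a multiple of the form defined by `X_i^m`. -/
theorem exists_eq_smul_gradientForm (hd : ∀ i, 1 ≤ d i) (hn : n + k = N)
    (hm : m + ∑ i, d i = N + 1)
    (hJ : ∀ z : Fin (N + 1) → ℂ, z ≠ 0 → (∀ j, eval z (f j) = 0) →
      LinearIndependent ℂ fun j l ↦ eval z (pderiv l (f j))) {i : Fin (N + 1)}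
    {φ ψ : Module.Dual Γ(hypersurfacesIntersection d f hf,
        (coordOpen hf i : (hypersurfacesIntersection d f hf).Opens))
      (TopForms (hypersurfacesIntersection d f hf) n (coordOpen hf i))}
    (h : IsGradientForm e (X i ^ m) (coordOpen hf i) φ) :
    ∃ b : Γ(hypersurfacesIntersection d f hf,
        (coordOpen hf i : (hypersurfacesIntersection d f hf).Opens)), ψ = b • φ := by
  set δ := fun K : Fin n → Fin (N + 1) ↦ dehomogenize hf i (coordMinor e f i K) with hδ
  have hδtop : Ideal.span (Set.range fun K ↦ δ K ^ (n + 1)) = ⊤ := by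
    have h1 : Ideal.span (Set.range δ) = ⊤ := by
      obtain ⟨M, hM⟩ := exists_X_pow_mem_frameDet e hf hn hJ i
      have h1 : Ideal.span (Set.range f) ⊔ Ideal.span (Set.range (coordMinor e f i)) ≤
          (Ideal.span (Set.range δ)).comap (dehomogenize hf i) := by
        refine sup_le (Ideal.span_le.mpr ?_) (Ideal.span_le.mpr ?_)
        · rintro _ ⟨j, rfl⟩
          change dehomogenize hf i (f j) ∈ Ideal.span (Set.range δ)
          rw [dehomogenize_equation]
          exact zero_mem _
        · rintro _ ⟨K, rfl⟩
          exact Ideal.subset_span ⟨K, rfl⟩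
      have h2 : dehomogenize hf i (X i ^ M) ∈ Ideal.span (Set.range δ) := h1 hM
      rw [map_pow, dehomogenize_X_self, one_pow] at h2
      exact (Ideal.eq_top_iff_one _).mpr h2
    have h2 := Ideal.span_pow_eq_top _ h1 (n + 1)
    rwa [← Set.range_comp] at h2
  have h1 : (1 : Γ(hypersurfacesIntersection d f hf,
      (coordOpen hf i : (hypersurfacesIntersection d f hf).Opens))) ∈
      Ideal.span (Set.range fun K ↦ δ K ^ (n + 1)) := by rw [hδtop]; trivial
  -- Since `φ (dy_K) = δ_K`, proportionality reads `δ_K^(n+1) ψ = δ_K^n ψ(dy_K) φ`. The multiplier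
  -- is the sum of these relations over the partition of unity `∑ c_K δ_K^(n+1) = 1`.
  obtain ⟨c, hc⟩ := Ideal.mem_span_range_iff_exists_fun.mp h1
  refine ⟨∑ K, c K * (δ K ^ n * ψ (wedgeD (hypersurfacesIntersection d f hf) n (coordOpen hf i)
    fun t ↦ affineCoord hf i (K t))), dual_topForms_ext fun u ↦ ?_⟩
  rw [LinearMap.smul_apply, smul_eq_mul, Finset.sum_mul]
  conv_lhs => rw [← one_mul (ψ _), ← hc, Finset.sum_mul]
  refine Finset.sum_congr rfl fun K _ ↦ ?_
  have h2 := AlternatingMap.pow_mul_comm_of_smul_mem (toAlternating ψ) (toAlternating φ)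
    (dehomogenize_coordMinor_smul_mem e i K) fun t ↦ KaehlerDifferential.D ℂ _ (u t)
  rw [toAlternating_D, toAlternating_D, toAlternating_D, toAlternating_D,
    h.apply_affineCoord hd hn hm K] at h2
  change δ K ^ n * (_ * δ K) = δ K ^ n * _ at h2
  rw [mul_assoc, mul_assoc, pow_succ, mul_assoc, mul_comm (δ K), h2]
  ring

/-- Over a basic open subset, sections keep a proportionality. -/
theorem eq_smul_of_basicOpen {X : Scheme} [X.Over (Spec (CommRingCat.of ℂ))]
    {s s' : anticanonicalSections X n} {U W : X.affineOpens} {b : Γ(X, (U : X.Opens))}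
    (h : s.1 U = b • s'.1 U) (hWU : (W : X.Opens) ≤ U) (g : Γ(X, (U : X.Opens)))
    (hW : (W : X.Opens) = X.basicOpen g) :
    s.1 W = X.presheaf.map (homOfLE hWU).op b • s'.1 W :=
  dual_topForms_ext_of_basicOpen hWU g hW fun u ↦ by
    rw [s.2 U W hWU, h, LinearMap.smul_apply, LinearMap.smul_apply, s'.2 U W hWU, smul_eq_mul,
      map_mul, smul_eq_mul]

theorem valueAt_mul_eq_of_smul_eq {U : (hypersurfacesIntersection d f hf).affineOpens}
    {x : Proj (coneGrading d f hf)} (hx : x ∈ (U : (hypersurfacesIntersection d f hf).Opens))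
    {b c : Γ(hypersurfacesIntersection d f hf, (U : (hypersurfacesIntersection d f hf).Opens))}
    {φ ψ : Module.Dual Γ(hypersurfacesIntersection d f hf,
      (U : (hypersurfacesIntersection d f hf).Opens))
      (TopForms (hypersurfacesIntersection d f hf) n U)} (h : b • φ = c • ψ)
    (ω : TopForms (hypersurfacesIntersection d f hf) n U) :
    valueAt hx b * valueAt hx (φ ω) = valueAt hx c * valueAt hx (ψ ω) := by
  rw [← map_mul, ← map_mul]
  exact congrArg (valueAt hx) (DFunLike.congr_fun h ω)

set_option maxHeartbeats 1000000 in
/-- The multipliers `b_i` of a section with respect to the forms defined by `X_i^m` transform like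
the functions `1 / X_i^m`. -/
theorem valueAt_mul_X_pow_eq (hn : n + k = N)
    (hJ : ∀ z : Fin (N + 1) → ℂ, z ≠ 0 → (∀ j, eval z (f j) = 0) →
      LinearIndependent ℂ fun j l ↦ eval z (pderiv l (f j)))
    {i j : Fin (N + 1)} {s s₁ s₂ : anticanonicalSections (hypersurfacesIntersection d f hf) n}
    (h₁ : ∀ U, IsGradientForm e (X i ^ m) U (s₁.1 U))
    (h₂ : ∀ U, IsGradientForm e (X j ^ m) U (s₂.1 U))
    {b : Γ(hypersurfacesIntersection d f hf,
      (coordOpen hf i : (hypersurfacesIntersection d f hf).Opens))}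
    {c : Γ(hypersurfacesIntersection d f hf,
      (coordOpen hf j : (hypersurfacesIntersection d f hf).Opens))}
    (hb : s.1 (coordOpen hf i) = b • s₁.1 (coordOpen hf i))
    (hc : s.1 (coordOpen hf j) = c • s₂.1 (coordOpen hf j)) {x : Proj (coneGrading d f hf)}
    (hi : x ∈ (coordOpen hf i : (hypersurfacesIntersection d f hf).Opens))
    (hj : x ∈ (coordOpen hf j : (hypersurfacesIntersection d f hf).Opens)) :
    valueAt hi b * coordHom x (X i) ^ m = valueAt hj c * coordHom x (X j) ^ m := by
  obtain ⟨W, hx, hWi, hWj, ⟨g, hW⟩, ⟨g', hgg⟩⟩ := exists_affine_basicOpen hi hj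
  have h := (eq_smul_of_basicOpen hb hWi g hW).symm.trans (eq_smul_of_basicOpen hc hWj g' hgg)
  rw [← sub_eq_zero]
  refine eq_zero_of_mul_coordMinor_eq_zero (e := e) hn hJ hi fun K ↦ ?_
  obtain ⟨u, hu⟩ : ∃ u : Fin n → Γ(hypersurfacesIntersection d f hf,
      (W : (hypersurfacesIntersection d f hf).Opens)),
      ∀ t, coordHom x (X i) * valueAt hx (u t) = coordHom x (X (K t)) :=
    ⟨fun t ↦ (hypersurfacesIntersection d f hf).presheaf.map (homOfLE hWi).op
      (affineCoord hf i (K t)), fun t ↦ (congrArg _ (valueAt_res hWi hx _)).trans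
        (valueAt_affineCoord hi (K t))⟩
  have h4 := (h₁ W).valueAt_coord hx hi hu
  have h5 := (h₂ W).valueAt_coord hx hi hu
  rw [map_pow] at h4 h5
  generalize (wedgeD (hypersurfacesIntersection d f hf) n W u) = ω at h4 h5
  have h6 : valueAt hi b * valueAt hx (s₁.1 W ω) = valueAt hj c * valueAt hx (s₂.1 W ω) :=
    valueAt_mul_eq_of_smul_eq hx h ω
  rw [sub_mul, mul_assoc, mul_assoc, ← h4, ← h5, mul_left_comm, mul_left_comm (valueAt hj c),
    h6, sub_self]

/-- A function which multiplies `a` into `a'` multiplies the form defined by `a` into the one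
defined by `a'`. -/
theorem IsGradientForm.smul_eq {a a' : MvPolynomial (Fin (N + 1)) ℂ}
    {U : (hypersurfacesIntersection d f hf).affineOpens}
    {φ φ' : Module.Dual Γ(hypersurfacesIntersection d f hf,
      (U : (hypersurfacesIntersection d f hf).Opens))
      (TopForms (hypersurfacesIntersection d f hf) n U)}
    (h : IsGradientForm e a U φ) (h' : IsGradientForm e a' U φ')
    {b : Γ(hypersurfacesIntersection d f hf, (U : (hypersurfacesIntersection d f hf).Opens))}
    (hb : ∀ x (hx : x ∈ (U : (hypersurfacesIntersection d f hf).Opens)),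
      valueAt hx b * coordHom x a = coordHom (hf := hf) x a') : b • φ = φ' := by
  refine dual_topForms_ext fun u ↦ valueAt_ext fun x hx ↦ ?_
  obtain ⟨i, hi⟩ := exists_mem_basicOpen_coordClass x
  choose W hxW hWU c r s hc hr hs hrs using fun t ↦ exists_valueAt_fraction hx i hi (u t)
  have h1 := h u x hx r s c hr hs (fun t ↦ (hrs t x (hxW t)).2.2) i
  have h2 := h' u x hx r s c hr hs (fun t ↦ (hrs t x (hxW t)).2.2) i
  refine IsUnit.mul_left_cancel ((isUnit_coordHom_X hi).mul
    (IsUnit.prod_univ_iff.mpr fun t ↦ (hrs t x (hxW t)).2.1.pow 2)) ?_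
  rw [LinearMap.smul_apply, smul_eq_mul, map_mul, mul_left_comm, h1, h2, map_mul, map_mul,
    ← mul_assoc, hb x hx]

/-- A polynomial vanishing on the affine cone over `D₊(p)` lies in the ideal after multiplication
by a power of `p`. -/
theorem exists_pow_mul_mem {p a : MvPolynomial (Fin (N + 1)) ℂ} {q c : ℕ}
    (hp : p.IsHomogeneous q) (hq : 0 < q) (ha : a.IsHomogeneous c)
    (h : ∀ x : Proj (coneGrading d f hf), IsUnit (coordHom x p) → coordHom x a = 0) :
    ∃ M, p ^ M * a ∈ Ideal.span (Set.range f) := by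
  obtain ⟨M, hM⟩ := exists_pow_mul_eq_zero (coneGrading d f hf)
    (mk_mem_quotientGrading (hypersurfacesIdeal d f hf) hp) hq
    (mk_mem_quotientGrading (hypersurfacesIdeal d f hf) ha)
    fun x hx ↦ h x ((isUnit_coordHom_iff x p).mpr hx)
  refine ⟨M, ?_⟩
  rw [← map_pow, ← map_mul] at hM
  exact Ideal.Quotient.eq_zero_iff_mem.mp hM

end AnticanonicalSections

/-! ### The space of anticanonical sections -/

section AnticanonicalDimension

variable {N n k m : ℕ} {d : Fin k → ℕ} {f : Fin k → MvPolynomial (Fin (N + 1)) ℂ}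
  {hf : ∀ i, (f i).IsHomogeneous (d i)} {e : Fin (N + 1) ≃ (Fin k ⊕ Unit) ⊕ Fin n}

/-- Functions `b_i` on the open sets `X_i ≠ 0` such that the `b_i X_i^m` agree on the overlaps come
from a homogeneous polynomial of degree `m`. -/
theorem exists_homogeneous_of_sections (hd : ∀ i, 1 ≤ d i) (hn : n + k = N)
    (hm : m + ∑ i, d i = N + 1) (hm1 : 1 ≤ m)
    (hJ : ∀ z : Fin (N + 1) → ℂ, z ≠ 0 → (∀ j, eval z (f j) = 0) →
      LinearIndependent ℂ fun j l ↦ eval z (pderiv l (f j)))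
    (b : ∀ i, Γ(hypersurfacesIntersection d f hf,
      (coordOpen hf i : (hypersurfacesIntersection d f hf).Opens)))
    (hb : ∀ (i j : Fin (N + 1)) (x : Proj (coneGrading d f hf))
      (hi : x ∈ (coordOpen hf i : (hypersurfacesIntersection d f hf).Opens))
      (hj : x ∈ (coordOpen hf j : (hypersurfacesIntersection d f hf).Opens)),
      valueAt hi (b i) * coordHom x (X i) ^ m = valueAt hj (b j) * coordHom x (X j) ^ m) :
    ∃ a : MvPolynomial (Fin (N + 1)) ℂ, a.IsHomogeneous m ∧
      ∀ (i : Fin (N + 1)) (x : Proj (coneGrading d f hf))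
        (hi : x ∈ (coordOpen hf i : (hypersurfacesIntersection d f hf).Opens)),
        valueAt hi (b i) * coordHom x (X i) ^ m = coordHom x a := by
  choose q r hr hrb using fun i ↦ exists_coordOpen_fraction i (b i)
  obtain ⟨E, hE⟩ : ∃ E, ∀ i, q i ≤ E :=
    ⟨Finset.univ.sup q, fun i ↦ Finset.le_sup (Finset.mem_univ i)⟩
  -- The multiplier `b_i X_i^m` is the form `G i` divided by `X_i^E`.
  obtain ⟨G, hG, hGb⟩ : ∃ G : Fin (N + 1) → MvPolynomial (Fin (N + 1)) ℂ,
      (∀ i, (G i).IsHomogeneous (m + E)) ∧ ∀ i (x : Proj (coneGrading d f hf))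
        (hi : x ∈ (coordOpen hf i : (hypersurfacesIntersection d f hf).Opens)),
        coordHom x (X i) ^ E * (valueAt hi (b i) * coordHom x (X i) ^ m) = coordHom x (G i) := by
    refine ⟨fun i ↦ r i * X i ^ (m + (E - q i)), fun i ↦ ?_, fun i x hi ↦ ?_⟩
    · have h1 := (hr i).mul (isHomogeneous_X_pow (R := ℂ) i (m + (E - q i)))
      rwa [show q i + (m + (E - q i)) = m + E by have := hE i; omega] at h1
    · rw [map_mul, map_pow, ← hrb i x hi]
      have h1 : E = q i + (E - q i) := by have := hE i; omega
      conv_lhs => rw [h1]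
      ring
  -- On overlaps the fractions agree only after multiplication by a power of `X_i X_j`; a common
  -- exponent `Q` is absorbed into numerators and denominators.
  have hov : ∀ i j, ∃ M, (X i * X j) ^ M * (G i * X j ^ E - G j * X i ^ E) ∈
      Ideal.span (Set.range f) := by
    intro i j
    refine exists_pow_mul_mem (hf := hf) ((isHomogeneous_X ℂ i).mul (isHomogeneous_X ℂ j))
      (by norm_num) (((hG i).mul (isHomogeneous_X_pow j E)).sub
        ((hG j).mul (isHomogeneous_X_pow i E))) fun x hx ↦ ?_
    rw [map_mul] at hx
    have hi : x ∈ (coordOpen hf i : (hypersurfacesIntersection d f hf).Opens) :=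
      (isUnit_coordHom_iff x (X i)).mp (isUnit_of_mul_isUnit_left hx)
    have hj : x ∈ (coordOpen hf j : (hypersurfacesIntersection d f hf).Opens) :=
      (isUnit_coordHom_iff x (X j)).mp (isUnit_of_mul_isUnit_right hx)
    rw [map_sub, map_mul, map_mul, ← hGb i x hi, ← hGb j x hj, hb i j x hi hj, map_pow, map_pow]
    ring
  choose M hM using hov
  obtain ⟨Q, hQ⟩ : ∃ Q, ∀ i j, M i j ≤ Q := by
    refine ⟨(Finset.univ : Finset (Fin (N + 1) × Fin (N + 1))).sup fun p ↦ M p.1 p.2, fun i j ↦ ?_⟩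
    exact Finset.le_sup (f := fun p : Fin (N + 1) × Fin (N + 1) ↦ M p.1 p.2)
      (Finset.mem_univ (i, j))
  obtain ⟨a, ha, hGa⟩ := exists_homogeneous hf hd hJ hn hm hm1 (E + Q) (fun i ↦ G i * X i ^ Q)
    (fun i ↦ by rw [← add_assoc]; exact (hG i).mul (isHomogeneous_X_pow i Q)) (fun i j ↦ by
      have h1 := Ideal.mul_mem_left _ ((X i * X j) ^ (Q - M i j)) (hM i j)
      rw [← mul_assoc, ← pow_add, Nat.sub_add_cancel (hQ i j)] at h1
      convert h1 using 1
      ring)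
  refine ⟨a, ha, fun i x hi ↦ ((isUnit_coordHom_X hi).pow (E + Q)).mul_left_cancel ?_⟩
  have h1 := coordHom_eq_zero (hf := hf) x (hGa i)
  rw [map_sub, sub_eq_zero, map_mul, map_mul, map_pow, map_pow, ← hGb i x hi] at h1
  rw [mul_comm _ (coordHom x a), ← h1]
  ring

set_option maxHeartbeats 1000000 in
/-- Every section of the anticanonical sheaf is given by a form of degree `i_X`. -/
theorem gradientSection_surjective (hd : ∀ i, 1 ≤ d i) (hn : n + k = N)
    (hm : m + ∑ i, d i = N + 1) (hm1 : 1 ≤ m)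
    (hJ : ∀ z : Fin (N + 1) → ℂ, z ≠ 0 → (∀ j, eval z (f j) = 0) →
      LinearIndependent ℂ fun j l ↦ eval z (pderiv l (f j))) :
    Function.Surjective (gradientSection (hf := hf) e hd hn hm) := by
  intro s
  let p : Fin (N + 1) → homogeneousSubmodule (Fin (N + 1)) ℂ m :=
    fun i ↦ ⟨X i ^ m, isHomogeneous_X_pow i m⟩
  have hp : ∀ i U, IsGradientForm e (X i ^ m) U
    ((gradientSection (hf := hf) e hd hn hm (p i)).1 U) :=
    fun i U ↦ isGradientForm_gradientSection hd hn hm (p i) U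
  -- On `X_i ≠ 0` the section is a multiple `b_i` of the section defined by `X_i^m`.
  choose b hb using fun i ↦ exists_eq_smul_gradientForm (ψ := s.1 (coordOpen hf i)) hd hn hm hJ
    (hp i (coordOpen hf i))
  obtain ⟨a, ha, hba⟩ := exists_homogeneous_of_sections hd hn hm hm1 hJ b fun i j x hi hj ↦
    valueAt_mul_X_pow_eq hn hJ (hp i) (hp j) (hb i) (hb j) hi hj
  refine ⟨⟨a, ha⟩, anticanonicalSections_ext fun i ↦ ?_⟩
  rw [hb i]
  refine ((hp i _).smul_eq (isGradientForm_gradientSection hd hn hm ⟨a, ha⟩ _) fun x hx ↦ ?_).symm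
  rw [map_pow]
  exact hba i x hx

set_option maxHeartbeats 1000000 in
/-- The kernel of `gradientSection` is the degree `i_X` part of the ideal: the minors have no common
zero, so a polynomial defining the zero section vanishes at all points of the intersection, and the
vertex is not an embedded component of the cone. -/
theorem gradientSection_eq_iff (hd : ∀ i, 1 ≤ d i) (hn : n + k = N)
    (hm : m + ∑ i, d i = N + 1)
    (hJ : ∀ z : Fin (N + 1) → ℂ, z ≠ 0 → (∀ j, eval z (f j) = 0) →
      LinearIndependent ℂ fun j l ↦ eval z (pderiv l (f j)))
    (a b : homogeneousSubmodule (Fin (N + 1)) ℂ m) :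
    gradientSection (hf := hf) e hd hn hm a = gradientSection e hd hn hm b ↔
      (a : MvPolynomial (Fin (N + 1)) ℂ) - (b : MvPolynomial (Fin (N + 1)) ℂ) ∈ Ideal.span
        (Set.range f) := by
  constructor
  · intro h
    have h1 : ∀ i, ∃ M, X i ^ M *
      ((a : MvPolynomial (Fin (N + 1)) ℂ) - (b : MvPolynomial (Fin (N + 1)) ℂ)) ∈
        Ideal.span (Set.range f) := by
      intro i
      refine exists_pow_mul_mem (hf := hf) (isHomogeneous_X ℂ i) one_pos (a.2.sub b.2) fun x hx ↦ ?_
      have hi : x ∈ (coordOpen hf i : (hypersurfacesIntersection d f hf).Opens) :=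
        (isUnit_coordHom_iff x (X i)).mp hx
      refine eq_zero_of_mul_coordMinor_eq_zero (e := e) hn hJ hi fun K ↦ ?_
      rw [map_sub, sub_mul,
        ← (isGradientForm_gradientSection hd hn hm a (coordOpen hf i)).valueAt_coord hi hi
          fun t ↦ valueAt_affineCoord hi (K t),
        ← (isGradientForm_gradientSection hd hn hm b (coordOpen hf i)).valueAt_coord hi hi
          fun t ↦ valueAt_affineCoord hi (K t), h, sub_self]
    choose M hM using h1
    refine mem_of_forall_mul_X_pow_mem hf hd hJ hn (Finset.univ.sup M) _ fun j ↦ ?_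
    have hj : M j ≤ Finset.univ.sup M := Finset.le_sup (Finset.mem_univ j)
    have h1 := Ideal.mul_mem_left _ (X j ^ (Finset.univ.sup M - M j)) (hM j)
    rwa [← mul_assoc, ← pow_add, Nat.sub_add_cancel hj, mul_comm] at h1
  · intro h
    refine anticanonicalSections_ext fun i ↦ ?_
    refine (isGradientForm_gradientSection hd hn hm a _).ext
      (isGradientForm_gradientSection hd hn hm b _) fun x _ ↦ ?_
    have h1 := coordHom_eq_zero (hf := hf) x h
    rwa [map_sub, sub_eq_zero] at h1

theorem nonempty_equiv_of_forall_eq_iff {V W W' : Type} [AddCommMonoid V] [AddCommMonoid W]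
    [AddCommMonoid W'] [Module ℂ V] [Module ℂ W] [Module ℂ W'] (g : V →ₗ[ℂ] W) (g' : V →ₗ[ℂ] W')
    (hg : Function.Surjective g) (hg' : Function.Surjective g')
    (h : ∀ a b, g a = g b ↔ g' a = g' b) : Nonempty (W ≃ₗ[ℂ] W') := by
  have h1 : ∀ a, g' (Function.surjInv hg (g a)) = g' a := fun a ↦
    (h _ _).mp (Function.surjInv_eq hg _)
  let l : W →ₗ[ℂ] W' :=
    { toFun := fun w ↦ g' (Function.surjInv hg w)
      map_add' := fun w₁ w₂ ↦ by
        obtain ⟨a, rfl⟩ := hg w₁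
        obtain ⟨b, rfl⟩ := hg w₂
        rw [← map_add, h1, h1, h1, map_add]
      map_smul' := fun c w ↦ by
        obtain ⟨a, rfl⟩ := hg w
        rw [← map_smul, h1, h1, map_smul, RingHom.id_apply] }
  refine ⟨LinearEquiv.ofBijective l ⟨fun w₁ w₂ hw ↦ ?_, fun w' ↦ ?_⟩⟩
  · obtain ⟨a, rfl⟩ := hg w₁
    obtain ⟨b, rfl⟩ := hg w₂
    exact (h _ _).mpr ((h1 a).symm.trans (hw.trans (h1 b)))
  · obtain ⟨a, rfl⟩ := hg' w'
    exact ⟨g a, h1 a⟩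

variable (hf) in
set_option maxHeartbeats 1000000 in
/-- The sections of the anticanonical sheaf form a space isomorphic to the part of degree `i_X` of
the homogeneous coordinate ring. -/
theorem nonempty_quotientPart_equiv_anticanonicalSections (hd : ∀ i, 1 ≤ d i) (hn : n + k = N)
    (hm : m + ∑ i, d i = N + 1) (hm1 : 1 ≤ m)
    (hJ : ∀ z : Fin (N + 1) → ℂ, z ≠ 0 → (∀ j, eval z (f j) = 0) →
      LinearIndependent ℂ fun j l ↦ eval z (pderiv l (f j))) :
    Nonempty (quotientPart (homogeneousSubmodule (Fin (N + 1)) ℂ) (Ideal.span (Set.range f)) m ≃ₗ[ℂ]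
      anticanonicalSections (hypersurfacesIntersection d f hf) n) := by
  have hcard : Fintype.card (Fin (N + 1)) = Fintype.card ((Fin k ⊕ Unit) ⊕ Fin n) := by
    simp; omega
  let e := Fintype.equivOfCardEq hcard
  refine nonempty_equiv_of_forall_eq_iff ((Ideal.Quotient.mkₐ ℂ
    (Ideal.span (Set.range f))).toLinearMap.submoduleMap (homogeneousSubmodule (Fin (N + 1)) ℂ m))
    (gradientSection (hf := hf) e hd hn hm) (LinearMap.submoduleMap_surjective _ _)
    (gradientSection_surjective hd hn hm hm1 hJ) fun a b ↦ ?_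
  rw [gradientSection_eq_iff hd hn hm hJ, ← Ideal.Quotient.eq, Subtype.ext_iff]
  exact Iff.rfl

end AnticanonicalDimension

/-! ### Boundary lattice points of dual polytopes -/

section DualPolytopes

variable {σ : Type} [Fintype σ]

theorem mem_dualPolytope_convexHull (S : Set (σ → ℤ)) (x : σ → ℝ) :
    x ∈ dualPolytope (convexHull ℝ (latticePoint '' S)) ↔
      ∀ b ∈ S, -1 ≤ ∑ v, x v * latticePoint b v := by
  constructor
  · exact fun h b hb ↦ h _ (subset_convexHull ℝ _ ⟨b, hb, rfl⟩)
  · intro h y hy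
    have hconv : Convex ℝ {y : σ → ℝ | -1 ≤ ∑ v, x v * y v} :=
      convex_halfSpace_ge ⟨fun a b ↦ by simp [mul_add, Finset.sum_add_distrib],
        fun c a ↦ by simp [Finset.mul_sum, mul_left_comm]⟩ _
    refine convexHull_min ?_ hconv hy
    rintro _ ⟨b, hb, rfl⟩
    exact h b hb

theorem sum_latticePoint_mul (a b : σ → ℤ) :
    ∑ v, latticePoint a v * latticePoint b v = ((a ⬝ᵥ b : ℤ) : ℝ) := by
  simp [latticePoint, dotProduct]

/-- If `0` is the only lattice point at which all elements of the finite set `S` are nonnegative,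
the boundary lattice points of the dual of the convex hull of `S` are its nonzero lattice
points. -/
theorem boundaryLatticePoints_dualPolytope {S : Set (σ → ℤ)} (hS : S.Finite)
    (h0 : ∀ a : σ → ℤ, (∀ b ∈ S, 0 ≤ a ⬝ᵥ b) → a = 0) :
    boundaryLatticePoints (dualPolytope (convexHull ℝ (latticePoint '' S))) =
      {a | ∀ b ∈ S, -1 ≤ a ⬝ᵥ b} \ {0} := by
  set P := dualPolytope (convexHull ℝ (latticePoint '' S)) with hP
  have hmem : ∀ a : σ → ℤ, latticePoint a ∈ P ↔ ∀ b ∈ S, -1 ≤ a ⬝ᵥ b := fun a ↦ by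
    rw [hP, mem_dualPolytope_convexHull]
    refine forall₂_congr fun b _ ↦ ?_
    rw [sum_latticePoint_mul]
    exact_mod_cast Iff.rfl
  have hclosed : IsClosed P := by
    have : P = ⋂ b ∈ S, {x | -1 ≤ ∑ v, x v * latticePoint b v} := by
      ext x; simp [hP, mem_dualPolytope_convexHull]
    rw [this]
    exact isClosed_biInter fun b _ ↦ isClosed_le continuous_const (by fun_prop)
  ext a
  rw [boundaryLatticePoints, Set.mem_ofPred_eq, hclosed.frontier_eq, Set.mem_sdiff, hmem,
    Set.mem_sdiff, Set.mem_ofPred_eq, Set.mem_singleton_iff]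
  refine and_congr_right fun ha ↦ not_congr ⟨fun hint ↦ ?_, ?_⟩
  · refine h0 a fun b hb ↦ ?_
    by_contra hneg
    have hb1 : a ⬝ᵥ b = -1 := le_antisymm (by omega) (ha b hb)
    -- Moving from `a` away from the origin leaves the half space defined by `b`.
    have hcont : Filter.Tendsto (fun t : ℝ ↦ t • latticePoint a) (nhds 1)
      (nhds (latticePoint a)) := by
      have : Continuous fun t : ℝ ↦ t • latticePoint a := by fun_prop
      simpa using this.tendsto 1
    have h1 : ∀ᶠ t : ℝ in nhds 1, t • latticePoint a ∈ P :=
      hcont.eventually (mem_interior_iff_mem_nhds.mp hint)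
    have h2 : ∃ᶠ t : ℝ in nhds 1, 1 < t :=
      ((eventually_mem_nhdsWithin (a := (1 : ℝ)) (s := Set.Ioi 1)).frequently).filter_mono
        nhdsWithin_le_nhds
    obtain ⟨t, ht1, ht⟩ := (h2.and_eventually h1).exists
    have h3 := (mem_dualPolytope_convexHull S _).mp ht b hb
    simp only [Pi.smul_apply, smul_eq_mul, mul_assoc] at h3
    rw [← Finset.mul_sum, sum_latticePoint_mul, hb1] at h3
    push_cast at h3
    linarith
  · rintro rfl
    rw [mem_interior]
    -- The origin satisfies all the finitely many inequalities strictly.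
    refine ⟨⋂ b ∈ S, {x | -1 < ∑ v, x v * latticePoint b v}, fun x hx ↦ ?_, ?_, ?_⟩
    · rw [hP, mem_dualPolytope_convexHull]
      intro b hb
      exact (Set.mem_iInter₂.mp hx b hb).le
    · exact hS.isOpen_biInter fun b _ ↦ isOpen_lt continuous_const (by fun_prop)
    · refine Set.mem_iInter₂.mpr fun b _ ↦ ?_
      simp [latticePoint]

end DualPolytopes

/-! ### Tropical values of Laurent polynomials -/

section TropicalValues

open scoped ComplexOrder

variable {σ : Type} [Fintype σ]

/-- The coefficients of the Laurent polynomial `q` are nonnegative, and `c` is the minimum over its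
exponents of the linear form `p`, i.e. the value at `p` of the tropicalization of `q`. -/
structure IsTropicalValue (p : σ → ℤ) (q : AddMonoidAlgebra ℂ (σ → ℤ)) (c : ℤ) : Prop where
  nonneg : ∀ a, 0 ≤ q.coeff a
  le : ∀ a, q.coeff a ≠ 0 → c ≤ p ⬝ᵥ a
  exists_eq : ∃ a, q.coeff a ≠ 0 ∧ p ⬝ᵥ a = c

theorem isTropicalValue_single (p a : σ → ℤ) :
    IsTropicalValue p (AddMonoidAlgebra.single a 1) (p ⬝ᵥ a) where
  nonneg b := by
    classical
    rw [AddMonoidAlgebra.coeff_single, Finsupp.single_apply]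
    split_ifs <;> simp
  le b hb := by
    classical
    rw [AddMonoidAlgebra.coeff_single, Finsupp.single_apply] at hb
    by_cases h : a = b
    · rw [h]
    · simp [h] at hb
  exists_eq := ⟨a, by simp, rfl⟩

theorem isTropicalValue_one (p : σ → ℤ) : IsTropicalValue p 1 0 := by
  simpa [AddMonoidAlgebra.one_def] using isTropicalValue_single p 0

/-- As the coefficients are nonnegative, no cancellation occurs in products. -/
theorem IsTropicalValue.mul {p : σ → ℤ} {q q' : AddMonoidAlgebra ℂ (σ → ℤ)} {c c' : ℤ}
    (h : IsTropicalValue p q c) (h' : IsTropicalValue p q' c') :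
    IsTropicalValue p (q * q') (c + c') := by
  classical
  have hnn : ∀ a a₁ a₂, 0 ≤ if a₁ + a₂ = a then q.coeff a₁ * q'.coeff a₂ else 0 := fun a a₁ a₂ ↦ by
    split_ifs
    · exact mul_nonneg (h.nonneg _) (h'.nonneg _)
    · exact le_rfl
  refine ⟨fun a ↦ ?_, fun a ha ↦ ?_, ?_⟩
  · rw [AddMonoidAlgebra.coeff_mul]
    exact Finset.sum_nonneg fun _ _ ↦ Finset.sum_nonneg fun _ _ ↦ hnn _ _ _
  · rw [AddMonoidAlgebra.coeff_mul] at ha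
    obtain ⟨a₁, h₁, ha⟩ := Finset.exists_ne_zero_of_sum_ne_zero ha
    obtain ⟨a₂, h₂, ha⟩ := Finset.exists_ne_zero_of_sum_ne_zero ha
    have h3 : a₁ + a₂ = a := by
      by_contra h3
      exact ha (if_neg h3)
    rw [← h3, dotProduct_add]
    exact add_le_add (h.le _ (Finsupp.mem_support_iff.mp h₁))
      (h'.le _ (Finsupp.mem_support_iff.mp h₂))
  · obtain ⟨a₁, h₁, rfl⟩ := h.exists_eq
    obtain ⟨a₂, h₂, rfl⟩ := h'.exists_eq
    refine ⟨a₁ + a₂, ?_, dotProduct_add _ _ _⟩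
    have hpos : 0 < q.coeff a₁ * q'.coeff a₂ :=
      mul_pos ((h.nonneg _).lt_of_ne h₁.symm) ((h'.nonneg _).lt_of_ne h₂.symm)
    rw [AddMonoidAlgebra.coeff_mul]
    refine (hpos.trans_le ?_).ne'
    refine le_trans ?_ (Finset.single_le_sum (f := fun b₁ ↦ q'.coeff.sum fun b₂ r₂ ↦
      if b₁ + b₂ = a₁ + a₂ then q.coeff b₁ * r₂ else 0)
      (fun _ _ ↦ Finset.sum_nonneg fun _ _ ↦ hnn _ _ _) (Finsupp.mem_support_iff.mpr h₁))
    refine le_trans ?_ (Finset.single_le_sum (f := fun b₂ ↦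
      if a₁ + b₂ = a₁ + a₂ then q.coeff a₁ * q'.coeff b₂ else 0)
      (fun _ _ ↦ hnn _ _ _) (Finsupp.mem_support_iff.mpr h₂))
    simp

/-- As the coefficients are nonnegative, no cancellation occurs in sums. -/
theorem IsTropicalValue.add {p : σ → ℤ} {q q' : AddMonoidAlgebra ℂ (σ → ℤ)} {c c' : ℤ}
    (h : IsTropicalValue p q c) (h' : IsTropicalValue p q' c') :
    IsTropicalValue p (q + q') (min c c') := by
  have key : ∀ a, (q + q').coeff a ≠ 0 ↔ q.coeff a ≠ 0 ∨ q'.coeff a ≠ 0 := fun a ↦ by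
    rw [AddMonoidAlgebra.coeff_add, Finsupp.add_apply, Ne,
      add_eq_zero_iff_of_nonneg (h.nonneg a) (h'.nonneg a)]
    tauto
  refine ⟨fun a ↦ ?_, fun a ha ↦ ?_, ?_⟩
  · rw [AddMonoidAlgebra.coeff_add, Finsupp.add_apply]
    exact add_nonneg (h.nonneg a) (h'.nonneg a)
  · rcases (key a).mp ha with ha | ha
    · exact (min_le_left _ _).trans (h.le a ha)
    · exact (min_le_right _ _).trans (h'.le a ha)
  · rcases min_choice c c' with hc | hc <;> rw [hc]
    · obtain ⟨a, ha, rfl⟩ := h.exists_eq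
      exact ⟨a, (key a).mpr (.inl ha), rfl⟩
    · obtain ⟨a, ha, rfl⟩ := h'.exists_eq
      exact ⟨a, (key a).mpr (.inr ha), rfl⟩

theorem IsTropicalValue.prod {p : σ → ℤ} {ι : Type} (s : Finset ι)
    {q : ι → AddMonoidAlgebra ℂ (σ → ℤ)} {c : ι → ℤ} (h : ∀ i ∈ s, IsTropicalValue p (q i) (c i)) :
    IsTropicalValue p (∏ i ∈ s, q i) (∑ i ∈ s, c i) := by
  classical
  induction s using Finset.induction_on with
  | empty => simpa using isTropicalValue_one p
  | insert i s hi ih =>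
    rw [Finset.prod_insert hi, Finset.sum_insert hi]
    exact (h i (Finset.mem_insert_self _ _)).mul
      (ih fun j hj ↦ h j (Finset.mem_insert_of_mem hj))

theorem IsTropicalValue.pow {p : σ → ℤ} {q : AddMonoidAlgebra ℂ (σ → ℤ)} {c : ℤ}
    (h : IsTropicalValue p q c) (t : ℕ) : IsTropicalValue p (q ^ t) (t * c) := by
  simpa using IsTropicalValue.prod (Finset.range t) (q := fun _ ↦ q) (c := fun _ ↦ c) fun _ _ ↦ h

theorem IsTropicalValue.sum {p : σ → ℤ} {ι : Type} {s : Finset ι} (hs : s.Nonempty)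
    {q : ι → AddMonoidAlgebra ℂ (σ → ℤ)} {c : ι → ℤ} (h : ∀ i ∈ s, IsTropicalValue p (q i) (c i)) :
    IsTropicalValue p (∑ i ∈ s, q i) (s.inf' hs c) := by
  classical
  induction hs using Finset.Nonempty.cons_induction with
  | singleton i => simpa using h i (by simp)
  | cons i s hi hs ih =>
    rw [Finset.sum_cons, Finset.inf'_cons hs]
    exact (h i (by simp)).add (ih fun j hj ↦ h j (by simp [hj]))

theorem IsTropicalValue.forall_le_iff {p : σ → ℤ} {q : AddMonoidAlgebra ℂ (σ → ℤ)} {c : ℤ}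
    (h : IsTropicalValue p q c) (t : ℤ) :
    (∀ b ∈ {a | q.coeff a ≠ 0}, t ≤ p ⬝ᵥ b) ↔ t ≤ c := by
  refine ⟨fun ht ↦ ?_, fun ht b hb ↦ ht.trans (h.le b hb)⟩
  obtain ⟨a, ha, rfl⟩ := h.exists_eq
  exact ht a ha

end TropicalValues

/-! ### Lattice points of the dual of Givental's polytope -/

section GiventalPolytope

variable {k : ℕ} {d : Fin k → ℕ} {m : ℕ}

theorem isTropicalValue_laurentVar {σ : Type} [Fintype σ] [DecidableEq σ] (p : σ → ℤ) (v : σ) :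
    IsTropicalValue p (laurentVar v) (p v) := by
  simpa [laurentVar] using isTropicalValue_single p (Pi.single v 1)

theorem isTropicalValue_laurentVarInv {σ : Type} [Fintype σ] [DecidableEq σ] (p : σ → ℤ) (v : σ) :
    IsTropicalValue p (laurentVarInv v) (-p v) := by
  simpa [laurentVarInv] using isTropicalValue_single p (Pi.single v (-1))

/-- The coordinates `x_{i,j}` of a lattice point, together with the coordinate `0` for the constant
term `1` of the `i`-th factor of Givental's polynomial. -/
def blockCoord (p : GiventalVar d m → ℤ) (i : Fin k) (o : Option (Fin (d i - 1))) : ℤ :=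
  o.elim 0 fun j ↦ p (.inl ⟨i, j⟩)

/-- The minimum of `0` and the coordinates `x_{i,j}`. -/
def blockMin (p : GiventalVar d m → ℤ) (i : Fin k) : ℤ :=
  Finset.univ.inf' Finset.univ_nonempty (blockCoord p i)

theorem blockMin_le (p : GiventalVar d m → ℤ) (i : Fin k) (o : Option (Fin (d i - 1))) :
    blockMin p i ≤ blockCoord p i o :=
  Finset.inf'_le _ (Finset.mem_univ o)

/-- The value at a lattice point of the tropicalization of the first summand of Givental's
polynomial. -/
def mainValue (p : GiventalVar d m → ℤ) : ℤ :=
  ∑ i, ∑ o, (blockMin p i - blockCoord p i o) - ∑ s, p (.inr s)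

/-- The tropicalization of Givental's polynomial is the minimum of `mainValue` and the coordinates
`y_s`. -/
theorem isTropicalValue_giventalPolynomial (hd : ∀ i, 1 ≤ d i) (p : GiventalVar d m → ℤ) :
    IsTropicalValue p (giventalPolynomial d m)
      (Finset.univ.inf' Finset.univ_nonempty
        fun o : Option (Fin (m - 1)) ↦ o.elim (mainValue p) fun s ↦ p (.inr s)) := by
  have hfactor : ∀ i, IsTropicalValue p ((∑ j, laurentVar (.inl ⟨i, j⟩)) + 1) (blockMin p i) := by
    intro i
    have h := IsTropicalValue.sum (p := p) (s := Finset.univ) Finset.univ_nonempty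
      (q := fun o : Option (Fin (d i - 1)) ↦ o.elim 1 fun j ↦ laurentVar (.inl ⟨i, j⟩))
      (c := blockCoord p i) fun o _ ↦ by
        cases o with
        | none => exact isTropicalValue_one p
        | some j => exact isTropicalValue_laurentVar p _
    rw [Fintype.sum_option, add_comm] at h
    exact h
  have hmain : IsTropicalValue p ((∏ i, ((∑ j, laurentVar (.inl ⟨i, j⟩)) + 1) ^ d i) *
      ((∏ i, ∏ j, laurentVarInv (.inl ⟨i, j⟩)) * ∏ s, laurentVarInv (.inr s))) (mainValue p) := by
    have h := (IsTropicalValue.prod Finset.univ fun i _ ↦ (hfactor i).pow (d i)).mul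
      ((IsTropicalValue.prod Finset.univ fun i _ ↦ IsTropicalValue.prod Finset.univ
        fun j _ ↦ isTropicalValue_laurentVarInv p (.inl ⟨i, j⟩)).mul
        (IsTropicalValue.prod Finset.univ fun s _ ↦ isTropicalValue_laurentVarInv p (.inr s)))
    have hval : mainValue p = ∑ i, (d i : ℤ) * blockMin p i +
        (∑ i, ∑ j : Fin (d i - 1), -p (.inl ⟨i, j⟩) + ∑ s, -p (.inr s)) := by
      rw [mainValue, ← add_assoc, ← Finset.sum_add_distrib, Finset.sum_neg_distrib, sub_eq_add_neg]
      congr 1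
      refine Finset.sum_congr rfl fun i _ ↦ ?_
      rw [Finset.sum_sub_distrib, Finset.sum_const, Fintype.sum_option, Finset.card_univ,
        Fintype.card_option, Fintype.card_fin, Nat.sub_add_cancel (hd i), Finset.sum_neg_distrib]
      simp [blockCoord, sub_eq_add_neg]
    rw [hval]
    exact h
  have h := IsTropicalValue.sum (p := p) (s := Finset.univ) Finset.univ_nonempty
    (q := fun o : Option (Fin (m - 1)) ↦ o.elim
      ((∏ i, ((∑ j, laurentVar (.inl ⟨i, j⟩)) + 1) ^ d i) *
      ((∏ i, ∏ j, laurentVarInv (.inl ⟨i, j⟩)) * ∏ s, laurentVarInv (.inr s)))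
      fun s ↦ laurentVar (.inr s))
    (c := fun o ↦ o.elim (mainValue p) fun s ↦ p (.inr s)) fun o _ ↦ by
      cases o with
      | none => exact hmain
      | some s => exact isTropicalValue_laurentVar p _
  rw [Fintype.sum_option] at h
  exact h

/-- The inequalities defining the dual polytope, at lattice points. -/
theorem forall_le_dotProduct_giventalPolynomial_iff (hd : ∀ i, 1 ≤ d i) (p : GiventalVar d m → ℤ)
    (t : ℤ) : (∀ b ∈ {a | (giventalPolynomial d m).coeff a ≠ 0}, t ≤ p ⬝ᵥ b) ↔
      t ≤ mainValue p ∧ ∀ s, t ≤ p (.inr s) := by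
  rw [(isTropicalValue_giventalPolynomial hd p).forall_le_iff, Finset.le_inf'_iff]
  simp [Option.forall]

/-- The origin is the only lattice point in the interior of the dual polytope. -/
theorem eq_zero_of_nonneg_mainValue {p : GiventalVar d m → ℤ} (h : 0 ≤ mainValue p)
    (hs : ∀ s, 0 ≤ p (.inr s)) : p = 0 := by
  -- All the terms of this sum are nonnegative, so they vanish.
  have h1 : ∑ i, ∑ o, (blockCoord p i o - blockMin p i) + ∑ s, p (.inr s) ≤ 0 := by
    have : ∑ i, ∑ o, (blockCoord p i o - blockMin p i) =
        -∑ i, ∑ o, (blockMin p i - blockCoord p i o) := by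
      simp only [← Finset.sum_neg_distrib, neg_sub]
    rw [mainValue] at h
    linarith
  have h2 : ∀ i o, 0 ≤ blockCoord p i o - blockMin p i :=
    fun i o ↦ sub_nonneg.mpr (blockMin_le p i o)
  have h3 : 0 ≤ ∑ i, ∑ o, (blockCoord p i o - blockMin p i) :=
    Finset.sum_nonneg fun i _ ↦ Finset.sum_nonneg fun o _ ↦ h2 i o
  have h4 : 0 ≤ ∑ s, p (.inr s) := Finset.sum_nonneg fun s _ ↦ hs s
  have h5 : ∑ i, ∑ o, (blockCoord p i o - blockMin p i) = 0 := by linarith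
  have h6 : ∑ s, p (.inr s) = 0 := by linarith
  have h7 : ∀ i o, blockCoord p i o = blockMin p i := fun i o ↦ by
    have := (Finset.sum_eq_zero_iff_of_nonneg fun i _ ↦
      Finset.sum_nonneg fun o _ ↦ h2 i o).mp h5 i (Finset.mem_univ _)
    have := (Finset.sum_eq_zero_iff_of_nonneg fun o _ ↦ h2 i o).mp this o (Finset.mem_univ _)
    linarith
  funext v
  rcases v with ⟨i, j⟩ | s
  · exact (h7 i (some j)).trans (h7 i none).symm
  · exact (Finset.sum_eq_zero_iff_of_nonneg fun s _ ↦ hs s).mp h6 s (Finset.mem_univ _)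

/-- The variables of the monomials corresponding to lattice points: one more than in each block
of variables of Givental's polynomial. -/
abbrev BlockVar (d : Fin k → ℕ) (m : ℕ) : Type :=
  (Σ i : Fin k, Option (Fin (d i - 1))) ⊕ Option (Fin (m - 1))

/-- The block of the `d_i` variables with index `i`. -/
def block (d : Fin k → ℕ) (m : ℕ) (i : Fin k) : Finset (BlockVar d m) :=
  Finset.univ.map ⟨fun o ↦ .inl ⟨i, o⟩, fun o o' h ↦ by simpa using h⟩

theorem mem_block {i : Fin k} {v : BlockVar d m} : v ∈ block d m i ↔ ∃ o, .inl ⟨i, o⟩ = v := by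
  rw [block, Finset.mem_map]
  simp only [Finset.mem_univ, true_and]
  rfl

theorem card_block (hd : ∀ i, 1 ≤ d i) (i : Fin k) : (block d m i).card = d i := by
  rw [block, Finset.card_map, Finset.card_univ, Fintype.card_option, Fintype.card_fin,
    Nat.sub_add_cancel (hd i)]

theorem pairwise_disjoint_block :
    Pairwise fun i j ↦ Disjoint (block d m i) (block d m j) := by
  intro i j hij
  rw [Finset.disjoint_left]
  intro v hi hj
  obtain ⟨o, rfl⟩ := mem_block.mp hi
  obtain ⟨o', h⟩ := mem_block.mp hj
  simp only [Sum.inl.injEq, Sigma.mk.injEq] at h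
  exact hij h.1.symm

theorem card_blockVar (hd : ∀ i, 1 ≤ d i) (hm : 1 ≤ m) :
    Fintype.card (BlockVar d m) = m + ∑ i, d i := by
  simp only [BlockVar, Fintype.card_sum, Fintype.card_sigma, Fintype.card_option, Fintype.card_fin,
    Nat.sub_add_cancel hm, fun i ↦ Nat.sub_add_cancel (hd i)]
  exact add_comm _ _

/-- The lattice point of a monomial: the exponents relative to the additional variable of each
block, and the exponents of the last variables diminished by `1`. -/
def pointOfMonomial (w : BlockVar d m →₀ ℕ) : GiventalVar d m → ℤ :=
  Sum.elim (fun v ↦ (w (.inl ⟨v.1, some v.2⟩) : ℤ) - w (.inl ⟨v.1, none⟩))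
    fun s ↦ (w (.inr (some s)) : ℤ) - 1

theorem blockCoord_pointOfMonomial (w : BlockVar d m →₀ ℕ) (i : Fin k)
    (o : Option (Fin (d i - 1))) :
    blockCoord (pointOfMonomial w) i o = (w (.inl ⟨i, o⟩) : ℤ) - w (.inl ⟨i, none⟩) := by
  cases o <;> simp [blockCoord, pointOfMonomial]

theorem blockMin_pointOfMonomial {w : BlockVar d m →₀ ℕ} {i : Fin k}
    (hw : ∃ l ∈ block d m i, w l = 0) :
    blockMin (pointOfMonomial w) i = -(w (.inl ⟨i, none⟩) : ℤ) := by
  refine le_antisymm ?_ ?_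
  · obtain ⟨_, hl, hw⟩ := hw
    obtain ⟨o, rfl⟩ := mem_block.mp hl
    refine (blockMin_le _ i o).trans ?_
    rw [blockCoord_pointOfMonomial, hw]
    simp
  · refine Finset.le_inf' _ _ fun o _ ↦ ?_
    rw [blockCoord_pointOfMonomial]
    simp

theorem degree_blockVar (w : BlockVar d m →₀ ℕ) : w.degree =
    ∑ i, ∑ o, w (.inl ⟨i, o⟩) + (w (.inr none) + ∑ s, w (.inr (some s))) := by
  rw [Finsupp.degree_eq_sum, Fintype.sum_sum_type, Fintype.sum_sigma, Fintype.sum_option]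

/-- At the lattice point of a monomial, the tropicalization of the first summand is determined by
the exponent of the one variable without counterpart in Givental's polynomial. -/
theorem mainValue_pointOfMonomial (hm : 1 ≤ m) {w : BlockVar d m →₀ ℕ}
    (hw : w ∈ avoidingMonomials (block d m) m k) :
    mainValue (pointOfMonomial w) = (w (.inr none) : ℤ) - 1 := by
  obtain ⟨hdeg, hw⟩ := hw
  rw [degree_blockVar] at hdeg
  have h1 : ∀ i o, blockMin (pointOfMonomial w) i - blockCoord (pointOfMonomial w) i o =
      -(w (.inl ⟨i, o⟩) : ℤ) := fun i o ↦ by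
    rw [blockMin_pointOfMonomial (hw i i.2), blockCoord_pointOfMonomial]
    ring
  simp only [mainValue, h1, Finset.sum_neg_distrib]
  simp only [pointOfMonomial, Sum.elim_inr, Finset.sum_sub_distrib, Finset.sum_const,
    Finset.card_univ, Fintype.card_fin, nsmul_eq_mul, mul_one]
  have h2 := congrArg (Nat.cast : ℕ → ℤ) hdeg
  push_cast at h2
  rw [Nat.cast_sub hm]
  push_cast
  linarith

/-- Lattice points of the dual polytope correspond to monomials of degree `m` which are not
divisible by the product of all variables of a block. -/
theorem bijOn_pointOfMonomial (hm : 1 ≤ m) :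
    Set.BijOn pointOfMonomial (avoidingMonomials (block d m) m k)
      {p : GiventalVar d m → ℤ | -1 ≤ mainValue p ∧ ∀ s, -1 ≤ p (.inr s)} := by
  refine ⟨fun w hw ↦ ⟨?_, fun s ↦ ?_⟩, fun w hw w' hw' h ↦ ?_, fun p hp ↦ ?_⟩
  · rw [mainValue_pointOfMonomial hm hw]
    omega
  · simp only [pointOfMonomial, Sum.elim_inr]
    omega
  · have h1 : ∀ i, (w (.inl ⟨i, none⟩) : ℤ) = w' (.inl ⟨i, none⟩) := fun i ↦ by
      have h1 := blockMin_pointOfMonomial (hw.2 i i.2)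
      rw [h, blockMin_pointOfMonomial (hw'.2 i i.2)] at h1
      linarith
    ext v
    rcases v with ⟨i, o⟩ | o
    · have h2 := blockCoord_pointOfMonomial w i o
      rw [h, blockCoord_pointOfMonomial, h1] at h2
      omega
    · cases o with
      | none =>
        have h2 := mainValue_pointOfMonomial hm hw
        rw [h, mainValue_pointOfMonomial hm hw'] at h2
        omega
      | some s =>
        have h2 := congrFun h (.inr s)
        simp only [pointOfMonomial, Sum.elim_inr] at h2
        omega
  · obtain ⟨hp1, hp2⟩ := hp
    -- The exponents in a block are the coordinates normalized to have minimum zero; the exponent of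
    -- the last variable is determined by the degree.
    let w : BlockVar d m →₀ ℕ := Finsupp.equivFunOnFinite.symm (Sum.elim
      (fun v ↦ (blockCoord p v.1 v.2 - blockMin p v.1).toNat)
      fun o ↦ (o.elim (mainValue p) (fun s ↦ p (.inr s)) + 1).toNat)
    have hwl : ∀ i o, (w (.inl ⟨i, o⟩) : ℤ) = blockCoord p i o - blockMin p i := fun i o ↦
      Int.toNat_of_nonneg (sub_nonneg.mpr (blockMin_le p i o))
    have hws : ∀ s, (w (.inr (some s)) : ℤ) = p (.inr s) + 1 := fun s ↦
      Int.toNat_of_nonneg (by have := hp2 s; change 0 ≤ p (.inr s) + 1; omega)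
    have hwn : (w (.inr none) : ℤ) = mainValue p + 1 :=
      Int.toNat_of_nonneg (by change 0 ≤ mainValue p + 1; omega)
    refine ⟨w, ⟨?_, fun i _ ↦ ?_⟩, ?_⟩
    · zify
      rw [degree_blockVar]
      push_cast
      simp only [hwl, hws, hwn, Finset.sum_add_distrib, Finset.sum_const, Finset.card_univ,
        Fintype.card_fin, nsmul_eq_mul, mul_one]
      rw [Nat.cast_sub hm, mainValue]
      have : ∑ i, ∑ o, (blockCoord p i o - blockMin p i) =
          -∑ i, ∑ o, (blockMin p i - blockCoord p i o) := by
        simp only [← Finset.sum_neg_distrib, neg_sub]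
      rw [this]
      push_cast
      ring
    · obtain ⟨o, -, ho⟩ := Finset.exists_mem_eq_inf' (s := Finset.univ) Finset.univ_nonempty
        (blockCoord p i)
      refine ⟨.inl ⟨i, o⟩, mem_block.mpr ⟨o, rfl⟩, ?_⟩
      have h1 := hwl i o
      rw [blockMin, ho, sub_self] at h1
      exact_mod_cast h1
    · funext v
      rcases v with ⟨i, j⟩ | s
      · simp only [pointOfMonomial, Sum.elim_inl, hwl]
        simp [blockCoord]
      · simp only [pointOfMonomial, Sum.elim_inr, hws]
        ring

/-- The number of boundary lattice points of the dual polytope is one less than the number of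
monomials. -/
theorem ncard_boundaryLatticePoints_giventalPolynomial (hd : ∀ i, 1 ≤ d i) (hm : 1 ≤ m) :
    (boundaryLatticePoints (dualPolytope (newtonPolytope (giventalPolynomial d m)))).Finite ∧
    (boundaryLatticePoints (dualPolytope (newtonPolytope (giventalPolynomial d m)))).ncard + 1 =
      (avoidingMonomials (block d m) m k).ncard := by
  have hbij := bijOn_pointOfMonomial (d := d) hm
  set L := {p : GiventalVar d m → ℤ | -1 ≤ mainValue p ∧ ∀ s, -1 ≤ p (.inr s)} with hL
  have hfin : L.Finite := by
    rw [← hbij.image_eq]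
    exact (avoidingMonomials_finite _ _ _).image _
  have h0 : (0 : GiventalVar d m → ℤ) ∈ L := by
    rw [hL, Set.mem_ofPred_eq, ← forall_le_dotProduct_giventalPolynomial_iff hd]
    intro b _
    simp
  have hbd : boundaryLatticePoints (dualPolytope (newtonPolytope (giventalPolynomial d m))) =
      L \ {0} := by
    rw [newtonPolytope, boundaryLatticePoints_dualPolytope]
    · congr 1
      ext p
      exact forall_le_dotProduct_giventalPolynomial_iff hd p (-1)
    · exact ((giventalPolynomial d m).coeff.support.finite_toSet).subset fun a ha ↦
        Finsupp.mem_support_iff.mpr ha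
    · intro p hp
      have h1 := (forall_le_dotProduct_giventalPolynomial_iff hd p 0).mp hp
      exact eq_zero_of_nonneg_mainValue h1.1 h1.2
  rw [hbd]
  refine ⟨hfin.subset Set.sdiff_subset, ?_⟩
  rw [Set.ncard_sdiff_singleton_add_one h0 hfin, ← hbij.image_eq,
    Set.InjOn.ncard_image hbij.injOn]

end GiventalPolytope

end

theorem mainTheorem3 (N n k m : ℕ) (d : Fin k → ℕ) (hd : ∀ i, 1 ≤ d i)
    (f : Fin k → MvPolynomial (Fin (N + 1)) ℂ) (hf : ∀ i, (f i).IsHomogeneous (d i))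
    (hn : n + k = N)
    (hX : SmoothOfRelativeDimension n
      (hypersurfacesIntersection d f hf ↘ Spec (CommRingCat.of ℂ)))
    (hm : m + ∑ i, d i = N + 1) (hFano : 1 ≤ m) :
    (boundaryLatticePoints (dualPolytope (newtonPolytope (giventalPolynomial d m)))).Finite ∧
    Module.Finite ℂ (anticanonicalSections (hypersurfacesIntersection d f hf) n) ∧
    ((boundaryLatticePoints
        (dualPolytope (newtonPolytope (giventalPolynomial d m)))).ncard : ℤ) =
      (Module.finrank ℂ (anticanonicalSections (hypersurfacesIntersection d f hf) n) : ℤ) - 1 := by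
  have hJ : ∀ z : Fin (N + 1) → ℂ, z ≠ 0 → (∀ j, eval z (f j) = 0) →
      LinearIndependent ℂ fun j l ↦ eval z (pderiv l (f j)) :=
    fun z hz hfz ↦ linearIndependent_gradient hf hn hX hz hfz
  have hprefix : prefixIdeal f k = Ideal.span (Set.range f) := by
    rw [prefixIdeal, ← Set.image_univ]
    congr 2
    ext j
    simp
  obtain ⟨hfin, hcard⟩ := ncard_boundaryLatticePoints_giventalPolynomial (d := d) hd hFano
  obtain ⟨E⟩ := nonempty_quotientPart_equiv_anticanonicalSections hf hd hn hm hFano hJ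
  have hrank : Module.finrank ℂ (anticanonicalSections (hypersurfacesIntersection d f hf) n) =
      (avoidingMonomials (block d m) m k).ncard := by
    rw [← E.finrank_eq, ← hprefix]
    exact finrank_quotientPart_prefixIdeal hf (mem_prefixIdeal_of_mul_mem hf hd hJ hn)
      (by rw [card_blockVar hd hFano, hm, Fintype.card_fin]) pairwise_disjoint_block
      (card_block hd) le_rfl m
  refine ⟨hfin, Module.Finite.equiv E, ?_⟩
  rw [hrank, ← hcard]
  push_cast
  ring
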